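/- There are an algorithm and a constant $C$ such that the following holds. Let $G=(V,E)$ be a finite connected simple graph with $n$ vertices and $m$ edges, and let $D_s, D_t$ be two dominating sets of $G$ of the same size $k$ (a set $D\subseteq V$ is dominating if every vertex is in $D$ or adjacent to a vertex of $D$). Given $G$, $D_s$ and $D_t$, the algorithm computes, in at most $C\,(n^{3.5}+n^2m)$ steps, a reconfiguration sequence from $D_s$ to $D_t$ under $(k,1),(k-2,2)$-Token Jumping together with its moves; that is, it computes dominating sets $D_s=D_0,D_1,\dots,D_\ell=D_t$ of size $k$ and, for each $i<\ell$, a bijection $f_i:D_i\to D_{i+1}$ such that $\mathrm{dist}_G(v,f_i(v))\le 2$ for all $v\in D_i$ and $\mathrm{dist}_G(v,f_i(v))\le 1$ for all but at most $\max(k-2,0)$ of the vertices $v\in D_i$. If $G$ has diameter at most $d$, then the number of moves satisfies $\ell\le C\,n\,d$. Here an algorithm is a program of a unit-cost word RAM (words of $O(\log n)$ bits; operations $+$, truncated $-$, $\times$, comparisons, indirect memory access, conditionals and loops). The graph has vertex set $\{0,\dots,n-1\}$ and is given by its adjacency matrix, $D_s$ and $D_t$ by characteristic vectors; the output is the number $\ell$,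 the characteristic vectors of $D_0,\dots,D_\ell$, and the values $f_i(v)$ for $i<\ell$, $v\in D_i$. -/

import Mathlib

/-! Dominating sets, moves and reconfiguration sequences -/

namespace TokenReconf

variable {V : Type*}

/-- Every vertex is in `D` or is adjacent to some vertex of `D`. -/
def IsDominating (G : SimpleGraph V) (D : Finset V) : Prop :=
  ∀ v, v ∈ D ∨ ∃ u ∈ D, G.Adj v u

/-- `f` is a move from `A` to `B` under `(k, 1), (k', d)`-Token Jumping, where `k` is the number of
all tokens: `f` restricts to a bijection from `A` to `B`, all tokens outside some set of at most
`k'` tokens move by distance at most `1`, and the tokens of this set by distance at most `d`. -/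
def IsMove [DecidableEq V] (G : SimpleGraph V) (k' d : ℕ) (A B : Finset V) (f : V → V) : Prop :=
  Set.BijOn f A B ∧
    ∃ S ⊆ A, S.card ≤ k' ∧ (∀ v ∈ A \ S, G.edist v (f v) ≤ 1) ∧ ∀ v ∈ S, G.edist v (f v) ≤ d

/-- `D 0, …, D l` is a reconfiguration sequence from `A` to `B` under
`(k, 1), (k', d)`-Token Jumping with `l` moves, the `i`-th of which is the move `f i` from `D i` to
`D (i + 1)`. All its members are feasible, that is, they satisfy `P`. -/
structure IsReconfSequence [DecidableEq V] (G : SimpleGraph V) (P : Finset V → Prop) (k' d : ℕ)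
    (A B : Finset V) (l : ℕ) (D : ℕ → Finset V) (f : ℕ → V → V) : Prop where
  start : D 0 = A
  finish : D l = B
  feasible : ∀ i ≤ l, P (D i)
  move : ∀ i < l, IsMove G k' d (D i) (D (i + 1)) (f i)

end TokenReconf

/-! A word RAM with unit-cost instructions, written as structured programs -/

namespace WordRAM

/-- The arithmetic operations and tests of the machine. -/
inductive BinOp
  | add
  | sub
  | mul
  | lt
  | eq

/-- Subtraction is truncated at `0`; a test has value `1` (true) or `0` (false). -/
def BinOp.eval : BinOp → ℕ → ℕ → ℕ
  | .add, a, b => a + b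
  | .sub, a, b => a - b
  | .mul, a, b => a * b
  | .lt, a, b => if a < b then 1 else 0
  | .eq, a, b => if a = b then 1 else 0

/-- A memory state: registers, addressed by constants of the program, and arrays, where the name of
an array is a constant of the program and the index into it is computed. -/
structure State where
  reg : ℕ → ℕ
  arr : ℕ → ℕ → ℕ

/-- Expressions: constants, registers, array entries and operations. -/
inductive Expr
  | lit (c : ℕ)
  | reg (x : ℕ)
  | read (a : ℕ) (i : Expr)
  | op (o : BinOp) (e₁ e₂ : Expr)

/-- The value of an expression. -/
def Expr.eval (s : State) : Expr → ℕ
  | .lit c => c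
  | .reg x => s.reg x
  | .read a i => s.arr a (i.eval s)
  | .op o e₁ e₂ => o.eval (e₁.eval s) (e₂.eval s)

/-- The number of unit-cost steps that it takes to evaluate an expression. -/
def Expr.cost : Expr → ℕ
  | .lit _ => 1
  | .reg _ => 1
  | .read _ i => i.cost + 1
  | .op _ e₁ e₂ => e₁.cost + e₂.cost + 1

/-- All values that occur in the evaluation of an expression (array indices included) are at most
`W`, that is, they fit into a machine word. -/
def Expr.Fits (W : ℕ) (s : State) : Expr → Prop
  | .lit c => c ≤ W
  | .reg x => s.reg x ≤ W
  | .read a i => i.Fits W s ∧ s.arr a (i.eval s) ≤ W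
  | .op o e₁ e₂ => e₁.Fits W s ∧ e₂.Fits W s ∧ o.eval (e₁.eval s) (e₂.eval s) ≤ W

/-- Programs. In `ite` and `while`, a condition holds if its value is not `0`. -/
inductive Prog
  | skip
  | assign (x : ℕ) (e : Expr)
  | write (a : ℕ) (i e : Expr)
  | seq (p q : Prog)
  | ite (e : Expr) (p q : Prog)
  | while (e : Expr) (p : Prog)

/-- Put `v` into register `x`. -/
def State.setReg (s : State) (x v : ℕ) : State :=
  { s with reg := Function.update s.reg x v }

/-- Put `v` into entry `i` of array `a`. -/
def State.setArr (s : State) (a i v : ℕ) : State :=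
  { s with arr := Function.update s.arr a (Function.update (s.arr a) i v) }

/-- `Exec W p s t s'`: started in state `s`, the program `p` halts in state `s'` after exactly `t`
steps, and no value that it computes on the way exceeds `W` (a program that would exceed `W` gets
stuck and has no execution). -/
inductive Exec (W : ℕ) : Prog → State → ℕ → State → Prop
  | skip (s : State) : Exec W .skip s 1 s
  | assign (x : ℕ) (e : Expr) (s : State) (he : e.Fits W s) :
      Exec W (.assign x e) s (e.cost + 1) (s.setReg x (e.eval s))
  | write (a : ℕ) (i e : Expr) (s : State) (hi : i.Fits W s) (he : e.Fits W s) :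
      Exec W (.write a i e) s (i.cost + e.cost + 1) (s.setArr a (i.eval s) (e.eval s))
  | seq (p q : Prog) (s s' s'' : State) (t t' : ℕ) (hp : Exec W p s t s')
      (hq : Exec W q s' t' s'') : Exec W (.seq p q) s (t + t') s''
  | ite_true (e : Expr) (p q : Prog) (s s' : State) (t : ℕ) (he : e.Fits W s)
      (h : e.eval s ≠ 0) (hp : Exec W p s t s') : Exec W (.ite e p q) s (e.cost + 1 + t) s'
  | ite_false (e : Expr) (p q : Prog) (s s' : State) (t : ℕ) (he : e.Fits W s)
      (h : e.eval s = 0) (hq : Exec W q s t s') : Exec W (.ite e p q) s (e.cost + 1 + t) s'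
  | while_false (e : Expr) (p : Prog) (s : State) (he : e.Fits W s) (h : e.eval s = 0) :
      Exec W (.while e p) s (e.cost + 1) s
  | while_true (e : Expr) (p : Prog) (s s' s'' : State) (t t' : ℕ) (he : e.Fits W s)
      (h : e.eval s ≠ 0) (hp : Exec W p s t s') (hw : Exec W (.while e p) s' t' s'') :
      Exec W (.while e p) s (e.cost + 1 + t + t') s''

end WordRAM

/-! Encoding of instances and of reconfiguration sequences in the memory of the machine -/

namespace TokenReconf

open Classical in
/-- The initial memory: register `0` holds the number `n` of vertices, array `0` the adjacency
matrix of `G` row by row, arrays `1` and `2` the characteristic vectors of `A` and `B`; everything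
else is `0`. -/
noncomputable def inputState {n : ℕ} (G : SimpleGraph (Fin n)) (A B : Finset (Fin n)) :
    WordRAM.State where
  reg := fun x => if x = 0 then n else 0
  arr := fun a i =>
    if a = 0 then (if ∃ u v : Fin n, i = u * n + v ∧ G.Adj u v then 1 else 0)
    else if a = 1 then (if ∃ v ∈ A, i = (v : ℕ) then 1 else 0)
    else if a = 2 then (if ∃ v ∈ B, i = (v : ℕ) then 1 else 0)
    else 0

/-- The final memory holds a sequence `D 0, …, D l` with its moves `f 0, …, f (l - 1)`: register `1`
holds `l`, array `3` the characteristic vectors of `D 0, …, D l` one after another, and entry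
`i * n + v` of array `4` holds `f i v` for each `i < l` and each `v` in `D i`. -/
def IsOutput {n : ℕ} (s : WordRAM.State) (l : ℕ) (D : ℕ → Finset (Fin n))
    (f : ℕ → Fin n → Fin n) : Prop :=
  s.reg 1 = l ∧
    (∀ i ≤ l, ∀ v : Fin n, s.arr 3 (i * n + v) = if v ∈ D i then 1 else 0) ∧
    ∀ i < l, ∀ v ∈ D i, s.arr 4 (i * n + v) = f i v

end TokenReconf

/-! ### Programs with bounded loops -/

namespace WordRAM

/-! Let `N` stand for distance at most 1 and `H` for distance at most 2, and put `X = Ds \ Dt`, `Y =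
Dt \ Ds`. If `u ∈ Ds` and `b ∈ Dt` dominate the same vertex, then `H u b`. The heart of the proof is
a partial matching of `X` with `Y` along `H`, split into two involutions `σ` and `τ` of disjoint
support, such that `σ(Ds)` and `τ(Dt)` contain a common dominating set. Then `Ds → σ(Ds)` and `τ(Dt)
→ Dt` are single moves, and between the two images the tokens can travel one at a time, because the
common part dominates all along.

The matching comes from an auction: an unmatched element of `X` takes its cheapest neighbour in `Y`,
whose price rises by one, and gives up ("dead") when all its neighbours cost at least `n`. A matched
element thus pays at most one more than the price of any neighbour. As `Y` has fewer than `n`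
elements, some `p < n` is not a price of an element of `Y`. Cutting the matching at `p` works: when
an element of `Ds` is dropped because it is dead or its partner costs more than `p`, all its
neighbours in `Y` cost at least `p`, hence more than `p`, and these are all taken in
(`Auction.exists_core`). Rounds are counted by the potential "sum of prices plus number of dead
elements", which stays below `n²` while the auction lasts (`Auction.potential_lt`).

The two big moves only guarantee distance 2 for every token. To get two slow tokens, the targets are
permuted along a cycle of a digraph on the tokens, whose arcs say that a token is adjacent or equal
to the target of another one. A cycle of length at least 2 makes all its tokens slow; a sink is slow
already because the other set dominates. Doing this once along outgoing and once along incoming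
proximity yields two different slow tokens, or the only token (`bijOn_rotate_forward`,
`bijOn_rotate_backward`).

A single token travels along a path in a breadth-first search tree. Where the path meets occupied
vertices, the whole chain of tokens advances simultaneously by one step, so that the travelling
token seems to jump to the next free vertex (`run_stepToken`). With tree depths bounded by the
diameter `d`, each token needs at most `2d` moves, which gives `2 + 2nd` in total.

The program uses only loops of length `n`, nested three deep, so it takes `O(n³)` steps, which lies
within the required bound. Values stored in memory grow only additively, hence stay polynomial in
`n` (`FProg.exists_exec`). -/

@[simp] theorem State.setReg_reg (s : State) (x v y : ℕ) :
    (s.setReg x v).reg y = if y = x then v else s.reg y := by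
  simp [State.setReg, Function.update_apply]

@[simp] theorem State.setReg_arr (s : State) (x v : ℕ) : (s.setReg x v).arr = s.arr := rfl

@[simp] theorem State.setArr_reg (s : State) (a i v : ℕ) : (s.setArr a i v).reg = s.reg := rfl

@[simp] theorem State.setArr_arr (s : State) (a i v b : ℕ) :
    (s.setArr a i v).arr b = if b = a then Function.update (s.arr a) i v else s.arr b := by
  simp [State.setArr, Function.update_apply]

/-- Programs all of whose loops run a register from `0` to `n - 1`, where register `0` holds `n`. -/
inductive FProg
  | skip
  | assign (x : ℕ) (e : Expr)
  | write (a : ℕ) (i e : Expr)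
  | seq (p q : FProg)
  | ite (e : Expr) (p q : FProg)
  | loop (x : ℕ) (p : FProg)

namespace FProg

/-- The program of the machine. -/
def compile : FProg → Prog
  | skip => .skip
  | assign x e => .assign x e
  | write a i e => .write a i e
  | seq p q => .seq p.compile q.compile
  | ite e p q => .ite e p.compile q.compile
  | loop x p => .seq (.assign x (.lit 0)) (.while (.op .lt (.reg x) (.reg 0))
      (.seq p.compile (.assign x (.op .add (.reg x) (.lit 1)))))

/-- The final state as a function of the initial state. -/
def run : FProg → State → State
  | skip => fun s => s
  | assign x e => fun s => s.setReg x (e.eval s)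
  | write a i e => fun s => s.setArr a (i.eval s) (e.eval s)
  | seq p q => fun s => q.run (p.run s)
  | ite e p q => fun s => if e.eval s ≠ 0 then p.run s else q.run s
  | loop x p => fun s =>
      (fun s' => (p.run s').setReg x ((p.run s').reg x + 1))^[s.reg 0] (s.setReg x 0)

/-- The registers that may be changed. -/
def regs : FProg → List ℕ
  | skip => []
  | assign x _ => [x]
  | write _ _ _ => []
  | seq p q => p.regs ++ q.regs
  | ite _ p q => p.regs ++ q.regs
  | loop x p => x :: p.regs

/-- The arrays that may be changed. -/
def arrs : FProg → List ℕ
  | skip => []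
  | assign _ _ => []
  | write a _ _ => [a]
  | seq p q => p.arrs ++ q.arrs
  | ite _ p q => p.arrs ++ q.arrs
  | loop _ p => p.arrs

end FProg

/-- Outside the registers `rs` and the arrays `as` the two states agree. -/
structure Frame (rs as : List ℕ) (s s' : State) : Prop where
  reg : ∀ x ∉ rs, s'.reg x = s.reg x
  arr : ∀ a ∉ as, s'.arr a = s.arr a

theorem Frame.trans {rs as : List ℕ} {s s' s'' : State} (h : Frame rs as s s')
    (h' : Frame rs as s' s'') : Frame rs as s s'' :=
  ⟨fun x hx => (h'.reg x hx).trans (h.reg x hx), fun a ha => (h'.arr a ha).trans (h.arr a ha)⟩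

theorem Frame.mono {rs as rs' as' : List ℕ} {s s' : State} (h : Frame rs as s s')
    (hr : rs ⊆ rs') (ha : as ⊆ as') : Frame rs' as' s s' :=
  ⟨fun x hx => h.reg x fun h' => hx (hr h'), fun a ha' => h.arr a fun h' => ha' (ha h')⟩

namespace FProg

theorem frame_iterate {rs as : List ℕ} (F : State → State) (hF : ∀ s, Frame rs as s (F s))
    (m : ℕ) (s : State) : Frame rs as s (F^[m] s) := by
  induction m generalizing s with
  | zero => exact ⟨fun _ _ => rfl, fun _ _ => rfl⟩
  | succ m ih => exact (hF s).trans (ih (F s))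

/-- The lists of changed registers and arrays are computed from the program text, so that
noninterference of program parts can later mostly be settled by `decide`. -/
theorem frame (p : FProg) (s : State) : Frame p.regs p.arrs s (p.run s) := by
  induction p generalizing s with
  | skip => exact ⟨fun _ _ => rfl, fun _ _ => rfl⟩
  | assign x e =>
    refine ⟨fun y hy => ?_, fun _ _ => rfl⟩
    have : y ≠ x := by simpa [regs] using hy
    simp [run, this]
  | write a i e =>
    refine ⟨fun y hy => rfl, fun b hb => ?_⟩
    have : b ≠ a := by simpa [arrs] using hb
    simp [run, this]
  | seq p q hp hq =>
    exact ((hp s).mono (by simp [regs]) (by simp [arrs])).trans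
      ((hq (p.run s)).mono (by simp [regs]) (by simp [arrs]))
  | ite e p q hp hq =>
    by_cases h : e.eval s = 0
    · simpa [run, h] using (hq s).mono (by simp [regs]) (by simp [arrs])
    · simpa [run, h] using (hp s).mono (by simp [regs]) (by simp [arrs])
  | loop x p hp =>
    have hset : ∀ (s : State) (v : ℕ), Frame (loop x p).regs (loop x p).arrs s (s.setReg x v) := by
      intro s v
      refine ⟨fun y hy => ?_, fun _ _ => rfl⟩
      have : y ≠ x := by
        rintro rfl
        simp [regs] at hy
      simp [this]
    refine (hset s 0).trans (frame_iterate _ (fun s' => ?_) _ _)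
    exact ((hp s').mono (by simp [regs]) (by simp [arrs])).trans (hset _ _)

/-- The invariant rule for loops. -/
theorem loop_inv {x : ℕ} {p : FProg} {s : State} (I : ℕ → State → Prop)
    (hx : x ∉ 0 :: p.regs) (h0 : I 0 (s.setReg x 0))
    (hstep : ∀ i s', i < s.reg 0 → s'.reg x = i → Frame (x :: p.regs) p.arrs s s' → I i s' →
      I (i + 1) ((p.run s').setReg x (i + 1))) :
    I (s.reg 0) ((loop x p).run s) := by
  have hx' : x ∉ p.regs := fun h => hx (List.mem_cons_of_mem _ h)
  -- The value of the counter and the frame condition join the invariant, so that `hstep` may assume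
  -- them.
  suffices H : ∀ m ≤ s.reg 0,
      let s' := (fun s' => (p.run s').setReg x ((p.run s').reg x + 1))^[m] (s.setReg x 0)
      s'.reg x = m ∧ Frame (x :: p.regs) p.arrs s s' ∧ I m s' from (H _ le_rfl).2.2
  have hset : ∀ (s : State) (v : ℕ), Frame (x :: p.regs) p.arrs s (s.setReg x v) := by
    intro s v
    refine ⟨fun y hy => ?_, fun _ _ => rfl⟩
    have : y ≠ x := by
      rintro rfl
      simp at hy
    simp [this]
  intro m
  induction m with
  | zero => intro _; exact ⟨by simp, hset s 0, h0⟩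
  | succ m ih =>
    intro hm
    obtain ⟨h1, h2, h3⟩ := ih (by omega)
    simp only [Function.iterate_succ_apply']
    set s' := (fun s' => (p.run s').setReg x ((p.run s').reg x + 1))^[m] (s.setReg x 0)
    have hr : (p.run s').reg x = m := by rw [(p.frame s').reg x hx', h1]
    rw [hr]
    refine ⟨by simp, ?_, hstep m s' (by omega) h1 h2 h3⟩
    exact (h2.trans ((p.frame s').mono (by simp) (by simp))).trans (hset _ _)

end FProg

/-! ### Time and word size -/

/-- Every register and every array entry is at most `M`. -/
def State.Bdd (M : ℕ) (s : State) : Prop := (∀ x, s.reg x ≤ M) ∧ ∀ a i, s.arr a i ≤ M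

theorem State.Bdd.mono {M M' : ℕ} {s : State} (h : s.Bdd M) (hM : M ≤ M') : s.Bdd M' :=
  ⟨fun x => (h.1 x).trans hM, fun a i => (h.2 a i).trans hM⟩

theorem State.Bdd.setReg {M : ℕ} {s : State} (h : s.Bdd M) {v : ℕ} (hv : v ≤ M) (x : ℕ) :
    (s.setReg x v).Bdd M := by
  refine ⟨fun y => ?_, h.2⟩
  rw [State.setReg_reg]
  split_ifs
  · exact hv
  · exact h.1 y

theorem State.Bdd.setArr {M : ℕ} {s : State} (h : s.Bdd M) {v : ℕ} (hv : v ≤ M) (a i : ℕ) :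
    (s.setArr a i v).Bdd M := by
  refine ⟨h.1, fun b j => ?_⟩
  rw [State.setArr_arr]
  split_ifs
  · rw [Function.update_apply]
    split_ifs
    · exact hv
    · exact h.2 a j
  · exact h.2 b j

/-! ### Bounds for the values of expressions -/

namespace Expr

/-- A bound for the values of literals and tests. -/
def const : Expr → Option ℕ
  | lit c => some c
  | op .lt _ _ => some 1
  | op .eq _ _ => some 1
  | _ => none

/-- A number `c` such that the value exceeds the largest value in the memory by at most `c`. -/
def inc : Expr → Option ℕ
  | lit c => some c
  | reg _ => some 0
  | read _ _ => some 0
  | op .add e₁ e₂ => e₁.inc.bind fun c => e₂.const.map fun d => c + d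
  | op .sub e₁ _ => e₁.inc
  | op .mul _ _ => none
  | op .lt _ _ => some 1
  | op .eq _ _ => some 1

/-- The value is at most `(M + 2) ^ e.size` if the memory is bounded by `M`. -/
def size : Expr → ℕ
  | lit c => c + 1
  | reg _ => 1
  | read _ i => i.size + 1
  | op _ e₁ e₂ => e₁.size + e₂.size + 1

theorem eval_le_const {e : Expr} {s : State} {c : ℕ} (h : e.const = some c) : e.eval s ≤ c := by
  match e, h with
  | lit _, h => simp only [const, Option.some.injEq] at h; simp [eval, h]
  | op .lt _ _, h =>
    simp only [const, Option.some.injEq] at h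
    simp only [eval, BinOp.eval]; split_ifs <;> omega
  | op .eq _ _, h =>
    simp only [const, Option.some.injEq] at h
    simp only [eval, BinOp.eval]; split_ifs <;> omega

theorem eval_le_inc {M : ℕ} {s : State} (hs : s.Bdd M) (e : Expr) {c : ℕ} (h : e.inc = some c) :
    e.eval s ≤ M + c := by
  induction e generalizing c with
  | lit d => simp only [inc, Option.some.injEq] at h; simp [eval, h]
  | reg x => exact (hs.1 x).trans (Nat.le_add_right _ _)
  | read a i _ => exact (hs.2 a _).trans (Nat.le_add_right _ _)
  | op o e₁ e₂ h₁ _ =>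
    match o, h with
    | .add, h =>
      simp only [inc, Option.bind_eq_some_iff, Option.map_eq_some_iff] at h
      obtain ⟨c₁, hc₁, c₂, hc₂, rfl⟩ := h
      have := h₁ hc₁
      have := eval_le_const (s := s) hc₂
      simp only [eval, BinOp.eval]
      omega
    | .sub, h =>
      simp only [inc] at h
      have := h₁ h
      simp only [eval, BinOp.eval]
      omega
    | .lt, h =>
      simp only [inc, Option.some.injEq] at h
      simp only [eval, BinOp.eval]; split_ifs <;> omega
    | .eq, h =>
      simp only [inc, Option.some.injEq] at h
      simp only [eval, BinOp.eval]; split_ifs <;> omega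

theorem size_pos (e : Expr) : 1 ≤ e.size := by
  cases e <;> simp [size]

theorem Fits.mono {W W' : ℕ} {s : State} (hW : W ≤ W') {e : Expr} (h : e.Fits W s) :
    e.Fits W' s := by
  induction e with
  | lit c => exact le_trans (b := W) h hW
  | reg x => exact le_trans (b := W) h hW
  | read a i hi => exact ⟨hi h.1, h.2.trans hW⟩
  | op o e₁ e₂ h₁ h₂ => exact ⟨h₁ h.1, h₂ h.2.1, h.2.2.trans hW⟩

theorem pow_le_pow_both {a b i j : ℕ} (hb : 0 < b) (hab : a ≤ b) (hij : i ≤ j) : a ^ i ≤ b ^ j :=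
  (Nat.pow_le_pow_left hab i).trans (Nat.pow_le_pow_right hb hij)

/-- Exponents add under multiplication; since both factors are at least 2, their product also
dominates sums and tests. The exponent depends on the expression only, not on the memory. -/
theorem fits_pow {M : ℕ} {s : State} (hs : s.Bdd M) (e : Expr) :
    e.Fits ((M + 2) ^ e.size) s ∧ e.eval s ≤ (M + 2) ^ e.size := by
  induction e with
  | lit c =>
    have : c ≤ (M + 2) ^ (c + 1) :=
      (Nat.lt_two_pow_self (n := c)).le.trans <| (Nat.pow_le_pow_left (by omega) c).trans <|
        Nat.pow_le_pow_right (by omega) (by omega)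
    exact ⟨this, this⟩
  | reg x =>
    have : s.reg x ≤ (M + 2) ^ 1 := by have := hs.1 x; rw [pow_one]; omega
    exact ⟨this, this⟩
  | read a i hi =>
    have h1 : (M + 2) ^ i.size ≤ (M + 2) ^ (i.size + 1) :=
      Nat.pow_le_pow_right (by omega) (by omega)
    have h2 : s.arr a (i.eval s) ≤ (M + 2) ^ (i.size + 1) :=
      ((hs.2 a _).trans (by omega : M ≤ M + 2)).trans (Nat.le_self_pow (by omega) _)
    exact ⟨⟨hi.1.mono h1, h2⟩, h2⟩
  | op o e₁ e₂ h₁ h₂ =>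
    have key : o.eval (e₁.eval s) (e₂.eval s) ≤ (M + 2) ^ (e₁.size + e₂.size + 1) := by
      have hp : (M + 2) ^ e₁.size * (M + 2) ^ e₂.size ≤ (M + 2) ^ (e₁.size + e₂.size + 1) := by
        rw [← pow_add]; exact Nat.pow_le_pow_right (by omega) (by omega)
      have h3 : 2 ≤ (M + 2) ^ e₁.size :=
        (by omega : 2 ≤ M + 2).trans (Nat.le_self_pow (by have := e₁.size_pos; omega) _)
      have h4 : 2 ≤ (M + 2) ^ e₂.size :=
        (by omega : 2 ≤ M + 2).trans (Nat.le_self_pow (by have := e₂.size_pos; omega) _)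
      have h5 := h₁.2
      have h6 := h₂.2
      refine le_trans ?_ hp
      generalize (M + 2) ^ e₁.size = A at *
      generalize (M + 2) ^ e₂.size = B at *
      cases o <;> simp only [BinOp.eval]
      · nlinarith
      · nlinarith [Nat.sub_le (e₁.eval s) (e₂.eval s)]
      · exact Nat.mul_le_mul h5 h6
      · split_ifs <;> nlinarith
      · split_ifs <;> nlinarith
    exact ⟨⟨h₁.1.mono (Nat.pow_le_pow_right (by omega) (by simp only [size]; omega)),
      h₂.1.mono (Nat.pow_le_pow_right (by omega) (by simp only [size]; omega)), key⟩, key⟩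

theorem fits_of_le {M W m : ℕ} {s : State} (hs : s.Bdd M) (e : Expr) (he : e.size ≤ m)
    (hW : (M + 2) ^ m ≤ W) : e.Fits W s :=
  (e.fits_pow hs).1.mono ((Nat.pow_le_pow_right (by omega) he).trans hW)

end Expr

/-! ### Bounds for the cost of programs -/

namespace FProg

/-- The expressions that are stored exceed the memory by at most a constant, and the registers of
the loops are not changed by their bodies. -/
def ok : FProg → Bool
  | skip => true
  | assign x e => e.inc.isSome && decide (x ≠ 0)
  | write _ _ e => e.inc.isSome
  | seq p q => p.ok && q.ok
  | ite _ p q => p.ok && q.ok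
  | loop x p => p.ok && decide (x ∉ 0 :: p.regs)

/-- A bound for the number of steps and for the growth of the values in the memory. -/
def bound (n : ℕ) : FProg → ℕ
  | skip => 1
  | assign _ e => e.cost + 1 + e.inc.getD 0
  | write _ i e => i.cost + e.cost + 1 + e.inc.getD 0
  | seq p q => p.bound n + q.bound n
  | ite e p q => e.cost + 1 + p.bound n + q.bound n
  | loop _ p => 6 + n * (p.bound n + 8)

/-- An exponent for the word size. -/
def size : FProg → ℕ
  | skip => 0
  | assign _ e => e.size
  | write _ i e => i.size + e.size
  | seq p q => p.size + q.size
  | ite e p q => e.size + p.size + q.size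
  | loop _ p => p.size + 4

/-- The nesting depth of the loops. -/
def depth : FProg → ℕ
  | skip => 0
  | assign _ _ => 0
  | write _ _ _ => 0
  | seq p q => max p.depth q.depth
  | ite _ p q => max p.depth q.depth
  | loop _ p => p.depth + 1

theorem zero_notMem_regs {p : FProg} (h : p.ok) : 0 ∉ p.regs := by
  induction p with
  | skip => simp [regs]
  | assign x e => simp only [ok, Bool.and_eq_true, decide_eq_true_eq] at h; simp [regs, h.2.symm]
  | write a i e => simp [regs]
  | seq p q hp hq => simp only [ok, Bool.and_eq_true] at h; simp [regs, hp h.1, hq h.2]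
  | ite e p q hp hq => simp only [ok, Bool.and_eq_true] at h; simp [regs, hp h.1, hq h.2]
  | loop x p hp =>
    simp only [ok, Bool.and_eq_true, decide_eq_true_eq, List.mem_cons, not_or] at h
    simp [regs, hp h.1, Ne.symm h.2.1]

/-- One number, `bound`, controls both time and growth of the memory: a store exceeds the memory by
a constant only, and this constant is charged like time. Products occur only in intermediate
results, for which the exponent `size` leaves room. -/
theorem exec (p : FProg) (hp : p.ok) (s : State) (M W : ℕ) (hs : s.Bdd M)
    (hW : (M + p.bound (s.reg 0) + 2) ^ p.size ≤ W) :
    ∃ t, Exec W p.compile s t (p.run s) ∧ t ≤ p.bound (s.reg 0) ∧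
      (p.run s).Bdd (M + p.bound (s.reg 0)) := by
  induction p generalizing s M with
  | skip => exact ⟨1, .skip s, le_rfl, hs.mono (Nat.le_add_right _ _)⟩
  | assign x e =>
    simp only [ok, Bool.and_eq_true] at hp
    obtain ⟨c, hc⟩ := Option.isSome_iff_exists.1 hp.1
    refine ⟨_, .assign x e s ?_, by simp [bound], ?_⟩
    · exact e.fits_of_le (hs.mono (Nat.le_add_right _ _)) le_rfl hW
    · refine (hs.mono (Nat.le_add_right _ _)).setReg ?_ x
      have := e.eval_le_inc hs hc
      simp only [bound, hc, Option.getD_some]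
      omega
  | write a i e =>
    simp only [ok] at hp
    obtain ⟨c, hc⟩ := Option.isSome_iff_exists.1 hp
    refine ⟨_, .write a i e s ?_ ?_, by simp [bound], ?_⟩
    · exact i.fits_of_le (hs.mono (Nat.le_add_right _ _)) (by simp [size]) hW
    · exact e.fits_of_le (hs.mono (Nat.le_add_right _ _)) (by simp [size]) hW
    · refine (hs.mono (Nat.le_add_right _ _)).setArr ?_ a _
      have := e.eval_le_inc hs hc
      simp only [bound, hc, Option.getD_some]
      omega
  | seq p q hp' hq' =>
    simp only [ok, Bool.and_eq_true] at hp
    have h0 := (p.frame s).reg 0 (zero_notMem_regs hp.1)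
    simp only [bound, size] at hW
    obtain ⟨t, h1, h2, h3⟩ := hp' hp.1 s M hs
      ((Expr.pow_le_pow_both (by omega) (by omega) (by omega)).trans hW)
    obtain ⟨t', h4, h5, h6⟩ := hq' hp.2 (p.run s) _ h3
      (by rw [h0]; exact (Expr.pow_le_pow_both (by omega) (by omega) (by omega)).trans hW)
    rw [h0] at h5 h6
    exact ⟨t + t', .seq _ _ _ _ _ _ _ h1 h4, by simp only [bound]; omega,
      h6.mono (by simp only [bound]; omega)⟩
  | ite e p q hp' hq' =>
    simp only [ok, Bool.and_eq_true] at hp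
    simp only [bound, size] at hW
    have he : e.Fits W s := e.fits_of_le (hs.mono (Nat.le_add_right _ _)) (by omega) hW
    by_cases h : e.eval s = 0
    · obtain ⟨t, h1, h2, h3⟩ := hq' hp.2 s M hs
        ((Expr.pow_le_pow_both (by omega) (by omega) (by omega)).trans hW)
      simp only [run, h, ne_eq, not_true_eq_false, if_false, bound]
      exact ⟨_, .ite_false _ _ _ _ _ _ he h h1, by omega, h3.mono (by omega)⟩
    · obtain ⟨t, h1, h2, h3⟩ := hp' hp.1 s M hs
        ((Expr.pow_le_pow_both (by omega) (by omega) (by omega)).trans hW)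
      simp only [run, h, ne_eq, not_false_eq_true, if_true, bound]
      exact ⟨_, .ite_true _ _ _ _ _ _ he h h1, by omega, h3.mono (by omega)⟩
  | loop x p hp' =>
    simp only [ok, Bool.and_eq_true, decide_eq_true_eq] at hp
    obtain ⟨hok, hx⟩ := hp
    have hx0 : x ≠ 0 := by rintro rfl; simp at hx
    have hxp : x ∉ p.regs := fun h => hx (List.mem_cons_of_mem _ h)
    simp only [bound, size] at hW ⊢
    set n := s.reg 0 with hn
    set b := p.bound n with hb
    -- `m` is the number of rounds left. A round costs `b` for the body and 4 each for the test and
    -- the increment, and the failing test costs 4. The memory is allowed to grow by `b` for the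
    -- body and 1 for the counter.
    suffices H : ∀ m (s : State), s.reg 0 = n → s.reg x + m = n →
        s.Bdd (M + s.reg x * (b + 1)) →
        ∃ t, Exec W (.while (.op .lt (.reg x) (.reg 0))
          (.seq p.compile (.assign x (.op .add (.reg x) (.lit 1))))) s t
            ((fun s' => (p.run s').setReg x ((p.run s').reg x + 1))^[m] s) ∧
          t ≤ 4 + m * (b + 8) ∧
          ((fun s' => (p.run s').setReg x ((p.run s').reg x + 1))^[m] s).Bdd
            (M + n * (b + 1)) by
      obtain ⟨t, h1, h2, h3⟩ := H n (s.setReg x 0) (by simp [Ne.symm hx0, hn]) (by simp)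
        (by simpa using hs.setReg (Nat.zero_le M) x)
      refine ⟨2 + t, .seq _ _ _ _ _ _ _ (.assign x (.lit 0) s (Nat.zero_le _)) h1, by omega,
        h3.mono ?_⟩
      nlinarith
    intro m
    induction m with
    | zero =>
      intro s h0 hm hs
      refine ⟨_, .while_false _ _ _ ?_ ?_, by simp [Expr.cost], ?_⟩
      · refine Expr.fits_of_le hs _ (m := p.size + 4) (by simp [Expr.size]) ?_
        refine (Nat.pow_le_pow_left ?_ _).trans hW
        have : s.reg x = n := by omega
        rw [this]; nlinarith
      · simp [Expr.eval, BinOp.eval, h0]; omega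
      · have : s.reg x = n := by omega
        simpa [this] using hs
    | succ m ih =>
      intro s h0 hm hs
      have hlt : s.reg x < n := by omega
      have hmul : s.reg x * (b + 1) + (b + 1) ≤ n * (b + 1) := by nlinarith
      have hmul' : n * (b + 1) ≤ n * (b + 8) := Nat.mul_le_mul_left _ (by omega)
      obtain ⟨t, h1, h2, h3⟩ := hp' hok s _ hs (by
        rw [h0]
        refine (Expr.pow_le_pow_both (by omega) ?_ (by omega : p.size ≤ p.size + 4)).trans hW
        omega)
      rw [h0] at h2 h3
      have hr : (p.run s).reg x = s.reg x := (p.frame s).reg x hxp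
      have hr0 : (p.run s).reg 0 = n := by rw [(p.frame s).reg 0 (zero_notMem_regs hok), h0]
      obtain ⟨t', h4, h5, h6⟩ := ih ((p.run s).setReg x ((p.run s).reg x + 1))
        (by simp [Ne.symm hx0, hr0]) (by simp [hr]; omega)
        (by
          have h7 := h3.mono (M' := M + (s.reg x + 1) * (b + 1)) (by
            rw [add_mul, one_mul, ← hb]; omega)
          have := h7.setReg (v := (p.run s).reg x + 1) (by rw [hr]; nlinarith) x
          simpa [hr] using this)
      refine ⟨_, .while_true _ _ _ _ _ _ _ ?_ ?_
        (.seq _ _ _ _ _ _ _ h1 (.assign x (.op .add (.reg x) (.lit 1)) _ ?_)) h4, ?_, h6⟩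
      · refine Expr.fits_of_le hs _ (m := p.size + 4) (by simp [Expr.size]) ?_
        refine (Nat.pow_le_pow_left ?_ _).trans hW
        omega
      · simp [Expr.eval, BinOp.eval, h0, hlt]
      · refine Expr.fits_of_le h3 _ (m := p.size + 4) (by simp [Expr.size]) ?_
        refine (Nat.pow_le_pow_left ?_ _).trans hW
        omega
      · simp only [Expr.cost]
        have : (m + 1) * (b + 8) = m * (b + 8) + (b + 8) := by ring
        omega

theorem bound_le (p : FProg) : ∃ K, ∀ n, p.bound n ≤ K * (n + 1) ^ p.depth := by
  induction p with
  | skip => exact ⟨1, fun n => by simp [bound, depth]⟩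
  | assign x e => exact ⟨e.cost + 1 + e.inc.getD 0, fun n => by simp [bound, depth]⟩
  | write a i e => exact ⟨i.cost + e.cost + 1 + e.inc.getD 0, fun n => by simp [bound, depth]⟩
  | seq p q hp hq =>
    obtain ⟨K, hK⟩ := hp
    obtain ⟨L, hL⟩ := hq
    refine ⟨K + L, fun n => ?_⟩
    have h1 : (n + 1) ^ p.depth ≤ (n + 1) ^ (max p.depth q.depth) :=
      Nat.pow_le_pow_right (by omega) (by omega)
    have h2 : (n + 1) ^ q.depth ≤ (n + 1) ^ (max p.depth q.depth) :=
      Nat.pow_le_pow_right (by omega) (by omega)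
    simp only [bound, depth]
    nlinarith [hK n, hL n, Nat.mul_le_mul_left K h1, Nat.mul_le_mul_left L h2]
  | ite e p q hp hq =>
    obtain ⟨K, hK⟩ := hp
    obtain ⟨L, hL⟩ := hq
    refine ⟨e.cost + 1 + K + L, fun n => ?_⟩
    have h1 : (n + 1) ^ p.depth ≤ (n + 1) ^ (max p.depth q.depth) :=
      Nat.pow_le_pow_right (by omega) (by omega)
    have h2 : (n + 1) ^ q.depth ≤ (n + 1) ^ (max p.depth q.depth) :=
      Nat.pow_le_pow_right (by omega) (by omega)
    have h3 : 1 ≤ (n + 1) ^ (max p.depth q.depth) := Nat.one_le_pow _ _ (by omega)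
    simp only [bound, depth]
    nlinarith [hK n, hL n, Nat.mul_le_mul_left K h1, Nat.mul_le_mul_left L h2,
      Nat.mul_le_mul_left (e.cost + 1) h3]
  | loop x p hp =>
    obtain ⟨K, hK⟩ := hp
    refine ⟨K + 14, fun n => ?_⟩
    have h3 : 1 ≤ (n + 1) ^ p.depth := Nat.one_le_pow _ _ (by omega)
    have h4 := hK n
    simp only [bound, depth, pow_succ]
    generalize (n + 1) ^ p.depth = A at *
    have h5 : n * (p.bound n + 8) ≤ n * (K * A + 8 * A) := Nat.mul_le_mul_left _ (by omega)
    nlinarith [Nat.zero_le (K * A), Nat.zero_le (n * A)]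

/-- A program with bounded loops of nesting depth `d` runs in `O((n + 1) ^ d)` steps with words of
`O(log n)` bits. -/
theorem exists_exec (p : FProg) (hp : p.ok) : ∃ K c : ℕ, ∀ s : State, s.Bdd (s.reg 0 + 1) →
    ∃ t, Exec ((s.reg 0 + 2) ^ c) p.compile s t (p.run s) ∧
      t ≤ K * (s.reg 0 + 1) ^ p.depth := by
  obtain ⟨K, hK⟩ := p.bound_le
  -- The constant `K` is absorbed into the exponent through `K + 2 < (n + 2) ^ (K + 2)`, which puts
  -- memory plus growth below `(n + 2) ^ (K + p.depth + 3)`.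
  refine ⟨K, (K + p.depth + 3) * p.size, fun s hs => ?_⟩
  obtain ⟨t, h1, h2, -⟩ := p.exec hp s _ ((s.reg 0 + 2) ^ ((K + p.depth + 3) * p.size)) hs (by
    rw [pow_mul]
    refine Nat.pow_le_pow_left ?_ _
    have h3 := hK (s.reg 0)
    set n := s.reg 0
    have h4 : (n + 1) ^ p.depth ≤ (n + 2) ^ p.depth := Nat.pow_le_pow_left (by omega) _
    have h5 : 1 ≤ (n + 2) ^ p.depth := Nat.one_le_pow _ _ (by omega)
    have h6 : K + 2 < (n + 2) ^ (K + 2) :=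
      (Nat.lt_two_pow_self (n := K + 2)).trans_le (Nat.pow_le_pow_left (by omega) _)
    have h7 : (n + 2) ^ (K + p.depth + 3) =
        (n + 2) ^ (K + 2) * ((n + 2) ^ p.depth * (n + 2)) := by
      rw [← pow_succ, ← pow_add]; congr 1; omega
    rw [h7]
    have h8 : (K + 2) * ((n + 2) ^ p.depth * (n + 2)) ≤
        (n + 2) ^ (K + 2) * ((n + 2) ^ p.depth * (n + 2)) := Nat.mul_le_mul_right _ h6.le
    refine le_trans ?_ h8
    have h9 : p.bound n ≤ K * (n + 2) ^ p.depth := h3.trans (Nat.mul_le_mul_left _ h4)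
    generalize (n + 2) ^ p.depth = A at *
    have : K * A ≤ K * A * (n + 2) := Nat.le_mul_of_pos_right _ (by omega)
    nlinarith)
  exact ⟨t, h1, h2.trans (hK _)⟩

end FProg

end WordRAM

/-! ### Combinatorics of matchings and moves -/

namespace TokenReconf

open Set in
-- On `P`, `g'` is `g` after the permutation of `P` that acts as `τ` on `C` and trivially elsewhere.
theorem bijOn_comp_cycle {V : Type*} {g g' τ : V → V} {P Q C : Set V} (hg : BijOn g P Q)
    (hC : C ⊆ P) (hτ : BijOn τ C C) (h1 : ∀ x ∈ C, g' x = g (τ x)) (h2 : ∀ x ∉ C, g' x = g x) :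
    BijOn g' P Q := by
  classical
  have hρ : BijOn (fun x => if x ∈ C then τ x else x) P P := by
    refine ⟨fun x hx => ?_, fun x hx y hy hxy => ?_, fun y hy => ?_⟩
    · by_cases h : x ∈ C
      · simpa [h] using hC (hτ.mapsTo h)
      · simpa [h] using hx
    · by_cases h : x ∈ C <;> by_cases h' : y ∈ C <;> simp only [h, h', if_true, if_false] at hxy
      · exact hτ.injOn h h' hxy
      · exact absurd (hxy ▸ hτ.mapsTo h) h'
      · exact absurd (hxy ▸ hτ.mapsTo h') h
      · exact hxy
    · by_cases h : y ∈ C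
      · obtain ⟨x, hx, rfl⟩ := hτ.surjOn h
        exact ⟨x, hC hx, by simp [hx]⟩
      · exact ⟨y, hy, by simp [h]⟩
  refine (hg.comp hρ).congr fun x _ => ?_
  by_cases h : x ∈ C
  · simp [h, h1 x h]
  · simp [h, h2 x h]

/-- The forward orbit of a point. -/
def orbit {V : Type*} (h : V → V) (c : V) : Set V := {v | ∃ i, h^[i] c = v}

theorem self_mem_orbit {V : Type*} (h : V → V) (c : V) : c ∈ orbit h c := ⟨0, rfl⟩

theorem map_mem_orbit {V : Type*} {h : V → V} {c v : V} (hv : v ∈ orbit h c) :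
    h v ∈ orbit h c := by
  obtain ⟨i, rfl⟩ := hv
  exact ⟨i + 1, Function.iterate_succ_apply' h i c⟩

theorem orbit_subset {V : Type*} {h : V → V} {c : V} {P : Set V} (hP : ∀ x ∈ P, h x ∈ P)
    (hc : c ∈ P) : orbit h c ⊆ P := by
  rintro _ ⟨i, rfl⟩
  exact (show Set.MapsTo h P P from hP).iterate i hc

/-- All points of the orbit are periodic, so `h` is injective there; going once more around the
cycle provides preimages. -/
theorem bijOn_orbit {V : Type*} {h : V → V} {c : V} (hc : c ∈ Function.periodicPts h) :
    Set.BijOn h (orbit h c) (orbit h c) := by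
  have hsub : orbit h c ⊆ Function.periodicPts h := by
    rintro _ ⟨i, rfl⟩
    obtain ⟨j, hj, hp⟩ := hc
    exact ⟨j, hj, hp.apply_iterate i⟩
  refine ⟨fun v hv => map_mem_orbit hv, fun x hx y hy hxy => ?_, ?_⟩
  · exact (Function.bijOn_periodicPts h).injOn (hsub hx) (hsub hy) hxy
  · rintro _ ⟨i, rfl⟩
    obtain ⟨j, hj, hp⟩ := hc
    refine ⟨h^[i + j - 1] c, ⟨_, rfl⟩, ?_⟩
    rw [← Function.iterate_succ_apply' h, show (i + j - 1).succ = i + j by omega,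
      Function.iterate_add_apply, hp.eq]

/-- Iteration from `v` returns to `c` but cannot leave a fixed point. Hence on a cycle of length at
least 2, a function with `IsChoice` follows a genuine arc everywhere. -/
theorem eq_of_map_eq_of_mem_orbit {V : Type*} {h : V → V} {c v : V}
    (hc : c ∈ Function.periodicPts h) (hv : v ∈ orbit h c) (hf : h v = v) : v = c := by
  obtain ⟨i, rfl⟩ := hv
  obtain ⟨j, hj, hp⟩ := hc
  have h1 : ∀ k, h^[k] (h^[i] c) = h^[i] c := fun k => Function.iterate_fixed hf k
  have h2 := h1 (i * (j - 1))
  rw [← Function.iterate_add_apply, show i * (j - 1) + i = i * j by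
    obtain ⟨j, rfl⟩ := Nat.exists_eq_succ_of_ne_zero hj.ne'
    simp; ring] at h2
  have h3 : h^[i * j] c = c := by
    rw [mul_comm]; exact hp.mul_const i
  rw [← h2, h3]

theorem orbit_eq_singleton {V : Type*} {h : V → V} {c : V} (hf : h c = c) : orbit h c = {c} := by
  ext v
  exact ⟨fun ⟨i, hi⟩ => by rw [← hi, Function.iterate_fixed hf]; rfl,
    fun hv => hv ▸ self_mem_orbit h c⟩

/-- The minimal period is at most the number of vertices; this is why `n` steps of `rotate` cover
the whole cycle. -/
theorem exists_lt_card_iterate {V : Type*} [Fintype V] {h : V → V} {c v : V}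
    (hc : c ∈ Function.periodicPts h) (hv : v ∈ orbit h c) :
    ∃ i < Fintype.card V, h^[i] c = v := by
  obtain ⟨i, rfl⟩ := hv
  exact ⟨i % Function.minimalPeriod h c,
    (Nat.mod_lt _ (Function.minimalPeriod_pos_of_mem_periodicPts hc)).trans_le
      Function.minimalPeriod_le_card, Function.iterate_mod_minimalPeriod_eq⟩

/-- By the pigeonhole principle two of the first `card V + 1` iterates agree, and from the first of
them on everything is periodic. So `followArcs` ends on a cycle. -/
theorem iterate_card_mem_periodicPts {V : Type*} [Fintype V] (h : V → V) (s : V) :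
    h^[Fintype.card V] s ∈ Function.periodicPts h := by
  obtain ⟨i, j, hij, he⟩ := Fintype.exists_ne_map_eq_of_card_lt
    (fun i : Fin (Fintype.card V + 1) => h^[i] s) (by simp)
  wlog hlt : i < j generalizing i j
  · exact this j i hij.symm he.symm (lt_of_le_of_ne (not_lt.1 hlt) hij.symm)
  have hp : Function.IsPeriodicPt h (j - i) (h^[i] s) := by
    unfold Function.IsPeriodicPt Function.IsFixedPt
    rw [← Function.iterate_add_apply, Nat.sub_add_cancel (by omega)]
    exact he.symm
  rw [show Fintype.card V = (Fintype.card V - i) + i by omega, Function.iterate_add_apply]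
  exact ⟨_, by omega, hp.apply_iterate _⟩

/-- `h` maps each vertex to an out-neighbour in the digraph `E`, if there is one, and fixes the
other vertices. -/
def IsChoice {V : Type*} (E : V → V → Prop) (h : V → V) : Prop :=
  ∀ x, E x (h x) ∨ (h x = x ∧ ∀ y, ¬ E x y)

/-- At least two tokens, or the only one, are moved to a neighbour by `g`. -/
def TwoSlow {V : Type*} (N : V → V → Prop) (P : Finset V) (g : V → V) : Prop :=
  ∃ r ∈ P, ∃ q ∈ P, N r (g r) ∧ N q (g q) ∧ (r ≠ q ∨ P = {r})

/-! ### Permuting the targets of a move along a cycle -/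

section Rotate

variable {V : Type*} {N H : V → V → Prop} {P Q : Finset V} {g g' h : V → V} {c : V}

/-- An arc `x → y` says that `x` is near the target of `y`. If the cycle is nontrivial, each of its
tokens takes the target of its successor and becomes slow. If `c` is a sink, no other target is near
`c`, but `Q` dominates `c`, so the target of `c` itself is near. -/
theorem bijOn_rotate_forward (hg : Set.BijOn g P Q) (hNH : ∀ x y, N x y → H x y)
    (hH : ∀ x ∈ P, H x (g x)) (hQ : ∀ x ∈ P, ∃ u ∈ Q, N x u)
    (hh : IsChoice (fun x y => x ∈ P ∧ y ∈ P ∧ x ≠ y ∧ N x (g y)) h)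
    (hc : c ∈ P) (hper : c ∈ Function.periodicPts h)
    (h1 : ∀ x ∈ orbit h c, g' x = g (h x)) (h2 : ∀ x ∉ orbit h c, g' x = g x) :
    Set.BijOn g' P Q ∧ (∀ x ∈ P, H x (g' x)) ∧
      ((∃ r ∈ P, ∃ q ∈ P, N r (g' r) ∧ N q (g' q) ∧ r ≠ q) ∨
        (N c (g' c) ∧ ∀ y ∈ P, y ≠ c → ¬ N c (g' y))) := by
  have hP : ∀ x ∈ (P : Set V), h x ∈ (P : Set V) := fun x hx => by
    rcases hh x with h | h
    · exact h.2.1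
    · rwa [h.1]
  have hsub : orbit h c ⊆ P := orbit_subset hP hc
  have hbij := bijOn_comp_cycle hg hsub (bijOn_orbit hper) h1 h2
  by_cases hf : h c = c
  · have hgg : g' = g := by
      funext x
      by_cases hx : x ∈ orbit h c
      · rw [h1 x hx]
        rw [orbit_eq_singleton hf] at hx
        rw [show x = c from hx, hf]
      · exact h2 x hx
    subst hgg
    have hno : ∀ y ∈ P, y ≠ c → ¬ N c (g' y) := by
      intro y hy hyc hN
      rcases hh c with h | h
      · exact h.2.2.1 hf.symm
      · exact h.2 y ⟨hc, hy, hyc.symm, hN⟩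
    refine ⟨hbij, hH, .inr ⟨?_, hno⟩⟩
    obtain ⟨u, hu, hN⟩ := hQ c hc
    obtain ⟨y, hy, rfl⟩ := hg.surjOn hu
    by_cases hyc : y = c
    · rwa [hyc] at hN
    · exact absurd hN (hno y hy hyc)
  · have hN : ∀ x ∈ orbit h c, N x (g' x) := by
      intro x hx
      rcases hh x with h | h
      · rw [h1 x hx]; exact h.2.2.2
      · exact absurd (eq_of_map_eq_of_mem_orbit hper hx h.1 ▸ h.1) hf
    refine ⟨hbij, fun x hx => ?_, .inl ⟨c, hc, h c, hP c hc, hN c (self_mem_orbit h c),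
      hN _ (map_mem_orbit (self_mem_orbit h c)), Ne.symm hf⟩⟩
    by_cases hx' : x ∈ orbit h c
    · exact hNH _ _ (hN x hx')
    · rw [h2 x hx']; exact hH x hx

/-- Now an arc `x → y` says that the target of `x` is near `y`, and domination by `P` makes sinks
slow. If the forward round left only one slow token `a` that is near no other target, no arc enters
`a`, so a walk that starts elsewhere ends either in a nontrivial cycle or in a second slow token. -/
theorem bijOn_rotate_backward (hg : Set.BijOn g P Q) (hNH : ∀ x y, N x y → H x y)
    (hH : ∀ x ∈ P, H x (g x)) (hP : ∀ u ∈ Q, ∃ x ∈ P, N x u) {a s : V}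
    (ha : (∃ r ∈ P, ∃ q ∈ P, N r (g r) ∧ N q (g q) ∧ r ≠ q) ∨
        (N a (g a) ∧ ∀ y ∈ P, y ≠ a → ¬ N a (g y)))
    (haP : a ∈ P) (hs : s ≠ a ∨ P = {a})
    (hh : IsChoice (fun x y => x ∈ P ∧ y ∈ P ∧ x ≠ y ∧ N y (g x)) h)
    (hsP : s ∈ P) (hc : c ∈ orbit h s) (hper : c ∈ Function.periodicPts h)
    (h1 : ∀ x ∈ orbit h c, g' (h x) = g x) (h2 : ∀ x ∉ orbit h c, g' x = g x) :
    Set.BijOn g' P Q ∧ (∀ x ∈ P, H x (g' x)) ∧ TwoSlow N P g' := by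
  have hPh : ∀ x ∈ (P : Set V), h x ∈ (P : Set V) := fun x hx => by
    rcases hh x with h | h
    · exact h.2.1
    · rwa [h.1]
  have hcP : c ∈ (P : Set V) := orbit_subset hPh hsP hc
  have hsub : orbit h c ⊆ P := orbit_subset hPh hcP
  have hb := bijOn_orbit hper
  have : Nonempty V := ⟨a⟩
  have hinv := hb.invOn_invFunOn
  have hbij : Set.BijOn g' P Q := by
    refine bijOn_comp_cycle hg hsub (Set.BijOn.symm hinv.symm hb) (fun x hx => ?_) h2
    obtain ⟨y, hy, rfl⟩ := hb.surjOn hx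
    rw [h1 y hy, hinv.1 hy]
  by_cases hf : h c = c
  · have hgg : g' = g := by
      funext x
      by_cases hx : x ∈ orbit h c
      · rw [orbit_eq_singleton hf] at hx
        rw [show x = c from hx]
        conv_lhs => rw [← hf]
        exact h1 c (self_mem_orbit h c)
      · exact h2 x hx
    subst hgg
    refine ⟨hbij, hH, ?_⟩
    rcases ha with ⟨r, hr, q, hq, h3, h4, h5⟩ | ⟨ha1, ha2⟩
    · exact ⟨r, hr, q, hq, h3, h4, .inl h5⟩
    · have hNc : N c (g' c) := by
        obtain ⟨y, hy, hN⟩ := hP _ (hg.mapsTo hcP)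
        by_cases hyc : y = c
        · rwa [hyc] at hN
        · rcases hh c with h | h
          · exact absurd hf.symm h.2.2.1
          · exact absurd ⟨hcP, hy, Ne.symm hyc, hN⟩ (h.2 y)
      refine ⟨a, haP, c, hcP, ha1, hNc, ?_⟩
      rcases hs with hs | hs
      -- The walk from `s ≠ a` cannot enter `a`: its last arc would come from a token other than `a`
      -- whose target is near `a`.
      · left
        rintro rfl
        obtain ⟨i, hi⟩ := hc
        induction i with
        | zero => exact hs hi
        | succ i ih =>
          rw [Function.iterate_succ_apply'] at hi
          by_cases hia : h^[i] s = a
          · exact ih hia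
          · rcases hh (h^[i] s) with h | h
            · rw [hi] at h
              exact ha2 _ h.1 hia h.2.2.2
            · exact hia (h.1.symm.trans hi)
      · exact .inr hs
  · have hN : ∀ x ∈ orbit h c, N x (g' x) := by
      intro x hx
      obtain ⟨y, hy, rfl⟩ := hb.surjOn hx
      rw [h1 y hy]
      rcases hh y with h | h
      · exact h.2.2.2
      · exact absurd (eq_of_map_eq_of_mem_orbit hper hy h.1 ▸ h.1) hf
    refine ⟨hbij, fun x hx => ?_, ⟨c, hcP, h c, hPh c hcP, hN c (self_mem_orbit h c),
      hN _ (map_mem_orbit (self_mem_orbit h c)), .inl (Ne.symm hf)⟩⟩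
    by_cases hx' : x ∈ orbit h c
    · exact hNH _ _ (hN x hx')
    · rw [h2 x hx']; exact hH x hx

end Rotate

/-! ### The auction -/

section Auction

variable {V : Type*} [DecidableEq V]

/-- A partial matching `mt` between `X` and `Y` (vertices without partner are fixed), prices `pr` of
the elements of `Y`, and a set `dd` of elements of `X` all of whose neighbours have price at least
`c`. -/
structure Auction (X Y : Finset V) (H : V → V → Prop) (c : ℕ) (mt : V → V) (pr : V → ℕ)
    (dd : Finset V) : Prop where
  inv : ∀ v, mt (mt v) = v
  edge : ∀ x ∈ X, mt x ≠ x → mt x ∈ Y ∧ H x (mt x)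
  back : ∀ y ∈ Y, mt y ≠ y → mt y ∈ X
  other : ∀ v, v ∉ X → v ∉ Y → mt v = v
  free : ∀ y ∈ Y, mt y = y → pr y = 0
  near : ∀ x ∈ X, mt x ≠ x → ∀ y ∈ Y, H x y → pr (mt x) ≤ pr y + 1
  dead : ∀ x ∈ dd, x ∈ X ∧ mt x = x ∧ ∀ y ∈ Y, H x y → c ≤ pr y
  cap : ∀ y, pr y ≤ c
  supp : ∀ y ∉ Y, pr y = 0

variable {X Y : Finset V} {H : V → V → Prop} {c : ℕ} {mt : V → V} {pr : V → ℕ} {dd : Finset V}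

theorem Auction.start {V : Type*} (X Y : Finset V) (H : V → V → Prop) (c : ℕ) :
    Auction X Y H c id (fun _ => 0) ∅ := by
  constructor <;> simp

theorem Auction.kill (h : Auction X Y H c mt pr dd) {x : V} (hx : x ∈ X) (hxm : mt x = x)
    (hy : ∀ y ∈ Y, H x y → c ≤ pr y) : Auction X Y H c mt pr (insert x dd) where
  __ := h
  dead z hz := by
    rcases Finset.mem_insert.1 hz with rfl | hz
    · exact ⟨hx, hxm, hy⟩
    · exact h.dead z hz

/-- The innermost update releases the former partner of `y`; if `y` was free it acts on `y` itself
and is overwritten. The clause `near` survives for `x` since `y` was cheapest before the rise by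
one, and for the other matched elements since their own prices are unchanged while no price falls.
-/
theorem Auction.bid (h : Auction X Y H c mt pr dd) (hXY : Disjoint X Y) {x y : V} (hx : x ∈ X)
    (hxm : mt x = x) (hxd : x ∉ dd) (hy : y ∈ Y) (hxy : H x y)
    (hmin : ∀ z ∈ Y, H x z → pr y ≤ pr z) (hc : pr y < c) :
    Auction X Y H c
      (Function.update (Function.update (Function.update mt (mt y) (mt y)) y x) x y)
      (Function.update pr y (pr y + 1)) dd := by
  have hd : ∀ {v}, v ∈ X → v ∉ Y := fun hv hv' => Finset.disjoint_left.1 hXY hv hv'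
  have hne : x ≠ y := fun e => hd hx (e ▸ hy)
  have hwx : mt y ≠ x := fun e => hne (by rw [← hxm, ← e, h.inv])
  have hm : ∀ v, Function.update (Function.update (Function.update mt (mt y) (mt y)) y x) x y v =
      if v = x then y else if v = y then x else if v = mt y then v else mt v := by
    intro v
    simp only [Function.update_apply]
    split_ifs <;> simp_all
  generalize hm' : Function.update (Function.update (Function.update mt (mt y) (mt y)) y x) x y = m
    at *
  clear hm'
  have hinv := h.inv
  have hmv : ∀ v, v ≠ x → v ≠ y → v ≠ mt y → m v = mt v ∧ mt v ≠ x ∧ mt v ≠ y ∧ mt v ≠ mt y := by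
    intro v h1 h2 h3
    refine ⟨by rw [hm, if_neg h1, if_neg h2, if_neg h3], fun e => h1 ?_, fun e => h3 ?_,
      fun e => h2 ?_⟩
    · rw [← hxm, ← e, hinv]
    · rw [← e, hinv]
    · rw [← hinv v, e, hinv]
  have hmx : m x = y := by rw [hm, if_pos rfl]
  have hmy : m y = x := by rw [hm, if_neg hne.symm, if_pos rfl]
  have hmw : mt y ≠ y → m (mt y) = mt y := fun e => by rw [hm, if_neg hwx, if_neg e, if_pos rfl]
  have hcases : ∀ v, v = x ∨ v = y ∨ (v = mt y ∧ mt y ≠ y) ∨ (v ≠ x ∧ v ≠ y ∧ v ≠ mt y) := by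
    intro v
    by_cases h1 : v = y
    · exact .inr (.inl h1)
    · by_cases h2 : v = mt y
      · exact .inr (.inr (.inl ⟨h2, fun e => h1 (h2.trans e)⟩))
      · tauto
  have hprle : ∀ z, pr z ≤ Function.update pr y (pr y + 1) z := by
    intro z
    rw [Function.update_apply]
    split_ifs with e
    · subst e; omega
    · exact le_rfl
  constructor
  · intro v
    rcases hcases v with rfl | rfl | ⟨rfl, e⟩ | ⟨h1, h2, h3⟩
    · rw [hmx, hmy]
    · rw [hmy, hmx]
    · rw [hmw e, hmw e]
    · obtain ⟨h4, h5, h6, h7⟩ := hmv v h1 h2 h3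
      rw [h4, (hmv _ h5 h6 h7).1, hinv]
  · intro v hv hmne
    rcases hcases v with rfl | rfl | ⟨rfl, e⟩ | ⟨h1, h2, h3⟩
    · rw [hmx]; exact ⟨hy, hxy⟩
    · exact absurd hy (hd hv)
    · exact absurd (hmw e) hmne
    · rw [(hmv v h1 h2 h3).1] at hmne ⊢
      exact h.edge v hv hmne
  · intro v hv hmne
    rcases hcases v with rfl | rfl | ⟨rfl, e⟩ | ⟨h1, h2, h3⟩
    · exact absurd hv (hd hx)
    · rwa [hmy]
    · exact absurd (hmw e) hmne
    · rw [(hmv v h1 h2 h3).1] at hmne ⊢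
      exact h.back v hv hmne
  · intro v hvX hvY
    rcases hcases v with rfl | rfl | ⟨rfl, e⟩ | ⟨h1, h2, h3⟩
    · exact absurd hx hvX
    · exact absurd hy hvY
    · exact hmw e
    · rw [(hmv v h1 h2 h3).1]; exact h.other v hvX hvY
  · intro v hv hmv'
    rcases hcases v with rfl | rfl | ⟨rfl, e⟩ | ⟨h1, h2, h3⟩
    · exact absurd hv (hd hx)
    · exact absurd (hmy.symm.trans hmv') hne
    · exact absurd hv (hd (h.back y hy e))
    · rw [(hmv v h1 h2 h3).1] at hmv'
      rw [Function.update_of_ne h2]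
      exact h.free v hv hmv'
  · intro v hv hmne z hz hvz
    rcases hcases v with rfl | rfl | ⟨rfl, e⟩ | ⟨h1, h2, h3⟩
    · rw [hmx, Function.update_self]
      have := hmin z hz hvz
      have := hprle z
      omega
    · exact absurd hy (hd hv)
    · exact absurd (hmw e) hmne
    · obtain ⟨h4, h5, h6, h7⟩ := hmv v h1 h2 h3
      rw [h4] at hmne ⊢
      rw [Function.update_of_ne h6]
      have := h.near v hv hmne z hz hvz
      have := hprle z
      omega
  · intro v hv
    obtain ⟨hvX, hvm, hvy⟩ := h.dead v hv
    refine ⟨hvX, ?_, fun z hz hvz => (hvy z hz hvz).trans (hprle z)⟩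
    rcases hcases v with rfl | rfl | ⟨rfl, e⟩ | ⟨h1, h2, h3⟩
    · exact absurd hv hxd
    · exact absurd hy (hd hvX)
    · exact hmw e
    · rw [(hmv v h1 h2 h3).1, hvm]
  · intro v
    rw [Function.update_apply]
    split_ifs
    · exact hc
    · exact h.cap v
  · intro v hv
    rw [Function.update_of_ne (fun e => hv (by rw [e]; exact hy))]
    exact h.supp v hv

variable [Fintype V]

theorem sum_update_succ (pr : V → ℕ) (y : V) :
    ∑ v, Function.update pr y (pr y + 1) v = ∑ v, pr v + 1 := by
  have : Function.update pr y (pr y + 1) = fun v => pr v + if v = y then 1 else 0 := by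
    funext v
    rw [Function.update_apply]
    split_ifs with e
    · rw [e]
    · rfl
  rw [this, Finset.sum_add_distrib, Finset.sum_ite_eq' Finset.univ y]
  simp

/-- With `n` vertices, prices live on `Y` and are at most `n`, and the dead elements lie in `X`
without `x`. As `X` is nonempty and disjoint from `Y`, the sum is at most `(n - 1) * n + (n - 1)`.
-/
theorem Auction.potential_lt (h : Auction X Y H (Fintype.card V) mt pr dd) (hXY : Disjoint X Y)
    {x : V} (hx : x ∈ X) (hxd : x ∉ dd) :
    ∑ v, pr v + dd.card < Fintype.card V * Fintype.card V := by
  have hdX : dd ⊆ X.erase x := fun z hz =>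
    Finset.mem_erase.2 ⟨fun e => hxd (e ▸ hz), (h.dead z hz).1⟩
  have h1 : dd.card ≤ X.card - 1 := by
    rw [← Finset.card_erase_of_mem hx]; exact Finset.card_le_card hdX
  have h2 : X.card + Y.card ≤ Fintype.card V := by
    rw [← Finset.card_union_of_disjoint hXY]; exact Finset.card_le_univ _
  have h3 : 0 < X.card := Finset.card_pos.2 ⟨x, hx⟩
  have h4 : ∑ v, pr v ≤ Y.card * Fintype.card V := by
    rw [← Finset.sum_subset (Finset.subset_univ Y) (fun v _ hv => h.supp v hv)]
    exact Finset.sum_le_card_nsmul _ _ _ fun v _ => h.cap v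
  have h5 : Y.card * Fintype.card V + Fintype.card V ≤ Fintype.card V * Fintype.card V := by
    nlinarith
  have h6 := Finset.card_le_univ X
  omega

theorem exists_gap {pr : V → ℕ} (hY : Y.card < c) : ∃ p < c, ∀ y ∈ Y, pr y ≠ p := by
  by_contra! hcon
  have : Finset.range c ⊆ Y.image pr := fun p hp => by
    obtain ⟨y, hy, he⟩ := hcon p (Finset.mem_range.1 hp)
    exact Finset.mem_image.2 ⟨y, hy, he⟩
  have := (Finset.card_le_card this).trans Finset.card_image_le
  simp at this
  omega

end Auction

/-- The vertices `v` such that `T` holds for `v` or `mt v` are moved by `mt`. -/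
def partSwap {V : Type*} (mt : V → V) (T : V → Prop) [DecidablePred T] (v : V) : V :=
  if T v ∨ T (mt v) then mt v else v

theorem partSwap_invol {V : Type*} {mt : V → V} (h : ∀ v, mt (mt v) = v) (T : V → Prop)
    [DecidablePred T] (v : V) : partSwap mt T (partSwap mt T v) = v := by
  unfold partSwap
  by_cases hv : T v ∨ T (mt v)
  · simp [hv, h, or_comm.1 hv]
  · simp [hv]

/-- The other vertices are moved by `mt`. -/
def partSwap' {V : Type*} (mt : V → V) (T : V → Prop) [DecidablePred T] (v : V) : V :=
  if T v ∨ T (mt v) then v else mt v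

theorem partSwap'_invol {V : Type*} {mt : V → V} (h : ∀ v, mt (mt v) = v) (T : V → Prop)
    [DecidablePred T] (v : V) : partSwap' mt T (partSwap' mt T v) = v := by
  unfold partSwap'
  by_cases hv : T v ∨ T (mt v)
  · simp [hv]
  · have : ¬ (T (mt v) ∨ T v) := fun h => hv h.symm
    simp [hv, h, this]

/-- Every vertex is `N`-related to an element of `D`. -/
def Dom {V : Type*} (N : V → V → Prop) (D : Finset V) : Prop := ∀ v, ∃ u ∈ D, N v u

/-! ### Splitting the matching at a gap in the prices -/

section Core

variable {V : Type*} [DecidableEq V] {N H : V → V → Prop} {Ds Dt dd : Finset V} {mt : V → V}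
  {pr : V → ℕ} {c p : ℕ}

theorem Auction.rel_mt (h : Auction (Ds \ Dt) (Dt \ Ds) H c mt pr dd) (hrefl : ∀ v, H v v)
    (hsymm : ∀ u v, H u v → H v u) (v : V) : H v (mt v) := by
  by_cases hv : mt v = v
  · rw [hv]; exact hrefl v
  · by_cases hX : v ∈ Ds \ Dt
    · exact (h.edge v hX hv).2
    · by_cases hY : v ∈ Dt \ Ds
      · have h1 := h.edge (mt v) (h.back v hY hv) (by rw [h.inv]; exact Ne.symm hv)
        rw [h.inv] at h1
        exact hsymm _ _ h1.2
      · exact absurd (h.other v hX hY) hv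

/-- When the auction has ended and `p` is a gap in the prices, the matching splits into two parts
whose exchanges lead from `Ds` and `Dt` to sets with a dominating intersection. -/
theorem Auction.exists_core (h : Auction (Ds \ Dt) (Dt \ Ds) H c mt pr dd)
    (hend : ∀ x ∈ Ds \ Dt, mt x = x → x ∈ dd) (hp : p < c) (hgap : ∀ y ∈ Dt \ Ds, pr y ≠ p)
    (hs : Dom N Ds) (ht : Dom N Dt) (hH : ∀ u v w, N w u → N w v → H u v) :
    ∃ A : Finset V, Dom N A ∧ (∀ v ∈ A, partSwap mt (fun v => p < pr v) v ∈ Ds) ∧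
      ∀ v ∈ A, partSwap' mt (fun v => p < pr v) v ∈ Dt := by
  classical
  have hTY : ∀ v, p < pr v → v ∈ Dt \ Ds := fun v hv => by
    by_contra hn
    rw [h.supp v hn] at hv
    omega
  -- Free elements have price 0, so a price above `p` belongs to a matched element.
  have hTm : ∀ v, p < pr v → mt v ∈ Ds \ Dt := fun v hv =>
    h.back v (hTY v hv) fun e => by rw [h.free v (hTY v hv) e] at hv; omega
  -- From `Ds` the dead elements and those matched above the gap are dropped; from `Dt` the elements
  -- priced above the gap are added. Common elements of `Ds` and `Dt` stay.
  refine ⟨Ds.filter (fun v => v ∉ dd ∧ ¬ p < pr (mt v)) ∪ Dt.filter (fun v => p < pr v),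
    fun w => ?_, fun v hv => ?_, fun v hv => ?_⟩
  · obtain ⟨u, hu, hwu⟩ := hs w
    by_cases hS : u ∉ dd ∧ ¬ p < pr (mt u)
    · exact ⟨u, Finset.mem_union_left _ (Finset.mem_filter.2 ⟨hu, hS⟩), hwu⟩
    · obtain ⟨b, hb, hwb⟩ := ht w
      have hHub := hH u b w hwu hwb
      by_cases hbs : b ∈ Ds
      · refine ⟨b, Finset.mem_union_left _ (Finset.mem_filter.2 ⟨hbs, ?_, ?_⟩), hwb⟩
        · intro hbd
          exact (Finset.mem_sdiff.1 (h.dead b hbd).1).2 hb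
        · intro hlt
          have h1 := hTm _ hlt
          rw [h.inv] at h1
          exact (Finset.mem_sdiff.1 h1).2 hb
      · have hbY : b ∈ Dt \ Ds := Finset.mem_sdiff.2 ⟨hb, hbs⟩
        refine ⟨b, Finset.mem_union_right _ (Finset.mem_filter.2 ⟨hb, ?_⟩), hwb⟩
        -- Since `p` is not a price, `p ≤ pr b` suffices. A dead `u` gives `c ≤ pr b`; otherwise `p
        -- < pr (mt u) ≤ pr b + 1`, and the gap makes up for the slack of one.
        have hne := hgap b hbY
        by_cases hud : u ∈ dd
        · have := (h.dead u hud).2.2 b hbY hHub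
          omega
        · have hlt : p < pr (mt u) := by tauto
          have h1 := hTm _ hlt
          rw [h.inv] at h1
          have h2 : mt u ≠ u := fun e => by
            have := hTY _ hlt
            rw [e] at this
            exact (Finset.mem_sdiff.1 this).2 hu
          have := h.near u h1 h2 b hbY hHub
          omega
  · rcases Finset.mem_union.1 hv with hv | hv
    · obtain ⟨hvs, -, hvp⟩ := Finset.mem_filter.1 hv
      have hvp' : ¬ p < pr v := fun hlt => (Finset.mem_sdiff.1 (hTY v hlt)).2 hvs
      simpa [partSwap, hvp, hvp'] using hvs
    · obtain ⟨-, hvp⟩ := Finset.mem_filter.1 hv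
      have := (Finset.mem_sdiff.1 (hTm v hvp)).1
      simpa [partSwap, hvp] using this
  · rcases Finset.mem_union.1 hv with hv | hv
    · obtain ⟨hvs, hvd, hvp⟩ := Finset.mem_filter.1 hv
      have hvp' : ¬ p < pr v := fun hlt => (Finset.mem_sdiff.1 (hTY v hlt)).2 hvs
      have hgoal : mt v ∈ Dt := by
        by_cases hvt : v ∈ Dt
        · rw [h.other v (by simp [hvt]) (by simp [hvs])]; exact hvt
        · have hX : v ∈ Ds \ Dt := Finset.mem_sdiff.2 ⟨hvs, hvt⟩
          exact (Finset.mem_sdiff.1 (h.edge v hX fun e => hvd (hend v hX e)).1).1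
      simpa [partSwap', hvp, hvp'] using hgoal
    · obtain ⟨hvt, hvp⟩ := Finset.mem_filter.1 hv
      simpa [partSwap', hvp] using hvt

end Core

/-! ### Chains of tokens -/

/-- This adds the arc from `p` to `q` to the simultaneous move of a chain; the old value of `f` at
`p` is irrelevant. -/
theorem bijOn_update {V : Type*} [DecidableEq V] {f : V → V} {A B : Set V} {p q : V}
    (h : Set.BijOn f A B) (hp : p ∉ A) (hq : q ∉ B) :
    Set.BijOn (Function.update f p q) (insert p A) (insert q B) := by
  have h1 : Set.BijOn (Function.update f p q) A B := h.congr fun x hx => by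
    rw [Function.update_of_ne]
    rintro rfl
    exact hp hx
  have := h1.insert (a := p) (by simpa using hq)
  simpa using this

end TokenReconf

/-! ### The program -/

namespace WordRAM

open FProg

@[simp] theorem FProg.run_skip (s : State) : skip.run s = s := rfl

@[simp] theorem FProg.run_assign (x : ℕ) (e : Expr) (s : State) :
    (assign x e).run s = s.setReg x (e.eval s) := rfl

@[simp] theorem FProg.run_write (a : ℕ) (i e : Expr) (s : State) :
    (write a i e).run s = s.setArr a (i.eval s) (e.eval s) := rfl

@[simp] theorem FProg.run_seq (p q : FProg) (s : State) :
    (p.seq q).run s = q.run (p.run s) := rfl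

theorem FProg.run_ite {e : Expr} {s : State} (φ : Prop) [Decidable φ] (h : e.eval s ≠ 0 ↔ φ)
    (p q : FProg) : (ite e p q).run s = if φ then p.run s else q.run s := by
  by_cases hφ : φ
  · rw [if_pos hφ]; exact if_pos (h.2 hφ)
  · rw [if_neg hφ]; exact if_neg (h.not.2 hφ)

@[simp] theorem Expr.eval_lit (s : State) (c : ℕ) : (Expr.lit c).eval s = c := rfl

@[simp] theorem Expr.eval_reg (s : State) (x : ℕ) : (Expr.reg x).eval s = s.reg x := rfl

@[simp] theorem Expr.eval_read (s : State) (a : ℕ) (i : Expr) :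
    (Expr.read a i).eval s = s.arr a (i.eval s) := rfl

@[simp] theorem Expr.eval_op (s : State) (o : BinOp) (e f : Expr) :
    (Expr.op o e f).eval s = o.eval (e.eval s) (f.eval s) := rfl

/-- Sequential composition. -/
infixr:60 " ;; " => FProg.seq

/-- The register `x`. -/
abbrev R (x : ℕ) : Expr := .reg x

/-- The constant `c`. -/
abbrev K (c : ℕ) : Expr := .lit c

/-- An entry of the array `a`. -/
abbrev A (a : ℕ) (i : Expr) : Expr := .read a i

/-- The sum of two values. -/
abbrev eAdd (e f : Expr) : Expr := .op .add e f

/-- The product of two values; the conjunction of two tests. -/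
abbrev eMul (e f : Expr) : Expr := .op .mul e f

/-- The test for `<`. -/
abbrev eLt (e f : Expr) : Expr := .op .lt e f

/-- The test for equality. -/
abbrev eEq (e f : Expr) : Expr := .op .eq e f

/-- The negation of a test. -/
abbrev eNot (e : Expr) : Expr := .op .eq e (.lit 0)

/-- The index of the entry in row `e` and column `f` of a matrix. -/
abbrev ix (e f : Expr) : Expr := eAdd (eMul e (R 0)) f

/-- Copy array `a` to array `b`. -/
def copyArr (a b : ℕ) : FProg := loop 3 (write b (R 3) (A a (R 3)))

/-- Array `5` receives the reflexive closure of the adjacency relation. -/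
def closedAdj : FProg :=
  loop 2 (loop 3 (write 5 (ix (R 2) (R 3))
    (eLt (K 0) (eAdd (A 0 (ix (R 2) (R 3))) (eEq (R 2) (R 3))))))

/-- Array `6` receives the relation of having distance at most `2`. -/
def closedAdjSq : FProg :=
  loop 2 (loop 3 (ite (A 5 (ix (R 2) (R 3)))
    (loop 4 (ite (A 5 (ix (R 3) (R 4))) (write 6 (ix (R 2) (R 4)) (K 1)) skip)) skip))

/-- Register `5` receives the successor of an unmatched element of `X` that can still bid, or `0`
if there is none. -/
def findBidder : FProg :=
  assign 5 (K 0) ;;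
  loop 4 (ite (eMul (A 1 (R 4)) (eMul (eNot (A 2 (R 4)))
      (eMul (eEq (A 7 (R 4)) (R 4)) (eNot (A 9 (R 4))))))
    (assign 5 (eAdd (R 4) (K 1))) skip)

/-- Registers `6` and `7` receive the least price of a neighbour of the bidder in `Y`, capped by
`n`, and such a neighbour. -/
def findBest : FProg :=
  assign 6 (R 0) ;; assign 7 (K 0) ;;
  loop 4 (ite (eMul (A 2 (R 4)) (eMul (eNot (A 1 (R 4)))
      (eMul (A 6 (ix (R 5) (R 4))) (eLt (A 8 (R 4)) (R 6)))))
    (assign 6 (A 8 (R 4)) ;; assign 7 (R 4)) skip)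

/-- The bidder receives the neighbour that was found, or gives up. -/
def placeBid : FProg :=
  ite (eLt (R 6) (R 0))
    (write 7 (A 7 (R 7)) (A 7 (R 7)) ;; write 7 (R 7) (R 5) ;; write 7 (R 5) (R 7) ;;
      write 8 (R 7) (eAdd (R 6) (K 1)))
    (write 9 (R 5) (K 1))

/-- One round of the auction. -/
def auctionStep : FProg :=
  findBidder ;; ite (R 5) (assign 5 (.op .sub (R 5) (K 1)) ;; findBest ;; placeBid) skip

/-- The auction. -/
def auction : FProg :=
  loop 3 (write 7 (R 3) (R 3)) ;; loop 2 (loop 3 auctionStep)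

/-- Register `8` receives a gap in the prices. -/
def findGap : FProg :=
  loop 2 (assign 5 (K 0) ;;
    loop 3 (ite (eMul (A 2 (R 3)) (eMul (eNot (A 1 (R 3))) (eEq (A 8 (R 3)) (R 2))))
      (assign 5 (K 1)) skip) ;;
    ite (R 5) skip (assign 8 (R 2)))

/-- The two parts of the matching (arrays `12` and `13`) and the sets to which they lead from the
two given sets (arrays `10` and `11`). -/
def splitMatching : FProg :=
  loop 2 (
    ite (eAdd (eLt (R 8) (A 8 (R 2))) (eLt (R 8) (A 8 (A 7 (R 2)))))
      (write 12 (R 2) (A 7 (R 2)) ;; write 13 (R 2) (R 2))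
      (write 12 (R 2) (R 2) ;; write 13 (R 2) (A 7 (R 2))) ;;
    write 10 (R 2) (A 1 (A 12 (R 2))) ;;
    write 11 (R 2) (A 2 (A 13 (R 2))))

end WordRAM

/-! ### Memory contents -/

namespace TokenReconf

open WordRAM FProg

theorem mul_add_inj {n u v u' v' : ℕ} (hv : v < n) (hv' : v' < n) :
    u * n + v = u' * n + v' ↔ u = u' ∧ v = v' := by
  refine ⟨fun h => ?_, fun h => by rw [h.1, h.2]⟩
  have hn : 0 < n := by omega
  have h1 : (u * n + v) / n = u := by
    rw [mul_comm, Nat.mul_add_div hn, Nat.div_eq_of_lt hv, add_zero]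
  have h2 : (u' * n + v') / n = u' := by
    rw [mul_comm, Nat.mul_add_div hn, Nat.div_eq_of_lt hv', add_zero]
  have h3 : u = u' := by rw [← h1, h, h2]
  subst h3
  exact ⟨rfl, by omega⟩

variable {n : ℕ}

/-- The array holds the values of `φ`. -/
def RepN (a : ℕ → ℕ) (φ : Fin n → ℕ) : Prop := ∀ v : Fin n, a v = φ v

/-- The array holds the vertices that are the values of `g`. -/
def RepF (a : ℕ → ℕ) (g : Fin n → Fin n) : Prop := ∀ v : Fin n, a v = g v

/-- The array holds the characteristic vector of `D`. -/
def RepS (a : ℕ → ℕ) (D : Finset (Fin n)) : Prop := ∀ v : Fin n, a v = if v ∈ D then 1 else 0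

/-- The array holds a matrix whose entries with `M` are those that do not vanish. -/
def RepM (a : ℕ → ℕ) (M : Fin n → Fin n → Prop) : Prop := ∀ u v : Fin n, a (u * n + v) ≠ 0 ↔ M u v

theorem RepN.update {a : ℕ → ℕ} {φ : Fin n → ℕ} (h : RepN a φ) (v : Fin n) (w : ℕ) :
    RepN (Function.update a v w) (Function.update φ v w) := fun u => by
  rw [Function.update_apply, Function.update_apply, h u]
  simp [Fin.ext_iff]

theorem RepF.update {a : ℕ → ℕ} {g : Fin n → Fin n} (h : RepF a g) (v w : Fin n) :
    RepF (Function.update a v w) (Function.update g v w) := fun u => by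
  rw [Function.update_apply, Function.update_apply, h u]
  simp only [Fin.ext_iff]
  split_ifs <;> rfl

theorem RepS.insert {a : ℕ → ℕ} {D : Finset (Fin n)} (h : RepS a D) (v : Fin n) :
    RepS (Function.update a v 1) (insert v D) := fun u => by
  rw [Function.update_apply, h u]
  simp only [Finset.mem_insert, Fin.ext_iff]
  split_ifs <;> tauto

theorem RepS.erase {a : ℕ → ℕ} {D : Finset (Fin n)} (h : RepS a D) (v : Fin n) :
    RepS (Function.update a v 0) (D.erase v) := fun u => by
  rw [Function.update_apply, h u]
  simp only [Finset.mem_erase, Fin.ext_iff, ne_eq]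
  split_ifs <;> tauto

theorem RepS.ne_zero {a : ℕ → ℕ} {D : Finset (Fin n)} (h : RepS a D) (v : Fin n) :
    a v ≠ 0 ↔ v ∈ D := by
  rw [h v]; simp

theorem run_fill {x a : ℕ} {e : Expr} {s : State} (φ : ℕ → ℕ) (hx : x ≠ 0)
    (he : ∀ i < s.reg 0, ∀ s', s'.reg x = i → Frame [x] [a] s s' → e.eval s' = φ i) :
    ∀ v < s.reg 0, ((loop x (write a (R x) e)).run s).arr a v = φ v := by
  refine loop_inv (x := x) (p := write a (R x) e) (s := s)
    (fun i s' => ∀ v < i, s'.arr a v = φ v) (by simp [regs, hx]) (by simp) ?_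
  intro i s' hi hr hF hI v hv
  have he' := he i hi s' hr hF
  simp only [run_write, State.setReg_arr, State.setArr_arr, if_true, Expr.eval_reg, hr, he',
    Function.update_apply]
  split_ifs with h
  · rw [h]
  · exact hI v (by omega)

theorem run_copyArr {a b : ℕ} (hab : a ≠ b) (s : State) :
    ∀ v < s.reg 0, ((copyArr a b).run s).arr b v = s.arr a v :=
  run_fill (s.arr a) (by decide) fun i _ s' hr hF => by
    simp [Expr.eval, hr, hF.arr a (by simpa using hab)]

theorem run_closedAdj {M : Fin n → Fin n → Prop} {s : State} (h0 : s.reg 0 = n)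
    (hM : RepM (s.arr 0) M) :
    RepM ((closedAdj.run s).arr 5) (fun u v => u = v ∨ M u v) := by
  have H := loop_inv (x := 2) (p := loop 3 (write 5 (ix (R 2) (R 3))
    (eLt (K 0) (eAdd (A 0 (ix (R 2) (R 3))) (eEq (R 2) (R 3)))))) (s := s)
    (fun i s' => ∀ u v : Fin n, (u : ℕ) < i → (s'.arr 5 (u * n + v) ≠ 0 ↔ u = v ∨ M u v))
    (by decide) (by simp) ?_
  · intro u v
    exact H u v (by rw [h0]; exact u.2)
  intro i s' hi hr hF hI u v hu
  have h0' : s'.reg 0 = n := (hF.reg 0 (by decide)).trans h0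
  have H := loop_inv (x := 3) (p := write 5 (ix (R 2) (R 3))
    (eLt (K 0) (eAdd (A 0 (ix (R 2) (R 3))) (eEq (R 2) (R 3))))) (s := s')
    (fun j s' => ∀ u v : Fin n, (u : ℕ) < i ∨ (u : ℕ) = i ∧ (v : ℕ) < j →
      (s'.arr 5 (u * n + v) ≠ 0 ↔ u = v ∨ M u v))
    (by decide) (by simpa using hI) ?_
  · refine H u v ?_
    rw [h0']
    have := v.2
    omega
  intro j s'' hj hr' hF' hI' u v huv
  have hr2 : s''.reg 2 = i := (hF'.reg 2 (by decide)).trans hr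
  have h0'' : s''.reg 0 = n := (hF'.reg 0 (by decide)).trans h0'
  have hadj : s''.arr 0 = s.arr 0 := (hF'.arr 0 (by decide)).trans (hF.arr 0 (by decide))
  have hjn : j < n := by omega
  have hval : ∀ (a : ℕ) (b c : ℕ), (if 0 < a + (if b = c then 1 else 0) then 1 else 0) ≠ 0 ↔
      b = c ∨ a ≠ 0 := fun a b c => by split_ifs <;> omega
  simp only [run_write, State.setReg_arr, State.setArr_arr, if_true, Expr.eval_lit, Expr.eval_reg,
    Expr.eval_op, Expr.eval_read, hr2, hr', h0'', hadj, Function.update_apply, BinOp.eval,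
    mul_add_inj v.2 hjn]
  by_cases h : (u : ℕ) = i ∧ (v : ℕ) = j
  · rw [if_pos h, hval, ← h.1, ← h.2, hM u v, Fin.ext_iff]
  · rw [if_neg h]
    exact hI' u v (by omega)

/-- A Boolean matrix product. The invariants are equivalences, so entries without a witness so far
must still be 0, which is why array `6` has to be blank at the start. -/
theorem run_closedAdjSq {M : Fin n → Fin n → Prop} {s : State} (h0 : s.reg 0 = n)
    (hM : RepM (s.arr 5) M) (h6 : ∀ i, s.arr 6 i = 0) :
    RepM ((closedAdjSq.run s).arr 6) (fun u v => ∃ w, M u w ∧ M w v) := by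
  have H := loop_inv (x := 2) (p := loop 3 (ite (A 5 (ix (R 2) (R 3)))
    (loop 4 (ite (A 5 (ix (R 3) (R 4))) (write 6 (ix (R 2) (R 4)) (K 1)) skip)) skip)) (s := s)
    (fun i s' => ∀ u v : Fin n, s'.arr 6 (u * n + v) ≠ 0 ↔ (u : ℕ) < i ∧ ∃ w, M u w ∧ M w v)
    (by decide) (by simp [h6]) ?_
  · intro u v
    rw [closedAdjSq, H u v, h0]
    simp
  intro i s' hi hr hF hI
  have h0' : s'.reg 0 = n := (hF.reg 0 (by decide)).trans h0
  have H := loop_inv (x := 3) (p := ite (A 5 (ix (R 2) (R 3)))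
    (loop 4 (ite (A 5 (ix (R 3) (R 4))) (write 6 (ix (R 2) (R 4)) (K 1)) skip)) skip) (s := s')
    (fun j s' => ∀ u v : Fin n, s'.arr 6 (u * n + v) ≠ 0 ↔
      ((u : ℕ) < i ∧ ∃ w, M u w ∧ M w v) ∨
      ((u : ℕ) = i ∧ ∃ w : Fin n, (w : ℕ) < j ∧ M u w ∧ M w v))
    (by decide) (by simpa using hI) ?_
  · intro u v
    rw [State.setReg_arr, H u v, h0']
    constructor
    · rintro (⟨h1, h2⟩ | ⟨h1, w, h2, h3⟩)
      · exact ⟨by omega, h2⟩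
      · exact ⟨by omega, w, h3⟩
    · rintro ⟨h1, w, h2⟩
      rcases Nat.lt_succ_iff_lt_or_eq.1 h1 with h1 | h1
      · exact .inl ⟨h1, w, h2⟩
      · exact .inr ⟨h1, w, w.2, h2⟩
  intro j s'' hj hr' hF' hI'
  have hr2 : s''.reg 2 = i := (hF'.reg 2 (by decide)).trans hr
  have h0'' : s''.reg 0 = n := (hF'.reg 0 (by decide)).trans h0'
  have hadj : s''.arr 5 = s.arr 5 := (hF'.arr 5 (by decide)).trans (hF.arr 5 (by decide))
  have hin : i < n := by omega
  have hjn : j < n := by omega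
  have hlast : ∀ u v : Fin n, (∃ w : Fin n, (w : ℕ) < j + 1 ∧ M u w ∧ M w v) ↔
      (∃ w : Fin n, (w : ℕ) < j ∧ M u w ∧ M w v) ∨ (M u ⟨j, hjn⟩ ∧ M ⟨j, hjn⟩ v) := by
    intro u v
    constructor
    · rintro ⟨w, h1, h2⟩
      rcases Nat.lt_succ_iff_lt_or_eq.1 h1 with h1 | h1
      · exact .inl ⟨w, h1, h2⟩
      · right
        have : w = ⟨j, hjn⟩ := Fin.ext h1
        rwa [this] at h2
    · rintro (⟨w, h1, h2⟩ | h)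
      · exact ⟨w, by omega, h2⟩
      · exact ⟨⟨j, hjn⟩, by simp, h⟩
  by_cases hMij : M ⟨i, hin⟩ ⟨j, hjn⟩
  · have hc : (A 5 (ix (R 2) (R 3))).eval s'' ≠ 0 := by
      have := (hM ⟨i, hin⟩ ⟨j, hjn⟩).2 hMij
      simpa [BinOp.eval, hr2, hr', h0'', hadj] using this
    have H := loop_inv (x := 4) (p := ite (A 5 (ix (R 3) (R 4)))
        (write 6 (ix (R 2) (R 4)) (K 1)) skip) (s := s'')
      (fun k s' => ∀ u v : Fin n, s'.arr 6 (u * n + v) ≠ 0 ↔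
        s''.arr 6 (u * n + v) ≠ 0 ∨ ((u : ℕ) = i ∧ (v : ℕ) < k ∧ M ⟨j, hjn⟩ v))
      (by decide) (by simp) ?_
    · intro u v
      rw [run_ite True (by simpa using hc), if_pos trivial, State.setReg_arr, H u v, hI' u v,
        hlast, h0'']
      constructor
      · rintro ((h | h) | ⟨h1, h2, h3⟩)
        · exact .inl h
        · exact .inr ⟨h.1, .inl h.2⟩
        · refine .inr ⟨h1, .inr ⟨?_, h3⟩⟩
          rwa [show u = ⟨i, hin⟩ from Fin.ext h1]
      · rintro (h | ⟨h1, h2 | h2⟩)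
        · exact .inl (.inl h)
        · exact .inl (.inr ⟨h1, h2⟩)
        · exact .inr ⟨h1, v.2, h2.2⟩
    intro k t hk htr hFt hIt u v
    have hkn : k < n := by omega
    have e2 : t.reg 2 = i := (hFt.reg 2 (by decide)).trans hr2
    have e3 : t.reg 3 = j := (hFt.reg 3 (by decide)).trans hr'
    have e0 : t.reg 0 = n := (hFt.reg 0 (by decide)).trans h0''
    have e5 : t.arr 5 = s.arr 5 := (hFt.arr 5 (by decide)).trans hadj
    have hMk := hM ⟨j, hjn⟩ ⟨k, hkn⟩
    simp only at hMk
    classical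
    rw [run_ite (M ⟨j, hjn⟩ ⟨k, hkn⟩) (by simpa [BinOp.eval, e3, e0, htr, e5] using hMk)]
    split_ifs with h
    · simp only [run_write, Expr.eval_lit, Expr.eval_reg, Expr.eval_op, BinOp.eval, e2, e0, htr,
        State.setReg_arr, State.setArr_arr, if_true,
        Function.update_apply, mul_add_inj v.2 hkn]
      split_ifs with h'
      · refine ⟨fun _ => .inr ⟨h'.1, by omega, ?_⟩, fun _ => one_ne_zero⟩
        rwa [show v = ⟨k, hkn⟩ from Fin.ext h'.2]
      · rw [hIt u v]
        constructor
        · rintro (h1 | ⟨h1, h2, h3⟩)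
          · exact .inl h1
          · exact .inr ⟨h1, by omega, h3⟩
        · rintro (h1 | ⟨h1, h2, h3⟩)
          · exact .inl h1
          · exact .inr ⟨h1, by omega, h3⟩
    · rw [run_skip, State.setReg_arr, hIt u v]
      constructor
      · rintro (h1 | ⟨h1, h2, h3⟩)
        · exact .inl h1
        · exact .inr ⟨h1, by omega, h3⟩
      · rintro (h1 | ⟨h1, h2, h3⟩)
        · exact .inl h1
        · refine .inr ⟨h1, ?_, h3⟩
          have : (v : ℕ) ≠ k := fun e => h (by rwa [← show v = ⟨k, hkn⟩ from Fin.ext e])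
          omega
  · have hc : (A 5 (ix (R 2) (R 3))).eval s'' = 0 := by
      have := (hM ⟨i, hin⟩ ⟨j, hjn⟩).not.2 hMij
      simpa [BinOp.eval, hr2, hr', h0'', hadj] using this
    intro u v
    rw [run_ite False (by simpa using hc), if_neg not_false, run_skip, State.setReg_arr, hI' u v,
      hlast]
    constructor
    · rintro (h | h)
      · exact .inl h
      · exact .inr ⟨h.1, .inl h.2⟩
    · rintro (h | ⟨h1, h2 | h2⟩)
      · exact .inl h
      · exact .inr ⟨h1, h2⟩
      · rw [show u = ⟨i, hin⟩ from Fin.ext h1] at h2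
        exact absurd h2.1 hMij

end TokenReconf

/-! ### Correctness of the auction -/

namespace TokenReconf

open WordRAM FProg

variable {n : ℕ}

/-- Later hits overwrite earlier ones, but it never matters which hit is reported. Without a hit the
register keeps its previous value, which each caller sets to a suitable default beforehand. -/
theorem run_scan {x r : ℕ} {e f : Expr} {s : State} (φ : ℕ → Prop) (val : ℕ → ℕ)
    (hx : x ∉ [0, r])
    (he : ∀ i < s.reg 0, ∀ s', s'.reg x = i → Frame [x, r] [] s s' →
      (e.eval s' ≠ 0 ↔ φ i) ∧ f.eval s' = val i) :
    ((((loop x (ite e (assign r f) skip)).run s).reg r = s.reg r ∧ ∀ i < s.reg 0, ¬ φ i) ∨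
      ∃ i < s.reg 0, φ i ∧ ((loop x (ite e (assign r f) skip)).run s).reg r = val i) := by
  classical
  have hx0 : x ≠ 0 := fun h => hx (by simp [h])
  have hxr : r ≠ x := fun h => hx (by simp [h])
  refine loop_inv (x := x) (p := ite e (assign r f) skip) (s := s)
    (fun j s' => (s'.reg r = s.reg r ∧ ∀ i < j, ¬ φ i) ∨ ∃ i < j, φ i ∧ s'.reg r = val i)
    (by simp [regs, hx0, hxr.symm]) (by simp [hxr]) ?_
  intro i s' hi hr hF hI
  obtain ⟨h1, h2⟩ := he i hi s' hr (hF.mono (by simp [regs]) (by simp [arrs]))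
  simp only [run_ite (φ i) h1, State.setReg_reg, hxr, if_false]
  by_cases h : φ i
  · right
    exact ⟨i, by omega, h, by simp [h, h2]⟩
  · simp only [h, if_false, run_skip]
    rcases hI with ⟨h3, h4⟩ | ⟨j, h3, h4⟩
    · refine .inl ⟨h3, fun j hj => ?_⟩
      rcases Nat.lt_succ_iff_lt_or_eq.1 hj with hj | rfl
      · exact h4 j hj
      · exact h
    · exact .inr ⟨j, by omega, h4⟩

/-- The part of the memory that is fixed after the computation of the distances. -/
structure Env (N H : Fin n → Fin n → Prop) (Ds Dt : Finset (Fin n)) (s : State) : Prop where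
  size : s.reg 0 = n
  source : RepS (s.arr 1) Ds
  target : RepS (s.arr 2) Dt
  near : RepM (s.arr 5) N
  near2 : RepM (s.arr 6) H

section Env

variable {N H : Fin n → Fin n → Prop} {Ds Dt : Finset (Fin n)} {s s' : State}

theorem Env.of_frame (h : Env N H Ds Dt s) {rs as : List ℕ} (hF : Frame rs as s s')
    (hd : 0 ∉ rs ∧ 1 ∉ as ∧ 2 ∉ as ∧ 5 ∉ as ∧ 6 ∉ as) : Env N H Ds Dt s' where
  size := (hF.reg 0 hd.1).trans h.size
  source := by rw [hF.arr 1 hd.2.1]; exact h.source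
  target := by rw [hF.arr 2 hd.2.2.1]; exact h.target
  near := by rw [hF.arr 5 hd.2.2.2.1]; exact h.near
  near2 := by rw [hF.arr 6 hd.2.2.2.2]; exact h.near2

theorem Env.run (h : Env N H Ds Dt s) (p : FProg)
    (hd : 0 ∉ p.regs ∧ 1 ∉ p.arrs ∧ 2 ∉ p.arrs ∧ 5 ∉ p.arrs ∧ 6 ∉ p.arrs) :
    Env N H Ds Dt (p.run s) := h.of_frame (p.frame s) hd

theorem Env.setReg (h : Env N H Ds Dt s) {x : ℕ} (hx : x ≠ 0) (v : ℕ) :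
    Env N H Ds Dt (s.setReg x v) where
  size := by simpa [hx.symm] using h.size
  source := h.source
  target := h.target
  near := h.near
  near2 := h.near2

end Env

/-- The memory holds the data of the auction. -/
structure AuctionState (mt : Fin n → Fin n) (pr : Fin n → ℕ) (dd : Finset (Fin n)) (s : State) :
    Prop where
  mate : RepF (s.arr 7) mt
  price : RepN (s.arr 8) pr
  dead : RepS (s.arr 9) dd

section Auction

variable {N H : Fin n → Fin n → Prop} {Ds Dt dd : Finset (Fin n)} {mt : Fin n → Fin n}
  {pr : Fin n → ℕ} {s s' : State}

theorem AuctionState.of_frame (h : AuctionState mt pr dd s) {rs as : List ℕ}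
    (hF : Frame rs as s s') (hd : 7 ∉ as ∧ 8 ∉ as ∧ 9 ∉ as) : AuctionState mt pr dd s' where
  mate := by rw [hF.arr 7 hd.1]; exact h.mate
  price := by rw [hF.arr 8 hd.2.1]; exact h.price
  dead := by rw [hF.arr 9 hd.2.2]; exact h.dead

theorem run_findBidder (hE : Env N H Ds Dt s) (hA : AuctionState mt pr dd s) :
    ((findBidder.run s).reg 5 = 0 ∧ ∀ x ∈ Ds \ Dt, mt x = x → x ∈ dd) ∨
      ∃ x ∈ Ds \ Dt, mt x = x ∧ x ∉ dd ∧ (findBidder.run s).reg 5 = x + 1 := by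
  rcases run_scan (x := 4) (r := 5) (s := s.setReg 5 0) (f := eAdd (R 4) (K 1))
    (e := eMul (A 1 (R 4)) (eMul (eNot (A 2 (R 4)))
      (eMul (eEq (A 7 (R 4)) (R 4)) (eNot (A 9 (R 4))))))
    (fun i => ∃ x : Fin n, (x : ℕ) = i ∧ x ∈ Ds \ Dt ∧ mt x = x ∧ x ∉ dd) (fun i => i + 1)
    (by decide) (by
      intro i hi s' hr hF
      rw [(hE.setReg (by decide) 0).size] at hi
      have hE' := (hE.setReg (x := 5) (by decide) 0).of_frame hF (by decide)
      have hA' : AuctionState mt pr dd s' :=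
        AuctionState.of_frame (s := s.setReg 5 0) ⟨hA.mate, hA.price, hA.dead⟩ hF (by decide)
      have h1 := hE'.source ⟨i, hi⟩
      have h2 := hE'.target ⟨i, hi⟩
      have h3 := hA'.mate ⟨i, hi⟩
      have h4 := hA'.dead ⟨i, hi⟩
      simp only at h1 h2 h3 h4
      refine ⟨?_, by simp [BinOp.eval, hr]⟩
      have : (∃ x : Fin n, (x : ℕ) = i ∧ x ∈ Ds \ Dt ∧ mt x = x ∧ x ∉ dd) ↔
          (⟨i, hi⟩ : Fin n) ∈ Ds \ Dt ∧ mt ⟨i, hi⟩ = ⟨i, hi⟩ ∧ (⟨i, hi⟩ : Fin n) ∉ dd :=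
        ⟨fun ⟨x, hx, h⟩ => by rwa [show x = ⟨i, hi⟩ from Fin.ext hx] at h, fun h => ⟨_, rfl, h⟩⟩
      rw [this]
      simp [BinOp.eval, hr, h1, h2, h3, h4, Fin.ext_iff]
      tauto) with ⟨h1, h2⟩ | ⟨i, -, h1, h2⟩
  · refine .inl ⟨by simpa [findBidder] using h1, fun x hx hm => ?_⟩
    by_contra hd
    exact h2 x (by rw [(hE.setReg (by decide) 0).size]; exact x.2) ⟨x, rfl, hx, hm, hd⟩
  · obtain ⟨x, rfl, h3, h4, h5⟩ := h1
    exact .inr ⟨x, h3, h4, h5, by simpa [findBidder] using h2⟩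

/-- The running minimum starts at `n`, so neighbours of price `n` are invisible, and a final value
`n` means that the bidder has to give up. -/
theorem run_findBest (hE : Env N H Ds Dt s) (hA : AuctionState mt pr dd s) {x : Fin n}
    (hx : s.reg 5 = x) :
    ((findBest.run s).reg 6 = n ∧ ∀ y ∈ Dt \ Ds, H x y → n ≤ pr y) ∨
      ∃ y ∈ Dt \ Ds, H x y ∧ (∀ z ∈ Dt \ Ds, H x z → pr y ≤ pr z) ∧ pr y < n ∧
        (findBest.run s).reg 6 = pr y ∧ (findBest.run s).reg 7 = y := by
  have H := loop_inv (x := 4) (s := (s.setReg 6 n).setReg 7 0)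
    (p := ite (eMul (A 2 (R 4)) (eMul (eNot (A 1 (R 4)))
      (eMul (A 6 (ix (R 5) (R 4))) (eLt (A 8 (R 4)) (R 6)))))
      (assign 6 (A 8 (R 4)) ;; assign 7 (R 4)) skip)
    (fun i s' => (s'.reg 6 = n ∧ ∀ y ∈ Dt \ Ds, H x y → (y : ℕ) < i → n ≤ pr y) ∨
      ∃ y ∈ Dt \ Ds, H x y ∧ (∀ z ∈ Dt \ Ds, H x z → (z : ℕ) < i → pr y ≤ pr z) ∧ pr y < n ∧
        s'.reg 6 = pr y ∧ s'.reg 7 = y) (by decide) (by simp) ?_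
  · have h0 : ((s.setReg 6 n).setReg 7 0).reg 0 = n := by simpa using hE.size
    rw [h0] at H
    simp only [findBest, run_seq, run_assign, Expr.eval_reg, Expr.eval_lit, hE.size]
    rcases H with ⟨h1, h2⟩ | ⟨y, h1, h2, h3, h4⟩
    · exact .inl ⟨h1, fun y hy hxy => h2 y hy hxy y.2⟩
    · exact .inr ⟨y, h1, h2, fun z hz hxz => h3 z hz hxz z.2, h4⟩
  intro i s' hi hr hF hI
  have hE0 := (hE.setReg (x := 6) (by decide) n).setReg (x := 7) (by decide) 0
  rw [hE0.size] at hi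
  have hE' := hE0.of_frame hF (by decide)
  have hA' : AuctionState mt pr dd s' :=
    AuctionState.of_frame (s := (s.setReg 6 n).setReg 7 0) ⟨hA.mate, hA.price, hA.dead⟩ hF
      (by decide)
  have h5 : s'.reg 5 = x := by rw [hF.reg 5 (by decide)]; simpa using hx
  have h1 := hE'.source ⟨i, hi⟩
  have h2 := hE'.target ⟨i, hi⟩
  have h3 := hA'.price ⟨i, hi⟩
  have h4 := hE'.near2 x ⟨i, hi⟩
  simp only at h1 h2 h3 h4
  classical
  rw [run_ite ((⟨i, hi⟩ : Fin n) ∈ Dt \ Ds ∧ H x ⟨i, hi⟩ ∧ pr ⟨i, hi⟩ < s'.reg 6) (by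
    simp [BinOp.eval, hr, h1, h2, h3, h5, hE'.size, ← h4]
    tauto)]
  have hsplit : ∀ z : Fin n, (z : ℕ) < i + 1 → (z : ℕ) < i ∨ z = ⟨i, hi⟩ := fun z hz => by
    rcases Nat.lt_succ_iff_lt_or_eq.1 hz with hz | hz
    · exact .inl hz
    · exact .inr (Fin.ext hz)
  split_ifs with hc
  · right
    refine ⟨⟨i, hi⟩, hc.1, hc.2.1, fun z hz hxz hzi => ?_, ?_, by simp [hr, h3], by simp [hr]⟩
    · rcases hsplit z hzi with hzi | rfl
      · rcases hI with ⟨h6, h7⟩ | ⟨y, -, -, h6, -, h7, -⟩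
        · have := h7 z hz hxz hzi
          have := hc.2.2
          omega
        · have := h6 z hz hxz hzi
          have := hc.2.2
          omega
      · exact le_rfl
    · rcases hI with ⟨h6, -⟩ | ⟨y, -, -, -, h6, h7, -⟩
      · have := hc.2.2
        omega
      · have := hc.2.2
        omega
  · simp only [run_skip, State.setReg_reg]
    rcases hI with ⟨h6, h7⟩ | ⟨y, h6, h7, h8, h9, h10, h11⟩
    · refine .inl ⟨by simpa using h6, fun z hz hxz hzi => ?_⟩
      rcases hsplit z hzi with hzi | rfl
      · exact h7 z hz hxz hzi
      · by_contra hlt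
        exact hc ⟨hz, hxz, by omega⟩
    · refine .inr ⟨y, h6, h7, fun z hz hxz hzi => ?_, h9, by simpa using h10, by simpa using h11⟩
      rcases hsplit z hzi with hzi | rfl
      · exact h8 z hz hxz hzi
      · by_contra hlt
        exact hc ⟨hz, hxz, by omega⟩

/-- Giving up adds a dead element and bidding raises one price, so the potential grows by one in
either case. The negated clause about the old data records that a finished auction stays finished.
-/
theorem run_auctionStep (hE : Env N H Ds Dt s) (hA : AuctionState mt pr dd s)
    (hI : Auction (Ds \ Dt) (Dt \ Ds) H n mt pr dd) :
    ∃ mt' pr' dd', AuctionState mt' pr' dd' (auctionStep.run s) ∧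
      Auction (Ds \ Dt) (Dt \ Ds) H n mt' pr' dd' ∧
      ((∀ x ∈ Ds \ Dt, mt' x = x → x ∈ dd') ∨
        (¬ (∀ x ∈ Ds \ Dt, mt x = x → x ∈ dd) ∧
          ∑ v, pr' v + dd'.card = ∑ v, pr v + dd.card + 1)) := by
  have hdisj : Disjoint (Ds \ Dt) (Dt \ Ds) := disjoint_sdiff_sdiff
  have hE1 := hE.run findBidder (by decide)
  have hA1 := hA.of_frame (findBidder.frame s) (by decide)
  rcases run_findBidder hE hA with ⟨h1, h2⟩ | ⟨x, h1, h2, h3, h4⟩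
  · refine ⟨mt, pr, dd, ?_, hI, .inl h2⟩
    rw [auctionStep, run_seq, run_ite False (by simp [h1])]
    exact hA1
  · rw [auctionStep, run_seq, run_ite True (by simp [h4]), if_pos trivial, run_seq, run_seq,
      run_assign]
    set s1 := findBidder.run s
    set s2 := s1.setReg 5 ((Expr.op .sub (R 5) (K 1)).eval s1) with hs2
    have h5 : s2.reg 5 = x := by simp [hs2, BinOp.eval, h4]
    have hE2 : Env N H Ds Dt s2 := hE1.setReg (by decide) _
    have hA2 : AuctionState mt pr dd s2 := ⟨hA1.mate, hA1.price, hA1.dead⟩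
    have hE3 := hE2.run findBest (by decide)
    have hA3 := hA2.of_frame (findBest.frame s2) (by decide)
    have h53 : (findBest.run s2).reg 5 = x := by
      rw [(findBest.frame s2).reg 5 (by decide), h5]
    rcases run_findBest hE2 hA2 h5 with ⟨h6, h7⟩ | ⟨y, hy, hxy, hmin, hlt, h6, h7⟩
    · refine ⟨mt, pr, insert x dd, ?_, hI.kill h1 h2 h7, .inr ⟨fun h => h3 (h x h1 h2), ?_⟩⟩
      · rw [placeBid, run_ite False (by simp [BinOp.eval, h6, hE3.size])]
        refine ⟨by simpa using hA3.mate, by simpa using hA3.price, ?_⟩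
        simpa [h53] using hA3.dead.insert x
      · rw [Finset.card_insert_of_notMem h3]; omega
    · refine ⟨_, _, dd, ?_, hI.bid hdisj h1 h2 h3 hy hxy hmin hlt,
        .inr ⟨fun h => h3 (h x h1 h2), ?_⟩⟩
      · rw [placeBid, run_ite True (by simp [BinOp.eval, h6, hE3.size, hlt]), if_pos trivial]
        refine ⟨?_, ?_, by simpa using hA3.dead⟩
        · have := ((hA3.mate.update (mt y) (mt y)).update y x).update x y
          simpa [h53, h7, hA3.mate y] using this
        · have := hA3.price.update y (pr y + 1)
          simpa [h53, h7, h6, BinOp.eval] using this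
      · rw [sum_update_succ]; omega

theorem run_auction (hE : Env N H Ds Dt s) (h8 : ∀ i, s.arr 8 i = 0) (h9 : ∀ i, s.arr 9 i = 0) :
    ∃ mt pr dd, AuctionState mt pr dd (auction.run s) ∧
      Auction (Ds \ Dt) (Dt \ Ds) H n mt pr dd ∧ ∀ x ∈ Ds \ Dt, mt x = x → x ∈ dd := by
  set s1 := (loop 3 (write 7 (R 3) (R 3))).run s with hs1
  have hE1 : Env N H Ds Dt s1 := hE.run _ (by decide)
  have hF1 := (loop 3 (write 7 (R 3) (R 3))).frame s
  have hA1 : AuctionState (id : Fin n → Fin n) (fun _ => 0) ∅ s1 := by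
    refine ⟨fun v => ?_, fun v => ?_, fun v => ?_⟩
    · exact run_fill (x := 3) (a := 7) (e := R 3) id (by decide) (fun i _ s' hr _ => hr) v
        (by rw [hE.size]; exact v.2)
    · rw [hF1.arr 8 (by decide), h8]
    · rw [hF1.arr 9 (by decide), h9]; simp
  have key := loop_inv (x := 2) (s := s1) (p := loop 3 auctionStep)
    (fun i s' => ∃ mt pr dd, AuctionState mt pr dd s' ∧
      Auction (Ds \ Dt) (Dt \ Ds) H n mt pr dd ∧
      ((∀ x ∈ Ds \ Dt, mt x = x → x ∈ dd) ∨ i * n ≤ ∑ v, pr v + dd.card)) (by decide)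
    ⟨id, fun _ => 0, ∅, ⟨hA1.mate, hA1.price, hA1.dead⟩, Auction.start _ _ _ _, .inr (by simp)⟩ ?_
  · rw [hE1.size] at key
    obtain ⟨mt, pr, dd, h1, h2, h3⟩ := key
    refine ⟨mt, pr, dd, h1, h2, ?_⟩
    rcases h3 with h3 | h3
    · exact h3
    · intro x hx _
      by_contra hd
      -- After `n * n` rounds, each of which raised the potential, an element that is not dead would
      -- keep the potential below `n * n`.
      have h4 := Auction.potential_lt (mt := mt) (by simpa using h2) disjoint_sdiff_sdiff hx hd
      simp only [Fintype.card_fin] at h4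
      omega
  intro i s' hi hr hF ⟨mt, pr, dd, h1, h2, h3⟩
  have hE' := hE1.of_frame hF (by decide)
  have key := loop_inv (x := 3) (s := s') (p := auctionStep)
    (fun j s' => ∃ mt pr dd, AuctionState mt pr dd s' ∧
      Auction (Ds \ Dt) (Dt \ Ds) H n mt pr dd ∧
      ((∀ x ∈ Ds \ Dt, mt x = x → x ∈ dd) ∨ i * n + j ≤ ∑ v, pr v + dd.card)) (by decide)
    ⟨mt, pr, dd, ⟨h1.mate, h1.price, h1.dead⟩, h2, by simpa using h3⟩ ?_
  · rw [hE'.size] at key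
    obtain ⟨mt, pr, dd, h1, h2, h3⟩ := key
    exact ⟨mt, pr, dd, ⟨h1.mate, h1.price, h1.dead⟩, h2, by rwa [add_mul, one_mul]⟩
  intro j s'' hj hr' hF' ⟨mt, pr, dd, h1, h2, h3⟩
  have hE'' := hE'.of_frame hF' (by decide)
  obtain ⟨mt', pr', dd', h4, h5, h6⟩ := run_auctionStep hE'' h1 h2
  refine ⟨mt', pr', dd', ⟨h4.mate, h4.price, h4.dead⟩, h5, ?_⟩
  rcases h6 with h6 | h6
  · exact .inl h6
  · rcases h3 with h3 | h3
    · exact absurd h3 h6.1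
    · exact .inr (by omega)

/-- The register holds the last gap seen. There need not be one below the current candidate, so the
invariant is conditional; `exists_gap` discharges the condition at the end. -/
theorem run_findGap (hE : Env N H Ds Dt s) (hA : AuctionState mt pr dd s)
    (hY : (Dt \ Ds).card < n) :
    (findGap.run s).reg 8 < n ∧ ∀ y ∈ Dt \ Ds, pr y ≠ (findGap.run s).reg 8 := by
  have key := loop_inv (x := 2) (s := s) (p := assign 5 (K 0) ;;
    loop 3 (ite (eMul (A 2 (R 3)) (eMul (eNot (A 1 (R 3))) (eEq (A 8 (R 3)) (R 2))))
      (assign 5 (K 1)) skip) ;;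
    ite (R 5) skip (assign 8 (R 2)))
    (fun i s' => (∃ p < i, ∀ y ∈ Dt \ Ds, pr y ≠ p) →
      s'.reg 8 < i ∧ ∀ y ∈ Dt \ Ds, pr y ≠ s'.reg 8) (by decide) (by simp) ?_
  · rw [hE.size] at key
    exact key (exists_gap hY)
  intro i s' hi hr hF hI ⟨p, hp, hgap⟩
  have hE' := hE.of_frame hF (by decide)
  have hA' := hA.of_frame hF (by decide)
  set s1 := s'.setReg 5 0 with hs1
  have hE1 : Env N H Ds Dt s1 := hE'.setReg (by decide) _
  have hA1 : AuctionState mt pr dd s1 := ⟨hA'.mate, hA'.price, hA'.dead⟩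
  have hscan := run_scan (x := 3) (r := 5) (s := s1) (f := K 1)
    (e := eMul (A 2 (R 3)) (eMul (eNot (A 1 (R 3))) (eEq (A 8 (R 3)) (R 2))))
    (fun j => ∃ y : Fin n, (y : ℕ) = j ∧ y ∈ Dt \ Ds ∧ pr y = i) (fun _ => 1)
    (by decide) (by
      intro j hj t htr hFt
      rw [hE1.size] at hj
      have hEt := hE1.of_frame hFt (by decide)
      have hAt := hA1.of_frame hFt (by decide)
      have h1 := hEt.source ⟨j, hj⟩
      have h2 := hEt.target ⟨j, hj⟩
      have h3 := hAt.price ⟨j, hj⟩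
      have h4 : t.reg 2 = i := by rw [hFt.reg 2 (by decide)]; simpa [hs1] using hr
      simp only at h1 h2 h3 h4
      refine ⟨?_, by simp⟩
      have : (∃ y : Fin n, (y : ℕ) = j ∧ y ∈ Dt \ Ds ∧ pr y = i) ↔
          (⟨j, hj⟩ : Fin n) ∈ Dt \ Ds ∧ pr ⟨j, hj⟩ = i :=
        ⟨fun ⟨x, hx, h⟩ => by rwa [show x = ⟨j, hj⟩ from Fin.ext hx] at h, fun h => ⟨_, rfl, h⟩⟩
      rw [this]
      simp [BinOp.eval, htr, h1, h2, h3, h4]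
      tauto)
  set q := loop 3 (ite (eMul (A 2 (R 3)) (eMul (eNot (A 1 (R 3))) (eEq (A 8 (R 3)) (R 2))))
      (assign 5 (K 1)) skip) with hq
  have hFq := q.frame s1
  have h2 : (q.run s1).reg 2 = i := by rw [hFq.reg 2 (by decide)]; simpa [hs1] using hr
  have h8 : (q.run s1).reg 8 = s'.reg 8 := by rw [hFq.reg 8 (by decide)]; simp [hs1]
  simp only [run_seq, run_assign, Expr.eval_lit, ← hs1]
  rcases hscan with ⟨h3, h4⟩ | ⟨j, -, ⟨y, -, hy, hyp⟩, h4⟩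
  · have h3' : (q.run s1).reg 5 = 0 := by rw [h3]; simp [hs1]
    rw [run_ite False (by simp [h3'])]
    simp only [if_false, run_assign, Expr.eval_reg, h2, State.setReg_reg]
    refine ⟨by simp, fun y hy hyp => h4 y (by rw [hE1.size]; exact y.2) ⟨y, rfl, hy, ?_⟩⟩
    simpa using hyp
  · rw [run_ite True (by simp [h4])]
    have hpi : p ≠ i := fun e => hgap y hy (by rw [hyp, e])
    obtain ⟨h5, h6⟩ := hI ⟨p, by omega, hgap⟩
    simp only [if_true, run_skip, State.setReg_reg, h8]
    exact ⟨by simpa using h5.trans (Nat.lt_succ_self i), by simpa using h6⟩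

theorem run_splitMatching (hE : Env N H Ds Dt s) (hA : AuctionState mt pr dd s) {p : ℕ}
    (hp : s.reg 8 = p) :
    RepF ((splitMatching.run s).arr 12) (partSwap mt (fun v => p < pr v)) ∧
    RepF ((splitMatching.run s).arr 13) (partSwap' mt (fun v => p < pr v)) ∧
    RepS ((splitMatching.run s).arr 10)
      (Finset.univ.filter fun v => partSwap mt (fun v => p < pr v) v ∈ Ds) ∧
    RepS ((splitMatching.run s).arr 11)
      (Finset.univ.filter fun v => partSwap' mt (fun v => p < pr v) v ∈ Dt) := by
  have key := loop_inv (x := 2) (s := s) (p :=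
    ite (eAdd (eLt (R 8) (A 8 (R 2))) (eLt (R 8) (A 8 (A 7 (R 2)))))
      (write 12 (R 2) (A 7 (R 2)) ;; write 13 (R 2) (R 2))
      (write 12 (R 2) (R 2) ;; write 13 (R 2) (A 7 (R 2))) ;;
    write 10 (R 2) (A 1 (A 12 (R 2))) ;;
    write 11 (R 2) (A 2 (A 13 (R 2))))
    (fun i s' => ∀ v : Fin n, (v : ℕ) < i →
      s'.arr 12 v = partSwap mt (fun v => p < pr v) v ∧
      s'.arr 13 v = partSwap' mt (fun v => p < pr v) v ∧
      s'.arr 10 v = (if partSwap mt (fun v => p < pr v) v ∈ Ds then 1 else 0) ∧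
      s'.arr 11 v = (if partSwap' mt (fun v => p < pr v) v ∈ Dt then 1 else 0))
    (by decide) (by simp) ?_
  · rw [hE.size] at key
    refine ⟨fun v => (key v v.2).1, fun v => (key v v.2).2.1, fun v => ?_, fun v => ?_⟩
    · rw [splitMatching, (key v v.2).2.2.1]; simp
    · rw [splitMatching, (key v v.2).2.2.2]; simp
  intro i s' hi hr hF hI v hv
  rw [hE.size] at hi
  have hE' := hE.of_frame hF (by decide)
  have hA' := hA.of_frame hF (by decide)
  have h8 : s'.reg 8 = p := (hF.reg 8 (by decide)).trans hp
  have h7 := hA'.mate ⟨i, hi⟩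
  have h9 := hA'.price ⟨i, hi⟩
  have h10 := hA'.price (mt ⟨i, hi⟩)
  have h11 := hE'.source ⟨i, hi⟩
  have h12 := hE'.target ⟨i, hi⟩
  simp only at h7 h9 h11 h12
  rw [run_seq, run_ite (p < pr ⟨i, hi⟩ ∨ p < pr (mt ⟨i, hi⟩)) (by
    simp only [Expr.eval_op, Expr.eval_reg, Expr.eval_read, BinOp.eval, hr, h8, h7, h9, h10]
    split_ifs <;> simp [*])]
  by_cases hT : p < pr ⟨i, hi⟩ ∨ p < pr (mt ⟨i, hi⟩)
  · rw [if_pos hT]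
    by_cases hvi : (v : ℕ) = i
    · have hv' : v = ⟨i, hi⟩ := Fin.ext hvi
      have e1 : partSwap mt (fun v => p < pr v) v = mt v := by rw [hv']; exact if_pos hT
      have e2 : partSwap' mt (fun v => p < pr v) v = v := by rw [hv']; exact if_pos hT
      rw [e1, e2, hv']
      simp [hr, h7, hE'.source (mt ⟨i, hi⟩), h12]
    · simpa [hr, Function.update_of_ne hvi] using hI v (by omega)
  · rw [if_neg hT]
    by_cases hvi : (v : ℕ) = i
    · have hv' : v = ⟨i, hi⟩ := Fin.ext hvi
      have e1 : partSwap mt (fun v => p < pr v) v = v := by rw [hv']; exact if_neg hT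
      have e2 : partSwap' mt (fun v => p < pr v) v = mt v := by rw [hv']; exact if_neg hT
      rw [e1, e2, hv']
      simp [hr, h7, hE'.target (mt ⟨i, hi⟩), h11]
    · simpa [hr, Function.update_of_ne hvi] using hI v (by omega)

end Auction

end TokenReconf

/-! ### Making two tokens slow -/

namespace WordRAM

open FProg

/-- Array `22` receives, for each vertex of the set in array `20`, an out-neighbour in the digraph
that is given by the test `e` on the registers `2` and `3`. -/
def chooseArcs (e : Expr) : FProg :=
  loop 2 (write 22 (R 2) (R 2) ;;
    loop 3 (ite (eMul (A 20 (R 2)) (eMul (A 20 (R 3)) (eMul (eNot (eEq (R 2) (R 3))) e)))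
      (write 22 (R 2) (R 3)) skip))

/-- Follow the chosen arcs for `n` steps. -/
def followArcs : FProg := loop 2 (assign 5 (A 22 (R 5)))

/-- Follow the chosen arcs for `n` steps and change the move in array `21` on the way. -/
def rotate (dst src : Expr) : FProg :=
  loop 2 (write 21 dst (A 23 src) ;; assign 5 (A 22 (R 5)))

/-- Change the move in array `21` of the set in array `20` such that two tokens move to
neighbours. -/
def slowDown : FProg :=
  chooseArcs (A 5 (ix (R 2) (A 21 (R 3)))) ;;
  assign 5 (K 0) ;; loop 2 (ite (A 20 (R 2)) (assign 5 (R 2)) skip) ;;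
  followArcs ;; assign 6 (R 5) ;; copyArr 21 23 ;; rotate (R 5) (A 22 (R 5)) ;;
  chooseArcs (A 5 (ix (R 3) (A 21 (R 2)))) ;;
  assign 5 (R 6) ;;
  loop 2 (ite (eMul (A 20 (R 2)) (eNot (eEq (R 2) (R 6)))) (assign 5 (R 2)) skip) ;;
  followArcs ;; copyArr 21 23 ;; rotate (A 22 (R 5)) (R 5)

end WordRAM

namespace TokenReconf

open WordRAM FProg

variable {n : ℕ}

theorem RepF.copy {g : Fin n → Fin n} {s : State} (h0 : s.reg 0 = n) {a b : ℕ} (hab : a ≠ b)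
    (h : RepF (s.arr a) g) : RepF (((copyArr a b).run s).arr b) g := fun v => by
  rw [run_copyArr hab s v (by rw [h0]; exact v.2), h v]

theorem RepS.copy {D : Finset (Fin n)} {s : State} (h0 : s.reg 0 = n) {a b : ℕ} (hab : a ≠ b)
    (h : RepS (s.arr a) D) : RepS (((copyArr a b).run s).arr b) D := fun v => by
  rw [run_copyArr hab s v (by rw [h0]; exact v.2), h v]

/-- Each entry is first set to the vertex itself, and this loop survives only if no arc leaves the
vertex: these are the two cases of `IsChoice`. -/
theorem run_chooseArcs {e : Expr} {s : State} {P : Finset (Fin n)} (E : Fin n → Fin n → Prop)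
    (h0 : s.reg 0 = n) (hP : RepS (s.arr 20) P)
    (he : ∀ (x y : Fin n) s', Frame [2, 3] [22] s s' → s'.reg 2 = x → s'.reg 3 = y →
      (e.eval s' ≠ 0 ↔ E x y)) :
    ∃ h, RepF (((chooseArcs e).run s).arr 22) h ∧
      IsChoice (fun x y => x ∈ P ∧ y ∈ P ∧ x ≠ y ∧ E x y) h := by
  classical
  set E' : Fin n → Fin n → Prop := fun x y => x ∈ P ∧ y ∈ P ∧ x ≠ y ∧ E x y with hE'
  have key := loop_inv (x := 2) (s := s) (p := write 22 (R 2) (R 2) ;;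
    loop 3 (ite (eMul (A 20 (R 2)) (eMul (A 20 (R 3)) (eMul (eNot (eEq (R 2) (R 3))) e)))
      (write 22 (R 2) (R 3)) skip))
    (fun i s' => ∀ x : Fin n, (x : ℕ) < i →
      ∃ y : Fin n, s'.arr 22 x = y ∧ (E' x y ∨ (y = x ∧ ∀ z, ¬ E' x z)))
    (by simp [regs]) (by simp) ?_
  · rw [h0] at key
    choose h h1 h2 using fun x : Fin n => key x x.2
    exact ⟨h, h1, h2⟩
  intro i s' hi hr hF hI
  rw [h0] at hi
  set s1 := s'.setArr 22 i i with hs1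
  have hrun : (write 22 (R 2) (R 2)).run s' = s1 := by simp [hs1, hr]
  have h01 : s1.reg 0 = n := (hF.reg 0 (by simp [regs])).trans h0
  have hF1 : Frame [2, 3] [22] s s1 := by
    refine (hF.mono (by simp [regs]) (by simp [arrs])).trans ⟨fun _ _ => rfl, fun a ha => ?_⟩
    have : a ≠ 22 := by simpa using ha
    simp [hs1, this]
  have key := loop_inv (x := 3) (s := s1)
    (p := ite (eMul (A 20 (R 2)) (eMul (A 20 (R 3)) (eMul (eNot (eEq (R 2) (R 3))) e)))
      (write 22 (R 2) (R 3)) skip)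
    (fun j t => (∀ x : Fin n, (x : ℕ) < i →
      ∃ y : Fin n, t.arr 22 x = y ∧ (E' x y ∨ (y = x ∧ ∀ z, ¬ E' x z))) ∧
      ∃ y : Fin n, t.arr 22 i = y ∧
        (E' ⟨i, hi⟩ y ∨ (y = ⟨i, hi⟩ ∧ ∀ z : Fin n, (z : ℕ) < j → ¬ E' ⟨i, hi⟩ z)))
    (by simp [regs]) ?_ ?_
  · rw [h01] at key
    rw [run_seq, hrun]
    intro x hx
    rw [State.setReg_arr]
    by_cases hxi : (x : ℕ) = i
    · obtain ⟨y, h1, h2⟩ := key.2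
      refine ⟨y, by rw [hxi, h1], ?_⟩
      rw [show x = ⟨i, hi⟩ from Fin.ext hxi]
      simpa using h2
    · exact key.1 x (by omega)
  · refine ⟨fun x hx => ?_, ⟨i, hi⟩, by simp [hs1], .inr ⟨rfl, by simp⟩⟩
    have hxi : (x : ℕ) ≠ i := by omega
    obtain ⟨y, h1, h2⟩ := hI x hx
    exact ⟨y, by simpa [hs1, Function.update_of_ne hxi] using h1, h2⟩
  intro j t hj htr hFt ⟨hI1, y, hI2, hI3⟩
  rw [h01] at hj
  have ht2 : t.reg 2 = i := (hFt.reg 2 (by simp [regs])).trans hr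
  have hFt' : Frame [2, 3] [22] s t := hF1.trans (hFt.mono (by simp [regs]) (by simp [arrs]))
  have he' := he ⟨i, hi⟩ ⟨j, hj⟩ t hFt' ht2 htr
  have hPi := hP ⟨i, hi⟩
  have hPj := hP ⟨j, hj⟩
  have h20 : t.arr 20 = s.arr 20 := hFt'.arr 20 (by decide)
  simp only at hPi hPj
  rw [run_ite (E' ⟨i, hi⟩ ⟨j, hj⟩) (by
    simp only [hE', ← he']
    simp [BinOp.eval, ht2, htr, h20, hPi, hPj]
    tauto)]
  by_cases hc : E' ⟨i, hi⟩ ⟨j, hj⟩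
  · rw [if_pos hc]
    refine ⟨fun x hx => ?_, ⟨j, hj⟩, by simp [ht2, htr], .inl hc⟩
    have hxi : (x : ℕ) ≠ i := by omega
    obtain ⟨y, h1, h2⟩ := hI1 x hx
    exact ⟨y, by simpa [ht2, Function.update_of_ne hxi] using h1, h2⟩
  · rw [if_neg hc]
    refine ⟨hI1, y, hI2, hI3.imp_right fun ⟨h1, h2⟩ => ⟨h1, fun z hz => ?_⟩⟩
    rcases Nat.lt_succ_iff_lt_or_eq.1 hz with hz | hz
    · exact h2 z hz
    · rwa [show z = ⟨j, hj⟩ from Fin.ext hz]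

theorem run_followArcs {s : State} {h : Fin n → Fin n} (h0 : s.reg 0 = n) (hh : RepF (s.arr 22) h)
    {x : Fin n} (hx : s.reg 5 = x) : (followArcs.run s).reg 5 = (h^[n] x : Fin n) := by
  have key := loop_inv (x := 2) (s := s) (p := assign 5 (A 22 (R 5)))
    (fun i s' => s'.reg 5 = (h^[i] x : Fin n)) (by decide) (by simpa using hx) ?_
  · rwa [h0] at key
  intro i s' _ _ hF hI
  have h22 : s'.arr 22 = s.arr 22 := hF.arr 22 (by decide)
  simp [Function.iterate_succ_apply', hI, h22, hh _]

/-- The `n` steps may go around the cycle several times. Values are read from the copy in array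
`23`, and `hαβ` ensures that entries written repeatedly get the same value each time. -/
theorem run_rotate {dst src : Expr} {s : State} {h α β g : Fin n → Fin n} {c : Fin n}
    (h0 : s.reg 0 = n) (hh : RepF (s.arr 22) h) (hg : RepF (s.arr 21) g)
    (hg' : RepF (s.arr 23) g) (hc : s.reg 5 = c)
    (hd : ∀ (v : Fin n) s', Frame [2, 5] [21] s s' → s'.reg 5 = v → dst.eval s' = α v)
    (hs : ∀ (v : Fin n) s', Frame [2, 5] [21] s s' → s'.reg 5 = v → src.eval s' = β v)
    (hαβ : ∀ i j, α (h^[i] c) = α (h^[j] c) → β (h^[i] c) = β (h^[j] c)) :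
    ∃ g', RepF (((rotate dst src).run s).arr 21) g' ∧
      (∀ i < n, g' (α (h^[i] c)) = g (β (h^[i] c))) ∧
      ∀ v, (∀ i < n, α (h^[i] c) ≠ v) → g' v = g v := by
  have key := loop_inv (x := 2) (s := s) (p := write 21 dst (A 23 src) ;; assign 5 (A 22 (R 5)))
    (fun j s' => s'.reg 5 = (h^[j] c : Fin n) ∧ ∃ g', RepF (s'.arr 21) g' ∧
      (∀ i < j, g' (α (h^[i] c)) = g (β (h^[i] c))) ∧
      ∀ v, (∀ i < j, α (h^[i] c) ≠ v) → g' v = g v) (by simp [regs])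
    ⟨by simpa using hc, g, hg, by simp, by simp⟩ ?_
  · rw [h0] at key
    exact key.2
  intro j s' _ _ hF ⟨h5, g', h1, h2, h3⟩
  have hF' : Frame [2, 5] [21] s s' := hF.mono (by simp [regs]) (by simp [arrs])
  have h22 : s'.arr 22 = s.arr 22 := hF'.arr 22 (by decide)
  have h23 : s'.arr 23 = s.arr 23 := hF'.arr 23 (by decide)
  refine ⟨by simp [Function.iterate_succ_apply', h5, h22, hh _],
    Function.update g' (α (h^[j] c)) (g (β (h^[j] c))), ?_, fun i hi => ?_, fun v hv => ?_⟩
  · have := h1.update (α (h^[j] c)) (g (β (h^[j] c)))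
    simpa [hd _ s' hF' h5, hs _ s' hF' h5, h23, hg' _] using this
  · rcases Nat.lt_succ_iff_lt_or_eq.1 hi with hi | rfl
    · rw [Function.update_apply]
      split_ifs with he
      · rw [hαβ i j he]
      · exact h2 i hi
    · rw [Function.update_self]
  · rw [Function.update_of_ne (hv j (by omega)).symm]
    exact h3 v fun i hi => hv i (by omega)

theorem run_slowDown {N H : Fin n → Fin n → Prop} {Ds Dt P Q : Finset (Fin n)} {s : State}
    {g : Fin n → Fin n} (hE : Env N H Ds Dt s) (hP : RepS (s.arr 20) P) (hg : RepF (s.arr 21) g)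
    (hn : 0 < n) (hbij : Set.BijOn g P Q) (hsymm : ∀ u v, N u v → N v u)
    (hNH : ∀ x y, N x y → H x y) (hH : ∀ x ∈ P, H x (g x)) (hDP : Dom N P) (hDQ : Dom N Q) :
    ∃ g', RepF ((slowDown.run s).arr 21) g' ∧ Set.BijOn g' P Q ∧ (∀ x ∈ P, H x (g' x)) ∧
      TwoSlow N P g' := by
  have hPne : ∃ x, x ∈ P := (hDP ⟨0, hn⟩).imp fun _ h => h.1
  -- the first round
  obtain ⟨h, hh, hch⟩ := run_chooseArcs (e := A 5 (ix (R 2) (A 21 (R 3)))) (s := s) (P := P)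
    (fun x y => N x (g y)) hE.size hP (fun x y s' hF h2 h3 => by
      have hE' := hE.of_frame hF (by decide)
      have h21 : s'.arr 21 = s.arr 21 := hF.arr 21 (by decide)
      rw [← hE'.near]
      simp [BinOp.eval, h2, h3, hE'.size, h21, hg y])
  unfold slowDown
  simp only [run_seq, run_assign, Expr.eval_lit, Expr.eval_reg]
  set s1 := (chooseArcs (A 5 (ix (R 2) (A 21 (R 3))))).run s with hs1
  have hF1 : Frame [2, 3] [22] s s1 := ((chooseArcs _).frame s).mono
    (by simp [chooseArcs, regs]) (by simp [chooseArcs, arrs])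
  have hE1 := hE.of_frame hF1 (by decide)
  have hscan := run_scan (x := 2) (r := 5) (s := s1.setReg 5 0) (e := A 20 (R 2)) (f := R 2)
    (fun i => ∃ x : Fin n, (x : ℕ) = i ∧ x ∈ P) id (by decide) (fun i hi s' hr hF => by
      rw [(hE1.setReg (by decide) 0).size] at hi
      have h20 : s'.arr 20 = s.arr 20 := (hF.arr 20 (by decide)).trans (hF1.arr 20 (by decide))
      have := hP.ne_zero ⟨i, hi⟩
      simp only at this
      refine ⟨?_, by simpa using hr⟩
      rw [Expr.eval_read, Expr.eval_reg, hr, h20, this]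
      exact ⟨fun h => ⟨_, rfl, h⟩, fun ⟨x, hx, h⟩ => by rwa [← show x = ⟨i, hi⟩ from Fin.ext hx]⟩)
  set q := loop 2 (ite (A 20 (R 2)) (assign 5 (R 2)) skip) with hq
  set s2 := q.run (s1.setReg 5 0) with hs2
  have hE2 : Env N H Ds Dt s2 := (hE1.setReg (by decide) 0).run q (by decide)
  have hF2 : Frame [2, 5] [] (s1.setReg 5 0) s2 := q.frame _
  obtain ⟨x, hxP, hx5⟩ : ∃ x ∈ P, s2.reg 5 = x := by
    rcases hscan with ⟨-, h⟩ | ⟨i, -, ⟨x, rfl, hx⟩, h⟩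
    · obtain ⟨x, hx⟩ := hPne
      exact absurd ⟨x, rfl, hx⟩ (h x (by rw [(hE1.setReg (by decide) 0).size]; exact x.2))
    · exact ⟨x, hx, h⟩
  have hh2 : RepF (s2.arr 22) h := by rw [hF2.arr 22 (by decide)]; exact hh
  have hc5 := run_followArcs hE2.size hh2 hx5
  set c := h^[n] x with hc
  set s3 := followArcs.run s2 with hs3
  have hF3 : Frame [2, 5] [] s2 s3 := followArcs.frame _
  have hE3 := hE2.of_frame hF3 (by decide)
  have hper : c ∈ Function.periodicPts h := by
    have := iterate_card_mem_periodicPts h x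
    rwa [Fintype.card_fin] at this
  have hhP : ∀ x ∈ (P : Set (Fin n)), h x ∈ (P : Set (Fin n)) := fun x hx => by
    rcases hch x with h | h
    · exact h.2.1
    · rwa [h.1]
  have hcP : c ∈ P := orbit_subset hhP hxP ⟨n, rfl⟩
  set s4 := s3.setReg 6 (s3.reg 5) with hs4
  have hE4 : Env N H Ds Dt s4 := hE3.setReg (by decide) _
  have h214 : s4.arr 21 = s.arr 21 := by
    rw [hs4, State.setReg_arr, hF3.arr 21 (by decide), hF2.arr 21 (by decide),
      State.setReg_arr, hF1.arr 21 (by decide)]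
  have hg4 : RepF (s4.arr 21) g := by rw [h214]; exact hg
  have hg23 := RepF.copy hE4.size (show 21 ≠ 23 by decide) hg4
  set s5 := (copyArr 21 23).run s4 with hs5
  have hF5 : Frame [3] [23] s4 s5 := (copyArr 21 23).frame _
  have hE5 := hE4.of_frame hF5 (by decide)
  have h55 : s5.reg 5 = c := by
    rw [hF5.reg 5 (by decide), hs4, State.setReg_reg, if_neg (by decide), hc5]
  have h56 : s5.reg 6 = c := by
    rw [hF5.reg 6 (by decide), hs4, State.setReg_reg, if_pos rfl, hc5]
  have hh5 : RepF (s5.arr 22) h := by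
    rw [hF5.arr 22 (by decide), hs4, State.setReg_arr, hF3.arr 22 (by decide)]; exact hh2
  obtain ⟨g1, hg1, hg1a, hg1b⟩ := run_rotate (dst := R 5) (src := A 22 (R 5)) (α := id) (β := h)
    hE5.size hh5 (by rw [hF5.arr 21 (by decide)]; exact hg4) hg23 h55 (fun v s' _ h => by simpa using h)
    (fun v s' hF h => by
      rw [Expr.eval_read, Expr.eval_reg, h, hF.arr 22 (by decide)]; exact hh5 v)
    (fun i j h => congrArg _ h)
  set s6 := (rotate (R 5) (A 22 (R 5))).run s5 with hs6
  have hF6 : Frame [2, 5] [21] s5 s6 := (rotate _ _).frame _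
  have hE6 := hE5.of_frame hF6 (by decide)
  obtain ⟨hb1, hH1, hfirst⟩ := bijOn_rotate_forward hbij hNH hH
    (fun x _ => hDQ x) hch hcP hper (g' := g1)
    (fun x hx => by
      obtain ⟨i, hi, rfl⟩ := exists_lt_card_iterate hper hx
      exact hg1a i (by simpa using hi))
    (fun x hx => hg1b x fun i _ he => hx ⟨i, he⟩)
  -- the second round
  have h206 : RepS (s6.arr 20) P := by
    rw [hF6.arr 20 (by decide), hF5.arr 20 (by decide), hs4, State.setReg_arr,
      hF3.arr 20 (by decide), hF2.arr 20 (by decide), State.setReg_arr, hF1.arr 20 (by decide)]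
    exact hP
  obtain ⟨k, hk, hck⟩ := run_chooseArcs (e := A 5 (ix (R 3) (A 21 (R 2)))) (s := s6) (P := P)
    (fun x y => N y (g1 x)) hE6.size h206 (fun x y s' hF h2 h3 => by
      have hE' := hE6.of_frame hF (by decide)
      have h21 : s'.arr 21 = s6.arr 21 := hF.arr 21 (by decide)
      rw [← hE'.near]
      simp [BinOp.eval, h2, h3, hE'.size, h21, hg1 x])
  set s7 := (chooseArcs (A 5 (ix (R 3) (A 21 (R 2))))).run s6 with hs7
  have hF7 : Frame [2, 3] [22] s6 s7 := ((chooseArcs _).frame s6).mono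
    (by simp [chooseArcs, regs]) (by simp [chooseArcs, arrs])
  have hE7 := hE6.of_frame hF7 (by decide)
  have h67 : s7.reg 6 = c := by
    rw [hF7.reg 6 (by decide), hF6.reg 6 (by decide), h56]
  rw [h67]
  have hscan2 := run_scan (x := 2) (r := 5) (s := s7.setReg 5 c)
    (e := eMul (A 20 (R 2)) (eNot (eEq (R 2) (R 6)))) (f := R 2)
    (fun i => ∃ x : Fin n, (x : ℕ) = i ∧ x ∈ P ∧ x ≠ c) id (by decide) (fun i hi s' hr hF => by
      rw [(hE7.setReg (by decide) _).size] at hi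
      have h20 : s'.arr 20 = s6.arr 20 := (hF.arr 20 (by decide)).trans (hF7.arr 20 (by decide))
      have h6 : s'.reg 6 = c := by
        rw [hF.reg 6 (by decide), State.setReg_reg, if_neg (by decide), h67]
      have := h206 ⟨i, hi⟩
      simp only at this
      refine ⟨?_, by simpa using hr⟩
      have hex : (∃ x : Fin n, (x : ℕ) = i ∧ x ∈ P ∧ x ≠ c) ↔
          (⟨i, hi⟩ : Fin n) ∈ P ∧ (⟨i, hi⟩ : Fin n) ≠ c :=
        ⟨fun ⟨x, hx, h⟩ => by rwa [show x = ⟨i, hi⟩ from Fin.ext hx] at h, fun h => ⟨_, rfl, h⟩⟩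
      rw [hex]
      simp [BinOp.eval, hr, h20, this, h6, Fin.ext_iff]
      tauto)
  set q2 := loop 2 (ite (eMul (A 20 (R 2)) (eNot (eEq (R 2) (R 6)))) (assign 5 (R 2)) skip)
    with hq2
  set s8 := q2.run (s7.setReg 5 c) with hs8
  have hE8 : Env N H Ds Dt s8 := (hE7.setReg (by decide) _).run q2 (by decide)
  have hF8 : Frame [2, 5] [] (s7.setReg 5 c) s8 := q2.frame _
  -- The second walk must not start at `c`; the default value `c` remains only if it is the sole
  -- token.
  obtain ⟨y, hyP, hy, hy5⟩ : ∃ y ∈ P, (y ≠ c ∨ P = {c}) ∧ s8.reg 5 = y := by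
    rcases hscan2 with ⟨h1, h⟩ | ⟨i, -, ⟨y, rfl, hy, hyc⟩, h⟩
    · refine ⟨c, hcP, .inr ?_, by rw [h1]; simp⟩
      refine Finset.eq_singleton_iff_unique_mem.2 ⟨hcP, fun y hy => ?_⟩
      by_contra hyc
      exact h y (by rw [(hE7.setReg (by decide) _).size]; exact y.2) ⟨y, rfl, hy, hyc⟩
    · exact ⟨y, hy, .inl hyc, h⟩
  have hk8 : RepF (s8.arr 22) k := by rw [hF8.arr 22 (by decide)]; exact hk
  have hc9 := run_followArcs hE8.size hk8 hy5
  set c' := k^[n] y with hc'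
  set s9 := followArcs.run s8 with hs9
  have hF9 : Frame [2, 5] [] s8 s9 := followArcs.frame _
  have hE9 := hE8.of_frame hF9 (by decide)
  have hper' : c' ∈ Function.periodicPts k := by
    have := iterate_card_mem_periodicPts k y
    rwa [Fintype.card_fin] at this
  have hg9 : RepF (s9.arr 21) g1 := by
    rw [hF9.arr 21 (by decide), hF8.arr 21 (by decide), State.setReg_arr, hF7.arr 21 (by decide)]
    exact hg1
  have hg10 := RepF.copy hE9.size (show 21 ≠ 23 by decide) hg9
  set s10 := (copyArr 21 23).run s9 with hs10
  have hF10 : Frame [3] [23] s9 s10 := (copyArr 21 23).frame _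
  have hE10 := hE9.of_frame hF10 (by decide)
  have hk10 : RepF (s10.arr 22) k := by
    rw [hF10.arr 22 (by decide), hF9.arr 22 (by decide)]; exact hk8
  obtain ⟨g2, hg2, hg2a, hg2b⟩ := run_rotate (dst := A 22 (R 5)) (src := R 5) (α := k) (β := id)
    hE10.size hk10 (by rw [hF10.arr 21 (by decide)]; exact hg9) hg10
    ((hF10.reg 5 (by decide)).trans hc9)
    (fun v s' hF h => by
      rw [Expr.eval_read, Expr.eval_reg, h, hF.arr 22 (by decide)]; exact hk10 v)
    (fun v s' _ h => by simpa using h)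
    -- The entry written belongs to `k v`, which determines `v` because `k` is injective on its
    -- cycle.
    (fun i j h => (bijOn_orbit hper').injOn ⟨i, rfl⟩ ⟨j, rfl⟩ h)
  obtain ⟨h1, h2, h3⟩ := bijOn_rotate_backward hb1 hNH hH1
    (fun u _ => (hDP u).imp fun x hx => ⟨hx.1, hsymm _ _ hx.2⟩) hfirst hcP hy hck hyP
    (c := c') ⟨n, rfl⟩ hper' (g' := g2)
    (fun x hx => by
      obtain ⟨i, hi, rfl⟩ := exists_lt_card_iterate hper' hx
      exact hg2a i (by simpa using hi))
    (fun x hx => hg2b x fun i _ he => hx (he ▸ map_mem_orbit ⟨i, rfl⟩))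
  exact ⟨g2, hg2, h1, h2, h3⟩

end TokenReconf

/-! ### Writing down the moves -/

namespace WordRAM

open FProg

/-- Append to the output the set in array `a` and the move in array `b`. On a graph with one vertex
nothing is appended. -/
def emit (a b : ℕ) : FProg :=
  loop 4 (write 3 (ix (R 1) (R 4)) (A a (R 4)) ;; write 4 (ix (R 1) (R 4)) (A b (R 4))) ;;
  assign 1 (eAdd (R 1) (eLt (K 1) (R 0)))

/-- A breadth-first search from vertex `0`; array `14` receives the depths, increased by one, and
array `15` the parents. -/
def bfs : FProg :=
  write 14 (K 0) (K 1) ;;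
  loop 2 (loop 3 (ite (eEq (A 14 (R 3)) (eAdd (R 2) (K 1)))
    (loop 4 (ite (eMul (A 5 (ix (R 3) (R 4))) (eNot (A 14 (R 4))))
      (write 14 (R 4) (eAdd (R 2) (K 2)) ;; write 15 (R 4) (R 3)) skip)) skip))

/-- Array `16` receives the first steps of paths to the vertex in register `5`. -/
def reroot : FProg :=
  copyArr 15 16 ;; assign 6 (R 5) ;;
  loop 3 (ite (R 6) (write 16 (A 15 (R 6)) (R 6) ;; assign 6 (A 15 (R 6))) skip)

/-- The travelling token, last put on the vertex in register `6`, proceeds from the vertex in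
register `7` to the next one; the move is written down as soon as this vertex is free. -/
def stepToken : FProg :=
  ite (eEq (R 7) (R 5)) skip (
    write 17 (R 7) (A 16 (R 7)) ;; assign 7 (A 16 (R 7)) ;;
    ite (A 10 (R 7)) skip (
      write 10 (R 6) (K 1) ;; emit 10 17 ;; write 10 (R 6) (K 0) ;; assign 6 (R 7) ;;
      loop 4 (write 17 (R 4) (R 4))))

/-- Move the token on the vertex in register `2` to the vertex in register `5`. -/
def moveToken : FProg :=
  reroot ;; write 10 (R 2) (K 0) ;; assign 6 (R 2) ;; assign 7 (R 2) ;;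
  loop 3 (write 17 (R 3) (R 3)) ;; loop 3 (stepToken ;; stepToken) ;; write 10 (R 5) (K 1)

/-- Change the set in array `10` into the set in array `11`, token by token. -/
def transfer : FProg :=
  loop 2 (ite (eMul (A 10 (R 2)) (eNot (A 11 (R 2))))
    (assign 5 (K 0) ;; loop 3 (ite (eMul (A 11 (R 3)) (eNot (A 10 (R 3)))) (assign 5 (R 3)) skip) ;;
      moveToken) skip)

end WordRAM

namespace TokenReconf

open WordRAM FProg

variable {n : ℕ}

/-- The closed neighbourhood relation. -/
def Near (G : SimpleGraph (Fin n)) (u v : Fin n) : Prop := u = v ∨ G.Adj u v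

theorem Near.symm {G : SimpleGraph (Fin n)} {u v : Fin n} (h : Near G u v) : Near G v u :=
  h.imp Eq.symm fun h => h.symm

theorem Near.edist_le {G : SimpleGraph (Fin n)} {u v : Fin n} (h : Near G u v) :
    G.edist u v ≤ 1 := by
  rcases h with rfl | h
  · simp
  · exact (SimpleGraph.edist_eq_one_iff_adj.2 h).le

theorem isDominating_iff {G : SimpleGraph (Fin n)} {D : Finset (Fin n)} :
    IsDominating G D ↔ Dom (Near G) D := by
  refine forall_congr' fun v => ⟨?_, ?_⟩
  · rintro (h | ⟨u, h1, h2⟩)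
    · exact ⟨v, h, .inl rfl⟩
    · exact ⟨u, h1, .inr h2⟩
  · rintro ⟨u, h1, rfl | h2⟩
    · exact .inl h1
    · exact .inr ⟨u, h1, h2⟩

/-- The sets that may occur in a reconfiguration sequence. -/
def Feasible (G : SimpleGraph (Fin n)) (k : ℕ) (A : Finset (Fin n)) : Prop :=
  IsDominating G A ∧ A.card = k

/-- The output contains a reconfiguration sequence from `A` to `B`, except for the last set. -/
def Hist (G : SimpleGraph (Fin n)) (k : ℕ) (A B : Finset (Fin n)) (s : State) : Prop :=
  (n ≤ 1 → s.reg 1 = 0) ∧ ∃ D f,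
    IsReconfSequence G (Feasible G k) (k - 2) 2 A B (s.reg 1) D f ∧
    ∀ i < s.reg 1, RepS (fun v => s.arr 3 (i * n + v)) (D i) ∧
      ∀ v ∈ D i, s.arr 4 (i * n + v) = f i v

section Hist

variable {G : SimpleGraph (Fin n)} {k : ℕ} {A B B' : Finset (Fin n)} {s s' : State}

theorem Hist.feasible (h : Hist G k A B s) : Feasible G k B := by
  obtain ⟨-, D, f, hD, -⟩ := h
  rw [← hD.finish]
  exact hD.feasible _ le_rfl

theorem Hist.congr (h : Hist G k A B s) (h1 : s'.reg 1 = s.reg 1) (h3 : s'.arr 3 = s.arr 3)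
    (h4 : s'.arr 4 = s.arr 4) : Hist G k A B s' := by
  unfold Hist
  rw [h1, h3, h4]
  exact h

theorem Hist.of_frame (h : Hist G k A B s) {rs as : List ℕ} (hF : Frame rs as s s')
    (hd : 1 ∉ rs ∧ 3 ∉ as ∧ 4 ∉ as) : Hist G k A B s' :=
  h.congr (hF.reg 1 hd.1) (hF.arr 3 hd.2.1) (hF.arr 4 hd.2.2)

/-- A graph with one vertex has diameter 0 and so admits no move at all. Since all feasible sets
coincide there, skipping every move is harmless. -/
theorem Feasible.eq_univ (h : Feasible G k A) (hn : n ≤ 1) : A = Finset.univ := by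
  refine Finset.eq_univ_iff_forall.2 fun v => ?_
  obtain ⟨u, hu, -⟩ := isDominating_iff.1 h.1 v
  rwa [show v = u from Fin.ext (by omega)]

theorem run_emit_loop {a b : ℕ} (ha : a ≠ 3 ∧ a ≠ 4) (hb : b ≠ 3 ∧ b ≠ 4) (s : State) :
    (∀ v < s.reg 0, ((emit a b).run s).arr 3 (s.reg 1 * s.reg 0 + v) = s.arr a v ∧
      ((emit a b).run s).arr 4 (s.reg 1 * s.reg 0 + v) = s.arr b v) ∧
    ∀ m < s.reg 1 * s.reg 0, ((emit a b).run s).arr 3 m = s.arr 3 m ∧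
      ((emit a b).run s).arr 4 m = s.arr 4 m := by
  refine loop_inv (x := 4) (s := s)
    (p := write 3 (ix (R 1) (R 4)) (A a (R 4)) ;; write 4 (ix (R 1) (R 4)) (A b (R 4)))
    (fun i s' => (∀ v < i, s'.arr 3 (s.reg 1 * s.reg 0 + v) = s.arr a v ∧
      s'.arr 4 (s.reg 1 * s.reg 0 + v) = s.arr b v) ∧
      ∀ m < s.reg 1 * s.reg 0, s'.arr 3 m = s.arr 3 m ∧ s'.arr 4 m = s.arr 4 m)
    (by simp [regs]) (by simp) ?_
  intro i s' hi hr hF ⟨hI1, hI2⟩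
  have h0 : s'.reg 0 = s.reg 0 := hF.reg 0 (by simp [regs])
  have h1 : s'.reg 1 = s.reg 1 := hF.reg 1 (by simp [regs])
  have h3 : s'.arr a = s.arr a := hF.arr a (by simp [arrs, ha])
  have h4 : s'.arr b = s.arr b := hF.arr b (by simp [arrs, hb])
  constructor
  · intro v hv
    by_cases hvi : v = i
    · subst hvi
      simp [BinOp.eval, h0, h1, hr, h3, h4, hb]
    · have hne : s.reg 1 * s.reg 0 + v ≠ s.reg 1 * s.reg 0 + i := by omega
      simpa [BinOp.eval, h0, h1, hr, Function.update_of_ne hne] using hI1 v (by omega)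
  · intro m hm
    have hne : m ≠ s.reg 1 * s.reg 0 + i := by omega
    simpa [BinOp.eval, h0, h1, hr, Function.update_of_ne hne] using hI2 m hm

theorem reg_emit (a b : ℕ) (s : State) :
    ((emit a b).run s).reg 1 = s.reg 1 + if 1 < s.reg 0 then 1 else 0 := by
  have hF := (loop 4 (write 3 (ix (R 1) (R 4)) (A a (R 4)) ;;
    write 4 (ix (R 1) (R 4)) (A b (R 4)))).frame s
  have h0 := hF.reg 0 (by simp [regs])
  have h1 := hF.reg 1 (by simp [regs])
  simp [emit, BinOp.eval, h0, h1]

/-- A move is stored with the set that it starts from, while the set that it leads to remains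
pending. Writing happens from index `s.reg 1 * n` on, beyond the rows that are already valid. -/
theorem Hist.emit (h : Hist G k A B s) (h0 : s.reg 0 = n) {a b : ℕ} (ha : a ≠ 3 ∧ a ≠ 4)
    (hb : b ≠ 3 ∧ b ≠ 4) {g : Fin n → Fin n} (hB : RepS (s.arr a) B) (hg : RepF (s.arr b) g)
    (hm : IsMove G (k - 2) 2 B B' g) (hB' : Feasible G k B') :
    Hist G k A B' ((WordRAM.emit a b).run s) := by
  have hl := reg_emit a b s
  obtain ⟨he1, he2⟩ := run_emit_loop ha hb s
  rw [h0] at hl he1 he2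
  by_cases hn : 1 < n
  · rw [if_pos hn] at hl
    obtain ⟨-, D, f, hD, hout⟩ := h
    refine ⟨fun h => absurd hn (by omega), fun i => if i ≤ s.reg 1 then D i else B',
      fun i => if i < s.reg 1 then f i else g, ⟨by simp [hD.start], by simp [hl], ?_, ?_⟩, ?_⟩
    · intro i hi
      split_ifs with h
      · exact hD.feasible i h
      · exact hB'
    · intro i hi
      rw [hl] at hi
      by_cases h : i < s.reg 1
      · rw [if_pos h.le, if_pos (by omega), if_pos h]
        exact hD.move i h
      · obtain rfl : i = s.reg 1 := by omega
        rw [if_pos le_rfl, if_neg (by omega), if_neg h, hD.finish]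
        exact hm
    · intro i hi
      rw [hl] at hi
      dsimp only
      by_cases h : i < s.reg 1
      · rw [if_pos h.le, if_pos h]
        have hidx : ∀ v : Fin n, i * n + v < s.reg 1 * n := fun v => by
          have := v.2
          have : (i + 1) * n ≤ s.reg 1 * n := Nat.mul_le_mul_right _ h
          rw [add_mul, one_mul] at this
          omega
        refine ⟨fun v => ?_, fun v hv => ?_⟩
        · dsimp only
          rw [(he2 _ (hidx v)).1]
          exact (hout i h).1 v
        · rw [(he2 _ (hidx v)).2]; exact (hout i h).2 v hv
      · obtain rfl : i = s.reg 1 := by omega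
        rw [if_pos le_rfl, if_neg h, hD.finish]
        refine ⟨fun v => ?_, fun v _ => ?_⟩
        · dsimp only
          rw [(he1 v v.2).1]
          exact hB v
        · rw [(he1 v v.2).2]; exact hg v
  · rw [if_neg hn, add_zero] at hl
    have hBB : B = B' := by
      rw [h.feasible.eq_univ (by omega), hB'.eq_univ (by omega)]
    subst hBB
    have h1 := h.1 (by omega)
    obtain ⟨-, D, f, hD, -⟩ := h
    refine ⟨fun _ => hl.trans h1, D, f, ?_, ?_⟩
    · rw [hl]; exact hD
    · rw [hl, h1]; intro i hi; omega

end Hist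

/-! ### Breadth-first search -/

/-- In round `r`, the vertices before `j` and the neighbours before `m` of `j` are processed. -/
structure BfsInv (N : Fin n → Fin n → Prop) (root : Fin n) (r j m : ℕ) (dep : Fin n → ℕ)
    (par : Fin n → Fin n) : Prop where
  dep_root : dep root = 1
  par_root : par root = root
  le : ∀ v, dep v ≤ r + 2
  tree : ∀ v, v ≠ root → dep v ≠ 0 → N v (par v) ∧ dep (par v) ≠ 0 ∧ dep (par v) + 1 = dep v
  done : ∀ u v, N u v → dep u ≠ 0 →
    (dep u ≤ r ∨ (dep u = r + 1 ∧ ((u : ℕ) < j ∨ ((u : ℕ) = j ∧ (v : ℕ) < m)))) →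
    dep v ≠ 0 ∧ dep v ≤ dep u + 1

/-- The result of breadth-first search. -/
structure IsTree (N : Fin n → Fin n → Prop) (root : Fin n) (dep : Fin n → ℕ)
    (par : Fin n → Fin n) : Prop where
  tree : ∀ v, v ≠ root → N v (par v) ∧ dep (par v) + 1 = dep v
  pos : ∀ v, 1 ≤ dep v
  le : ∀ v, dep v ≤ n

section Bfs

variable {N H : Fin n → Fin n → Prop} {Ds Dt : Finset (Fin n)} {root : Fin n} {r j m : ℕ}
  {dep : Fin n → ℕ} {par : Fin n → Fin n} {s s' : State}

/-- An unvisited `v` is the parent of no visited vertex other than the root, and by `done` it is not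
near any visited vertex of depth at most `r`. So only vertices of depth `r + 1` have to cope with
its new depth. -/
theorem BfsInv.visit (h : BfsInv N root r j m dep par) (hsymm : ∀ u v, N u v → N v u)
    {u v : Fin n} (_ : (u : ℕ) = j) (hv : (v : ℕ) = m) (hd : dep u = r + 1) (hN : N u v)
    (hv0 : dep v = 0) :
    BfsInv N root r j (m + 1) (Function.update dep v (r + 2)) (Function.update par v u) := by
  have huv : u ≠ v := fun e => by rw [e] at hd; omega
  have hrv : root ≠ v := fun e => by have := h.dep_root; rw [e] at this; omega
  refine ⟨?_, ?_, fun w => ?_, fun w hw hw0 => ?_, fun x y hxy hx0 hx => ?_⟩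
  · rw [Function.update_of_ne hrv]; exact h.dep_root
  · rw [Function.update_of_ne hrv]; exact h.par_root
  · rw [Function.update_apply]
    split_ifs
    · exact le_rfl
    · exact h.le w
  · by_cases hwv : w = v
    · subst hwv
      rw [Function.update_self, Function.update_self, Function.update_of_ne huv]
      exact ⟨hsymm _ _ hN, by omega, by omega⟩
    · rw [Function.update_of_ne hwv] at hw0
      obtain ⟨h1, h2, h3⟩ := h.tree w hw hw0
      have hpv : par w ≠ v := fun e => h2 (e ▸ hv0)
      rw [Function.update_of_ne hwv, Function.update_of_ne hwv, Function.update_of_ne hpv]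
      exact ⟨h1, h2, h3⟩
  · have hxv : x ≠ v := by
      rintro rfl
      rw [Function.update_self] at hx
      omega
    rw [Function.update_of_ne hxv] at hx0 hx ⊢
    by_cases hyv : y = v
    · subst hyv
      rw [Function.update_self]
      refine ⟨by omega, ?_⟩
      rcases hx with hx | hx
      · exact absurd hv0 (h.done x y hxy hx0 (.inl hx)).1
      · omega
    · rw [Function.update_of_ne hyv]
      refine h.done x y hxy hx0 (hx.imp_right fun ⟨h1, h2⟩ => ⟨h1, h2.imp_right fun ⟨h3, h4⟩ => ?_⟩)
      refine ⟨h3, ?_⟩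
      have : (y : ℕ) ≠ m := fun e => hyv (Fin.ext (e.trans hv.symm))
      omega

theorem BfsInv.skip (h : BfsInv N root r j m dep par)
    {u v : Fin n} (hu : (u : ℕ) = j) (hv : (v : ℕ) = m) (hd : dep u = r + 1)
    (hN : ¬ (N u v ∧ dep v = 0)) : BfsInv N root r j (m + 1) dep par where
  __ := h
  done x y hxy hx0 hx := by
    by_cases hxy' : x = u ∧ y = v
    · obtain ⟨rfl, rfl⟩ := hxy'
      have h1 := h.le y
      exact ⟨fun e => hN ⟨hxy, e⟩, by omega⟩
    · refine h.done x y hxy hx0 (hx.imp_right fun ⟨h1, h2⟩ => ⟨h1, h2.imp_right fun ⟨h3, h4⟩ => ?_⟩)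
      refine ⟨h3, ?_⟩
      have : (y : ℕ) ≠ m := fun e => hxy' ⟨Fin.ext (h3.trans hu.symm), Fin.ext (e.trans hv.symm)⟩
      omega

theorem BfsInv.next (h : BfsInv N root r j m dep par)
    (hj : ∀ u : Fin n, (u : ℕ) = j → dep u = r + 1 → n ≤ m) :
    BfsInv N root r (j + 1) 0 dep par where
  __ := h
  done x y hxy hx0 hx := by
    refine h.done x y hxy hx0 (hx.imp_right fun ⟨h1, h2⟩ => ⟨h1, ?_⟩)
    by_cases hxj : (x : ℕ) = j
    · have := hj x hxj h1
      exact .inr ⟨hxj, by omega⟩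
    · exact .inl (by omega)

/-- Along a shortest path the depth rises by at most one per edge, and a path has fewer than `n`
edges, so `n` rounds reach every vertex. Only the upper bound of depth by distance is needed. -/
theorem run_bfs {G : SimpleGraph (Fin n)} (hE : Env (Near G) H Ds Dt s) (hG : G.Connected)
    (hn : 0 < n) (h14 : ∀ i, s.arr 14 i = 0) (h15 : ∀ i, s.arr 15 i = 0) :
    ∃ dep par, RepN ((bfs.run s).arr 14) dep ∧ RepF ((bfs.run s).arr 15) par ∧
      IsTree (Near G) ⟨0, hn⟩ dep par ∧ ∀ v, dep v ≤ G.dist ⟨0, hn⟩ v + 1 := by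
  set root : Fin n := ⟨0, hn⟩ with hroot
  set s1 := s.setArr 14 0 1 with hs1
  have hE1 : Env (Near G) H Ds Dt s1 := hE.of_frame (rs := []) (as := [14])
    ((write 14 (K 0) (K 1)).frame s) (by decide)
  have key := loop_inv (x := 2) (s := s1) (p := loop 3 (ite (eEq (A 14 (R 3)) (eAdd (R 2) (K 1)))
    (loop 4 (ite (eMul (A 5 (ix (R 3) (R 4))) (eNot (A 14 (R 4))))
      (write 14 (R 4) (eAdd (R 2) (K 2)) ;; write 15 (R 4) (R 3)) skip)) skip))
    (fun r s' => ∃ dep par, RepN (s'.arr 14) dep ∧ RepF (s'.arr 15) par ∧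
      BfsInv (Near G) root r 0 0 dep par ∧ ∀ v, dep v ≤ r + 1) (by decide) ?_ ?_
  · rw [hE1.size] at key
    obtain ⟨dep, par, h1, h2, h3, h4⟩ := key
    -- The length condition keeps every vertex but the last at depth at most `n`, where `done`
    -- applies after `n` rounds.
    have hwalk : ∀ (u v : Fin n) (w : G.Walk u v), dep u ≠ 0 → dep u + w.length ≤ n + 1 →
        dep v ≠ 0 ∧ dep v ≤ dep u + w.length := by
      intro u v w
      induction w with
      | nil => intro h _; simpa using h
      | cons hadj w ih =>
        intro h5 h6
        rw [SimpleGraph.Walk.length_cons] at h6 ⊢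
        obtain ⟨h7, h8⟩ := h3.done _ _ (.inr hadj) h5 (.inl (by omega))
        obtain ⟨h9, h10⟩ := ih h7 (by omega)
        exact ⟨h9, by omega⟩
    have hdist : ∀ v, dep v ≠ 0 ∧ dep v ≤ G.dist root v + 1 ∧ G.dist root v < n := by
      intro v
      obtain ⟨w, hw, hl⟩ := hG.exists_path_of_dist root v
      have hlt := hw.length_lt
      rw [Fintype.card_fin] at hlt
      obtain ⟨h5, h6⟩ := hwalk _ _ w (by rw [h3.dep_root]; omega) (by rw [h3.dep_root]; omega)
      rw [h3.dep_root] at h6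
      exact ⟨h5, by omega, by omega⟩
    refine ⟨dep, par, h1, h2, ⟨fun v hv => ?_, fun v => ?_, fun v => ?_⟩, fun v => (hdist v).2.1⟩
    · have := h3.tree v hv (hdist v).1
      exact ⟨this.1, this.2.2⟩
    · have := (hdist v).1; omega
    · have := (hdist v).2; omega
  · refine ⟨fun v => if v = root then 1 else 0, fun _ => root, fun v => ?_, fun v => ?_, ?_, ?_⟩
    · simp [hs1, Function.update_apply, h14, hroot, Fin.ext_iff]
    · simp [hs1, h15, hroot]
    · refine ⟨by simp, rfl, fun v => ?_, fun v hv hv0 => ?_, fun u v _ h1 h2 => ?_⟩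
      · split_ifs <;> omega
      · simp [hv] at hv0
      · rcases h2 with h2 | h2 <;> omega
    · intro v
      dsimp only
      split_ifs <;> omega
  intro r s' hr hrr hF ⟨dep, par, h1, h2, h3, h4⟩
  have hE' := hE1.of_frame hF (by decide)
  have key := loop_inv (x := 3) (s := s') (p := ite (eEq (A 14 (R 3)) (eAdd (R 2) (K 1)))
    (loop 4 (ite (eMul (A 5 (ix (R 3) (R 4))) (eNot (A 14 (R 4))))
      (write 14 (R 4) (eAdd (R 2) (K 2)) ;; write 15 (R 4) (R 3)) skip)) skip)
    (fun j t => ∃ dep par, RepN (t.arr 14) dep ∧ RepF (t.arr 15) par ∧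
      BfsInv (Near G) root r j 0 dep par) (by decide) ⟨dep, par, h1, h2, h3⟩ ?_
  · rw [hE'.size] at key
    obtain ⟨dep, par, h1, h2, h3⟩ := key
    refine ⟨dep, par, h1, h2, ?_, h3.le⟩
    exact ⟨h3.dep_root, h3.par_root, fun v => (h3.le v).trans (by omega), h3.tree,
      fun u v huv hu0 hu => h3.done u v huv hu0 (by have := u.2; omega)⟩
  clear h1 h2 h3 h4 dep par
  intro j t hj hjr hFt ⟨dep, par, h1, h2, h3⟩
  rw [hE'.size] at hj
  have hEt := hE'.of_frame hFt (by decide)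
  have ht2 : t.reg 2 = r := (hFt.reg 2 (by decide)).trans hrr
  have hdj := h1 ⟨j, hj⟩
  simp only at hdj
  rw [run_ite (dep ⟨j, hj⟩ = r + 1) (by simp [BinOp.eval, hjr, ht2, hdj])]
  by_cases hc : dep ⟨j, hj⟩ = r + 1
  swap
  · rw [if_neg hc]
    refine ⟨dep, par, h1, h2, h3.next fun u hu hu' => absurd hu' ?_⟩
    rwa [show u = ⟨j, hj⟩ from Fin.ext hu]
  rw [if_pos hc]
  have key := loop_inv (x := 4) (s := t) (p := ite (eMul (A 5 (ix (R 3) (R 4))) (eNot (A 14 (R 4))))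
      (write 14 (R 4) (eAdd (R 2) (K 2)) ;; write 15 (R 4) (R 3)) skip)
    (fun m t' => ∃ dep par, RepN (t'.arr 14) dep ∧ RepF (t'.arr 15) par ∧
      BfsInv (Near G) root r j m dep par ∧ dep ⟨j, hj⟩ = r + 1) (by decide)
    ⟨dep, par, h1, h2, h3, hc⟩ ?_
  · rw [hEt.size] at key
    obtain ⟨dep, par, h1, h2, h3, h4⟩ := key
    exact ⟨dep, par, h1, h2, h3.next fun _ _ _ => le_rfl⟩
  clear h1 h2 h3 hc hdj dep par
  intro m t' hm hmr hFt' ⟨dep, par, h1, h2, h3, hc⟩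
  rw [hEt.size] at hm
  have hEt' := hEt.of_frame hFt' (by decide)
  have ht2' : t'.reg 2 = r := (hFt'.reg 2 (by decide)).trans ht2
  have ht3' : t'.reg 3 = j := (hFt'.reg 3 (by decide)).trans hjr
  have hdm := h1 ⟨m, hm⟩
  have hNm := hEt'.near ⟨j, hj⟩ ⟨m, hm⟩
  simp only at hdm hNm
  classical
  rw [run_ite (Near G ⟨j, hj⟩ ⟨m, hm⟩ ∧ dep ⟨m, hm⟩ = 0) (by
    simp [BinOp.eval, hmr, ht3', hEt'.size, hdm, ← hNm]
    tauto)]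
  by_cases hc' : Near G ⟨j, hj⟩ ⟨m, hm⟩ ∧ dep ⟨m, hm⟩ = 0
  · rw [if_pos hc']
    refine ⟨_, _, ?_, ?_, h3.visit (fun _ _ h => h.symm) rfl rfl hc hc'.1 hc'.2, ?_⟩
    · simpa [hmr, ht2', BinOp.eval] using h1.update ⟨m, hm⟩ (r + 2)
    · simpa [hmr, ht3'] using h2.update ⟨m, hm⟩ ⟨j, hj⟩
    · rw [Function.update_of_ne, hc]
      intro e
      rw [e] at hc
      omega
  · rw [if_neg hc']
    exact ⟨dep, par, h1, h2, h3.skip rfl rfl hc hc', hc⟩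

/-- Reversing the arcs on the tree path from `y` to the root makes `y` the new root. The function
`h` bounds the number of steps to `y`. -/
theorem run_reroot (h0 : s.reg 0 = n) {hn : 0 < n} (hT : IsTree N ⟨0, hn⟩ dep par)
    (hsymm : ∀ u v, N u v → N v u) (h15 : RepF (s.arr 15) par) {y : Fin n} (hy : s.reg 5 = y) :
    ∃ (nx : Fin n → Fin n) (h : Fin n → ℕ), RepF ((reroot.run s).arr 16) nx ∧
      (∀ v, h v + 2 ≤ dep y + dep v) ∧ ∀ v, v ≠ y → N v (nx v) ∧ h (nx v) < h v := by
  set root : Fin n := ⟨0, hn⟩ with hroot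
  have hF1 := (copyArr 15 16).frame s
  have h16 := RepF.copy h0 (show 15 ≠ 16 by decide) h15
  unfold reroot
  simp only [run_seq, run_assign, Expr.eval_reg]
  set s1 := (copyArr 15 16).run s with hs1
  have h5 : s1.reg 5 = y := (hF1.reg 5 (by decide)).trans hy
  have h01 : s1.reg 0 = n := (hF1.reg 0 (by decide)).trans h0
  rw [h5]
  have key := loop_inv (x := 3) (s := s1.setReg 6 y)
    (p := ite (R 6) (write 16 (A 15 (R 6)) (R 6) ;; assign 6 (A 15 (R 6))) skip)
    (fun i s' => ∃ (cur : Fin n) (nx : Fin n → Fin n) (S : Finset (Fin n)), s'.reg 6 = cur ∧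
      RepF (s'.arr 16) nx ∧ cur ∈ S ∧ (∀ v ∈ S, dep cur ≤ dep v ∧ dep v ≤ dep y) ∧
      (∀ v ∈ S, v ≠ y → nx v ∈ S ∧ N v (nx v) ∧ dep (nx v) = dep v + 1) ∧
      (∀ v ∉ S, nx v = par v) ∧ (cur = root ∨ dep cur + i ≤ dep y)) (by decide) ?_ ?_
  · rw [show (s1.setReg 6 y).reg 0 = n by simpa using h01] at key
    obtain ⟨cur, nx, S, -, h2, h3, h4, h5, h6, h7⟩ := key
    have hcur : cur = root := by
      refine h7.resolve_right fun h => ?_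
      have := hT.pos cur
      have := hT.le y
      omega
    subst hcur
    -- `S` is the path from `y` to the root. On it `h` counts the descent to `y`; off it, the ascent
    -- to the root followed by the descent, where the 2 corrects for depths starting at 1.
    refine ⟨nx, fun v => if v ∈ S then dep y - dep v else dep y + dep v - 2, h2, fun v => ?_,
      fun v hv => ?_⟩
    · have := hT.pos v
      have := hT.pos y
      dsimp only
      split_ifs
      · omega
      · omega
    · dsimp only
      by_cases hvS : v ∈ S
      · obtain ⟨h8, h9, h10⟩ := h5 v hvS hv
        have := (h4 _ h8).2
        rw [if_pos hvS, if_pos h8]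
        exact ⟨h9, by omega⟩
      · have hvr : v ≠ root := fun e => hvS (e ▸ h3)
        obtain ⟨h8, h9⟩ := hT.tree v hvr
        have h10 := hT.pos (par v)
        have h11 := hT.pos y
        rw [if_neg hvS, h6 v hvS]
        refine ⟨h8, ?_⟩
        split_ifs with h12
        · have := (h4 _ h12).2
          omega
        · omega
  · refine ⟨y, par, {y}, by simp, h16, by simp, by simp, ?_, fun _ _ => rfl, .inr le_rfl⟩
    intro v hv hvy
    exact absurd (Finset.mem_singleton.1 hv) hvy
  intro i s' _ _ hF ⟨cur, nx, S, h1, h2, h3, h4, h5, h6, h7⟩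
  have h15' : s'.arr 15 = s.arr 15 := (hF.arr 15 (by decide)).trans (hF1.arr 15 (by decide))
  rw [run_ite (cur ≠ root) (by simp [h1, hroot, Fin.ext_iff])]
  by_cases hc : cur ≠ root
  · rw [if_pos hc]
    obtain ⟨h8, h9⟩ := hT.tree cur hc
    have hnew : par cur ∉ S := fun h => by have := (h4 _ h).1; omega
    refine ⟨par cur, Function.update nx (par cur) cur, insert (par cur) S, ?_, ?_,
      Finset.mem_insert_self _ _, fun v hv => ?_, fun v hv hvy => ?_, fun v hv => ?_, .inr ?_⟩
    · simp [h1, h15', h15 _]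
    · simpa [h1, h15', h15 _] using h2.update (par cur) cur
    · rcases Finset.mem_insert.1 hv with rfl | hv
      · have := (h4 cur h3).2
        exact ⟨le_rfl, by omega⟩
      · have := h4 v hv
        exact ⟨by omega, this.2⟩
    · rcases Finset.mem_insert.1 hv with rfl | hv
      · rw [Function.update_self]
        exact ⟨Finset.mem_insert_of_mem h3, hsymm _ _ h8, h9.symm⟩
      · rw [Function.update_of_ne (fun e => hnew (by rw [← e]; exact hv))]
        obtain ⟨h10, h11⟩ := h5 v hv hvy
        exact ⟨Finset.mem_insert_of_mem h10, h11⟩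
    · rw [Finset.mem_insert, not_or] at hv
      rw [Function.update_of_ne hv.1]
      exact h6 v hv.2
    · have := h7.resolve_left hc
      omega
  · rw [if_neg hc]
    exact ⟨cur, nx, S, by simpa using h1, h2, h3, h4, h5, h6, .inl (not_not.1 hc)⟩

end Bfs

end TokenReconf

/-! ### Moving the tokens one by one -/

namespace TokenReconf

open WordRAM FProg

variable {n : ℕ}

/-- All tokens but one are on the vertices of `E`. The remaining token has been put on `q` by the
moves written down so far; in the next move, the tokens that `f` displaces proceed along the path to
`y`, which has been followed up to `p`. -/
structure ChainInv (G : SimpleGraph (Fin n)) (k : ℕ) (S E : Finset (Fin n)) (y : Fin n)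
    (nx : Fin n → Fin n) (h : Fin n → ℕ) (m : ℕ) (q p : Fin n) (f : Fin n → Fin n) (s : State) :
    Prop where
  size : s.reg 0 = n
  set : RepS (s.arr 10) E
  reg_q : s.reg 6 = q
  reg_p : s.reg 7 = p
  reg_y : s.reg 5 = y
  path : RepF (s.arr 16) nx
  map : RepF (s.arr 17) f
  hist : Hist G k S (insert q E) s
  notMem : q ∉ E
  bij : Set.BijOn f (insert ↑q ↑E \ {p}) E
  near : ∀ v, Near G v (f v)
  fixed : ∀ v, h v ≤ h p → f v = v
  occ : p = q ∨ p ∈ E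
  count : s.reg 1 + h p ≤ m

section Chain

variable {G : SimpleGraph (Fin n)} {k m : ℕ} {S E : Finset (Fin n)} {y q p : Fin n}
  {nx f : Fin n → Fin n} {h : Fin n → ℕ} {s : State}

theorem ChainInv.setReg (hI : ChainInv G k S E y nx h m q p f s) {x : ℕ} (hx : 7 < x ∨ x = 3)
    (v : ℕ) : ChainInv G k S E y nx h m q p f (s.setReg x v) where
  __ := hI
  size := by rw [State.setReg_reg, if_neg (by omega), hI.size]
  reg_q := by rw [State.setReg_reg, if_neg (by omega), hI.reg_q]
  reg_p := by rw [State.setReg_reg, if_neg (by omega), hI.reg_p]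
  reg_y := by rw [State.setReg_reg, if_neg (by omega), hI.reg_y]
  hist := hI.hist.congr (by rw [State.setReg_reg, if_neg (by omega)]) rfl rfl
  count := by rw [State.setReg_reg, if_neg (by omega)]; exact hI.count

theorem isMove_of_near {P Q : Finset (Fin n)} (hf : Set.BijOn f P Q) (h : ∀ v, Near G v (f v))
    (k' d : ℕ) : IsMove G k' d P Q f :=
  ⟨hf, ∅, by simp, by simp, fun v _ => (h v).edist_le, by simp⟩

/-- If the next vertex is occupied, its token joins the chain and nothing is written. If it is free,
the whole chain advances in one move of distances at most 1, with the net effect that the travelling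
token jumps from `q` to that vertex. Every set contains `E` and so dominates. At most one move is
written while `h p` drops, which preserves `count`. -/
theorem run_stepToken (hI : ChainInv G k S E y nx h m q p f s) (hE : IsDominating G E)
    (hk : E.card + 1 = k) (hnx : ∀ v, v ≠ y → Near G v (nx v) ∧ h (nx v) < h v) :
    ∃ q' p' f', ChainInv G k S E y nx h m q' p' f' (stepToken.run s) ∧ (p = y → p' = y) ∧
      (p ≠ y → h p' < h p) := by
  unfold stepToken
  rw [run_ite (p = y) (by simp [BinOp.eval, hI.reg_p, hI.reg_y, Fin.ext_iff])]
  by_cases hpy : p = y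
  · rw [if_pos hpy]
    exact ⟨q, p, f, hI, fun _ => hpy, fun h => absurd hpy h⟩
  rw [if_neg hpy]
  obtain ⟨hnear, hlt⟩ := hnx p hpy
  have hpne : nx p ≠ p := fun e => by rw [e] at hlt; exact lt_irrefl _ hlt
  simp only [run_seq, run_write, run_assign, Expr.eval_reg, Expr.eval_read]
  have hmap : RepF ((s.setArr 17 (s.reg 7) (s.arr 16 (s.reg 7))).arr 17)
      (Function.update f p (nx p)) := by
    simpa [hI.reg_p, hI.path p] using hI.map.update p (nx p)
  rw [show ((s.setArr 17 (s.reg 7) (s.arr 16 (s.reg 7))).arr 16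
    ((s.setArr 17 (s.reg 7) (s.arr 16 (s.reg 7))).reg 7)) = nx p by simp [hI.reg_p, hI.path p]]
  set s1 := s.setArr 17 (s.reg 7) (s.arr 16 (s.reg 7)) with hs1
  have hr1 : s1.reg = s.reg := rfl
  have h10 : s1.arr 10 = s.arr 10 := by simp [hs1]
  have h16 : s1.arr 16 = s.arr 16 := by simp [hs1]
  have h3 : s1.arr 3 = s.arr 3 := by simp [hs1]
  have h4 : s1.arr 4 = s.arr 4 := by simp [hs1]
  clear_value s1
  have hset := hI.set
  have hnear' : ∀ v, Near G v (Function.update f p (nx p) v) := fun v => by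
    rw [Function.update_apply]
    split_ifs with e
    · rw [e]; exact hnear
    · exact hI.near v
  rw [run_ite (nx p ∈ E) (by simp [h10, hset (nx p)])]
  by_cases hmem : nx p ∈ E
  · rw [if_pos hmem, run_skip]
    refine ⟨q, nx p, Function.update f p (nx p), ?_, fun e => absurd e hpy, fun _ => hlt⟩
    refine ⟨by simp [hr1, hI.size], by simpa [h10] using hset, by simp [hr1, hI.reg_q], by simp,
      by simp [hr1, hI.reg_y], by simpa [h16] using hI.path, hmap,
      hI.hist.congr (by simp [hr1]) h3 h4, hI.notMem, ?_, hnear', fun v hv => ?_, .inr hmem, ?_⟩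
    · have h5 : f (nx p) = nx p := hI.fixed _ hlt.le
      have h6 := hI.bij.sdiff_singleton (a := nx p) ⟨.inr hmem, hpne⟩
      rw [h5] at h6
      have h7 := bijOn_update h6 (p := p) (q := nx p) (by simp) (by simp)
      convert h7 using 1
      · ext v
        have := hI.occ
        simp only [Set.mem_sdiff, Set.mem_insert_iff, Finset.mem_coe, Set.mem_singleton_iff]
        by_cases e : v = p
        · subst e
          simp [hpne.symm, this]
        · simp [e]
      · simp [hmem]
    · rw [Function.update_of_ne]
      · exact hI.fixed v (hv.trans hlt.le)
      · rintro rfl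
        omega
    · have := hI.count
      rw [show (s1.setReg 7 (nx p)).reg 1 = s.reg 1 by simp [hr1]]
      omega
  · rw [if_neg hmem]
    simp only [run_seq, run_write, run_assign, Expr.eval_reg, Expr.eval_lit]
    rw [show (s1.setReg 7 (nx p)).reg 6 = q by simp [hr1, hI.reg_q]]
    have hQ : RepS (((s1.setReg 7 (nx p)).setArr 10 q 1).arr 10) (insert q E) := by
      simpa [h10] using hset.insert q
    have hmap2 : RepF (((s1.setReg 7 (nx p)).setArr 10 q 1).arr 17)
        (Function.update f p (nx p)) := by simpa using hmap
    have hhist2 : Hist G k S (insert q E) ((s1.setReg 7 (nx p)).setArr 10 q 1) :=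
      hI.hist.congr (by simp [hr1]) (by simpa using h3) (by simpa using h4)
    have hr : ∀ x ≠ 7, ((s1.setReg 7 (nx p)).setArr 10 q 1).reg x = s.reg x := fun x hx => by
      simp [hr1, hx]
    have hr7 : ((s1.setReg 7 (nx p)).setArr 10 q 1).reg 7 = nx p := by simp
    have h16' : ((s1.setReg 7 (nx p)).setArr 10 q 1).arr 16 = s.arr 16 := by simp [h16]
    set s2 := (s1.setReg 7 (nx p)).setArr 10 q 1
    clear_value s2
    have h20 : s2.reg 0 = n := (hr 0 (by decide)).trans hI.size
    have hbij : Set.BijOn (Function.update f p (nx p)) ↑(insert q E) ↑(insert (nx p) E) := by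
      have h7 := bijOn_update hI.bij (p := p) (q := nx p) (by simp) (by simpa using hmem)
      convert h7 using 1
      · ext v
        have := hI.occ
        simp only [Finset.coe_insert, Set.mem_sdiff, Set.mem_insert_iff, Finset.mem_coe,
          Set.mem_singleton_iff]
        by_cases e : v = p
        · subst e
          simp [this]
        · simp [e]
      · simp
    have hfeas : Feasible G k (insert (nx p) E) := by
      refine ⟨fun v => ?_, by rw [Finset.card_insert_of_notMem hmem, hk]⟩
      rcases hE v with h | ⟨u, h, h'⟩
      · exact .inl (Finset.mem_insert_of_mem h)
      · exact .inr ⟨u, Finset.mem_insert_of_mem h, h'⟩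
    have hhist3 := hhist2.emit h20 (a := 10) (b := 17) (by decide) (by decide) hQ hmap2
      (isMove_of_near hbij hnear' _ _) hfeas
    have hF3 := (emit 10 17).frame s2
    have hc3 := reg_emit 10 17 s2
    set s3 := (emit 10 17).run s2
    clear_value s3
    have hr3 : ∀ x, x ≠ 1 → x ≠ 4 → s3.reg x = s2.reg x := fun x h1 h4 =>
      hF3.reg x (by simp [emit, regs, h1, h4])
    have hset4 : RepS ((s3.setArr 10 q 0).arr 10) E := by
      have h8 := hQ.erase q
      rw [Finset.erase_insert hI.notMem, ← hF3.arr 10 (by decide)] at h8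
      simpa using h8
    rw [show s3.reg 6 = q by rw [hr3 6 (by decide) (by decide), hr 6 (by decide), hI.reg_q],
      show (s3.setArr 10 q 0).reg 7 = nx p by
        rw [State.setArr_reg, hr3 7 (by decide) (by decide), hr7]]
    have hF5 := (loop 4 (write 17 (R 4) (R 4))).frame ((s3.setArr 10 q 0).setReg 6 (nx p))
    have h17 := run_fill (x := 4) (a := 17) (e := R 4) (s := (s3.setArr 10 q 0).setReg 6 (nx p)) id
      (by decide) (fun i _ s' hr _ => hr)
    have hreg5 : ∀ x, x ≠ 1 → x ≠ 4 → x ≠ 6 → x ≠ 7 →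
        ((loop 4 (write 17 (R 4) (R 4))).run ((s3.setArr 10 q 0).setReg 6 (nx p))).reg x =
          s.reg x := fun x h1 h4 h6 h7 => by
      rw [hF5.reg x (by simp [regs, h4]), State.setReg_reg, if_neg h6, State.setArr_reg,
        hr3 x h1 h4, hr x h7]
    have hcount : ((loop 4 (write 17 (R 4) (R 4))).run ((s3.setArr 10 q 0).setReg 6 (nx p))).reg 1 ≤
        s.reg 1 + 1 := by
      rw [hF5.reg 1 (by decide), State.setReg_reg, if_neg (by decide), State.setArr_reg, hc3,
        hr 1 (by decide)]
      split_ifs <;> omega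
    refine ⟨nx p, nx p, id, ?_, fun e => absurd e hpy, fun _ => hlt⟩
    refine ⟨?_, ?_, ?_, ?_, ?_, ?_, fun v => ?_, ?_, hmem, ?_, fun v => .inl rfl, fun v _ => rfl,
      .inl rfl, ?_⟩
    · rw [hreg5 0 (by decide) (by decide) (by decide) (by decide), hI.size]
    · rw [hF5.arr 10 (by decide)]
      exact hset4
    · rw [hF5.reg 6 (by decide)]
      simp
    · rw [hF5.reg 7 (by decide)]
      simp [hr3, hr7]
    · rw [hreg5 5 (by decide) (by decide) (by decide) (by decide), hI.reg_y]
    · rw [hF5.arr 16 (by decide)]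
      simpa [hF3.arr 16 (by decide), h16'] using hI.path
    · exact h17 v (by simp [hr3, h20])
    · refine hhist3.congr ?_ ?_ ?_
      · rw [hF5.reg 1 (by decide)]
        simp
      · rw [hF5.arr 3 (by decide)]
        simp
      · rw [hF5.arr 4 (by decide)]
        simp
    · convert Set.bijOn_id (↑E : Set (Fin n)) using 1
      simp [hmem]
    · have := hI.count
      omega

/-- Moving the token on `x` to `y`. -/
theorem run_moveToken {hn : 0 < n} {dep : Fin n → ℕ} {D : Finset (Fin n)}
    {par : Fin n → Fin n} {x : Fin n} (h0 : s.reg 0 = n) (hT : IsTree (Near G) ⟨0, hn⟩ dep par)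
    (h15 : RepF (s.arr 15) par) (hD : RepS (s.arr 10) D) (hx : s.reg 2 = x) (hy : s.reg 5 = y)
    (hxD : x ∈ D) (hyD : y ∉ D) (hdom : IsDominating G (D.erase x)) (hH : Hist G k S D s) :
    RepS ((moveToken.run s).arr 10) (insert y (D.erase x)) ∧
      Hist G k S (insert y (D.erase x)) (moveToken.run s) ∧
      (moveToken.run s).reg 1 + 2 ≤ s.reg 1 + dep y + dep x := by
  obtain ⟨nx, h, h16, hle, hnx⟩ := run_reroot h0 hT (fun _ _ h => h.symm) h15 hy
  have hF1 := reroot.frame s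
  unfold moveToken
  simp only [run_seq, run_write, run_assign, Expr.eval_reg, Expr.eval_lit]
  set s1 := reroot.run s
  clear_value s1
  have hr : ∀ i, i = 0 ∨ i = 1 ∨ i = 2 ∨ i = 5 → s1.reg i = s.reg i := by
    rintro i (rfl | rfl | rfl | rfl) <;> exact hF1.reg _ (by decide)
  rw [hr 2 (by decide), hx, show (s1.setArr 10 x 0).reg 2 = x by simp [hr, hx],
    show ((s1.setArr 10 x 0).setReg 6 x).reg 2 = x by simp [hr, hx]]
  set s2 := ((s1.setArr 10 x 0).setReg 6 x).setReg 7 x with hs2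
  have hF3 := (loop 3 (write 17 (R 3) (R 3))).frame s2
  have h17 := run_fill (x := 3) (a := 17) (e := R 3) (s := s2) id (by decide)
    (fun i _ s' hr _ => hr)
  set s3 := (loop 3 (write 17 (R 3) (R 3))).run s2
  clear_value s3
  have hins : insert x (D.erase x) = D := Finset.insert_erase hxD
  have hfeas := hH.feasible
  have hI : ChainInv G k S (D.erase x) y nx h (s.reg 1 + h x) x x id s3 := by
    refine ⟨?_, ?_, ?_, ?_, ?_, ?_, fun v => ?_, ?_, by simp, ?_, fun v => .inl rfl, fun v _ => rfl,
      .inl rfl, ?_⟩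
    · rw [hF3.reg 0 (by decide)]
      simp [hs2, hr, h0]
    · rw [hF3.arr 10 (by decide)]
      have := hD.erase x
      rw [← hF1.arr 10 (by decide)] at this
      simpa [hs2] using this
    · rw [hF3.reg 6 (by decide)]
      simp [hs2]
    · rw [hF3.reg 7 (by decide)]
      simp [hs2]
    · rw [hF3.reg 5 (by decide)]
      simp [hs2, hr, hy]
    · rw [hF3.arr 16 (by decide)]
      simpa [hs2] using h16
    · exact h17 v (by simp [hs2, hr, h0])
    · rw [hins]
      refine hH.congr ?_ ?_ ?_
      · rw [hF3.reg 1 (by decide)]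
        simp [hs2, hr]
      · rw [hF3.arr 3 (by decide)]
        simp [hs2, hF1.arr 3 (by decide)]
      · rw [hF3.arr 4 (by decide)]
        simp [hs2, hF1.arr 4 (by decide)]
    · convert Set.bijOn_id (↑(D.erase x) : Set (Fin n)) using 1
      simp
    · rw [hF3.reg 1 (by decide)]
      simp [hs2, hr]
  have hk : (D.erase x).card + 1 = k := by rw [Finset.card_erase_add_one hxD, hfeas.2]
  -- The path may have up to `2 * n - 2` arcs while the loop has `n` rounds; hence two steps per
  -- round.
  have key := loop_inv (x := 3) (s := s3) (p := stepToken ;; stepToken)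
    (fun i s' => ∃ q p f, ChainInv G k S (D.erase x) y nx h (s.reg 1 + h x) q p f s' ∧
      (p = y ∨ h p + 2 * i ≤ h x)) (by decide)
    ⟨x, x, id, hI.setReg (.inr rfl) 0, .inr (by omega)⟩ (by
      rintro i s' - - - ⟨q, p, f, h1, h2⟩
      obtain ⟨q', p', f', h3, h4, h5⟩ := run_stepToken h1 hdom hk hnx
      obtain ⟨q'', p'', f'', h6, h7, h8⟩ := run_stepToken h3 hdom hk hnx
      refine ⟨q'', p'', f'', h6.setReg (.inr rfl) _, ?_⟩
      by_cases e1 : p = y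
      · exact .inl (h7 (h4 e1))
      by_cases e2 : p' = y
      · exact .inl (h7 e2)
      have := h5 e1
      have := h8 e2
      have := h2.resolve_left e1
      exact .inr (by omega))
  obtain ⟨q, p, f, h1, h2⟩ := key
  set s4 := (loop 3 (stepToken ;; stepToken)).run s3
  clear_value s4
  have hyE : y ∉ D.erase x := fun h => hyD (Finset.mem_of_mem_erase h)
  have hpy : p = y := by
    refine h2.resolve_right fun h2 => ?_
    have := hle x
    have := hT.le x
    have := hT.le y
    rw [hI.size] at h2
    omega
  subst hpy
  -- An unfinished chain would end on an occupied vertex, but `y` is free; so the last move has been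
  -- written.
  have hq : p = q := h1.occ.resolve_right hyE
  subst hq
  rw [h1.reg_y]
  refine ⟨?_, h1.hist.congr rfl (by simp) (by simp), ?_⟩
  · simpa using h1.set.insert p
  · have := h1.count
    have := hle x
    rw [State.setArr_reg]
    omega

/-- Dominating sets of equal size with a common dominating subset. -/
theorem run_transfer {hn : 0 < n} {dep : Fin n → ℕ} {D₁ D₂ : Finset (Fin n)} {par : Fin n → Fin n}
    {e : ℕ} (h0 : s.reg 0 = n) (hT : IsTree (Near G) ⟨0, hn⟩ dep par) (h15 : RepF (s.arr 15) par)
    (he : ∀ v, dep v ≤ e + 1) (h10 : RepS (s.arr 10) D₁) (h11 : RepS (s.arr 11) D₂)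
    (hE : IsDominating G E) (h₁ : E ⊆ D₁) (h₂ : E ⊆ D₂) (hk : D₂.card = k)
    (hH : Hist G k S D₁ s) :
    Hist G k S D₂ (transfer.run s) ∧ (transfer.run s).reg 1 ≤ s.reg 1 + n * (2 * e) := by
  have key := loop_inv (x := 2) (s := s) (p := ite (eMul (A 10 (R 2)) (eNot (A 11 (R 2))))
    (assign 5 (K 0) ;; loop 3 (ite (eMul (A 11 (R 3)) (eNot (A 10 (R 3)))) (assign 5 (R 3)) skip) ;;
      moveToken) skip)
    (fun i s' => ∃ D, RepS (s'.arr 10) D ∧ E ⊆ D ∧ Hist G k S D s' ∧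
      (∀ v ∈ D, (v : ℕ) < i → v ∈ D₂) ∧ s'.reg 1 ≤ s.reg 1 + i * (2 * e)) (by decide)
    ⟨D₁, h10, h₁, hH.congr (by simp) rfl rfl, by simp, by simp⟩ ?_
  · rw [h0] at key
    obtain ⟨D, -, -, h3, h4, h5⟩ := key
    have hD : D = D₂ := Finset.eq_of_subset_of_card_le (fun v hv => h4 v hv v.2)
      (by rw [hk, h3.feasible.2])
    rw [hD] at h3
    exact ⟨h3, h5⟩
  rintro i s' hi hr hF ⟨D, hD, hED, hHD, hlt, hc⟩
  rw [h0] at hi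
  have h11' : RepS (s'.arr 11) D₂ := by rw [hF.arr 11 (by decide)]; exact h11
  have h15' : RepF (s'.arr 15) par := by rw [hF.arr 15 (by decide)]; exact h15
  have h0' : s'.reg 0 = n := (hF.reg 0 (by decide)).trans h0
  set x : Fin n := ⟨i, hi⟩ with hx
  have hrx : s'.reg 2 = x := hr
  rw [run_ite (x ∈ D ∧ x ∉ D₂) (by
    simp [BinOp.eval, hrx, hD x, h11' x]
    tauto)]
  by_cases hc' : x ∈ D ∧ x ∉ D₂
  swap
  · rw [if_neg hc', run_skip]
    refine ⟨D, hD, hED, hHD.congr (by simp) rfl rfl, fun v hv hvi => ?_, ?_⟩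
    · rcases Nat.lt_succ_iff_lt_or_eq.1 hvi with h | h
      · exact hlt v hv h
      · obtain rfl : v = x := Fin.ext h
        by_contra hn
        exact hc' ⟨hv, hn⟩
    · rw [State.setReg_reg, if_neg (by decide), add_mul]
      omega
  rw [if_pos hc']
  simp only [run_seq, run_assign, Expr.eval_lit]
  have hF1 := (loop 3 (ite (eMul (A 11 (R 3)) (eNot (A 10 (R 3)))) (assign 5 (R 3)) skip)).frame
    (s'.setReg 5 0)
  have hscan := run_scan (x := 3) (r := 5) (s := s'.setReg 5 0) (f := R 3)
    (e := eMul (A 11 (R 3)) (eNot (A 10 (R 3))))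
    (fun i => ∃ y : Fin n, (y : ℕ) = i ∧ y ∈ D₂ ∧ y ∉ D) (fun i => i) (by decide) (by
      intro j hj t ht hFt
      rw [show (s'.setReg 5 0).reg 0 = n by simpa using h0'] at hj
      have e1 := h11' ⟨j, hj⟩
      have e2 := hD ⟨j, hj⟩
      simp only at e1 e2
      refine ⟨?_, by simp [ht]⟩
      simp only [Expr.eval_op, Expr.eval_read, Expr.eval_reg, Expr.eval_lit, BinOp.eval, ht,
        hFt.arr 11 (by decide), hFt.arr 10 (by decide), State.setReg_arr, e1, e2]
      constructor
      · intro h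
        refine ⟨⟨j, hj⟩, rfl, ?_⟩
        by_contra hn
        apply h
        by_cases h1 : (⟨j, hj⟩ : Fin n) ∈ D₂ <;> by_cases h2 : (⟨j, hj⟩ : Fin n) ∈ D <;> simp_all
      · rintro ⟨y, rfl, h1, h2⟩
        simp [h1, h2])
  obtain ⟨y, hy₂, hyD, hy5⟩ : ∃ y ∈ D₂, y ∉ D ∧
      ((loop 3 (ite (eMul (A 11 (R 3)) (eNot (A 10 (R 3)))) (assign 5 (R 3)) skip)).run
        (s'.setReg 5 0)).reg 5 = y := by
    rcases hscan with ⟨-, h⟩ | ⟨-, -, ⟨y, rfl, h1, h2⟩, h3⟩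
    · exfalso
      have hsub : D₂ ⊆ D := fun v hv => by
        by_contra hn
        exact h v (by simp [h0']) ⟨v, rfl, hv, hn⟩
      rw [Finset.eq_of_subset_of_card_le hsub (by rw [hk, hHD.feasible.2])] at hc'
      exact hc'.2 hc'.1
    · exact ⟨y, h1, h2, h3⟩
  set t := (loop 3 (ite (eMul (A 11 (R 3)) (eNot (A 10 (R 3)))) (assign 5 (R 3)) skip)).run
    (s'.setReg 5 0)
  clear_value t
  have hrt : ∀ j, j = 0 ∨ j = 1 ∨ j = 2 → t.reg j = s'.reg j := by
    rintro j (rfl | rfl | rfl) <;>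
      exact (hF1.reg _ (by decide)).trans (by simp)
  have hat : ∀ j, t.arr j = s'.arr j := fun j => hF1.arr j (by simp [arrs])
  -- The vertex `x` is not in `D₂`, hence not in `E`: the tokens that stay behind dominate.
  have hEe : E ⊆ D.erase x := fun v hv =>
    Finset.mem_erase.2 ⟨fun e => hc'.2 (e ▸ h₂ hv), hED hv⟩
  have hdom : IsDominating G (D.erase x) := fun v => by
    rcases hE v with h | ⟨u, h, h'⟩
    · exact .inl (hEe h)
    · exact .inr ⟨u, hEe h, h'⟩
  obtain ⟨g1, g2, g3⟩ := run_moveToken (s := t) (D := D) (x := x) ((hrt 0 (by decide)).trans h0')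
    hT (by rw [hat]; exact h15') (by rw [hat]; exact hD) ((hrt 2 (by decide)).trans hrx) hy5 hc'.1
    hyD hdom (hHD.congr (hrt 1 (by decide)) (hat 3) (hat 4))
  refine ⟨insert y (D.erase x), by simpa using g1,
    fun v hv => Finset.mem_insert_of_mem (hEe hv), g2.congr (by simp) rfl rfl,
    fun v hv hvi => ?_, ?_⟩
  · rcases Finset.mem_insert.1 hv with rfl | hv
    · exact hy₂
    · obtain ⟨h1, h2⟩ := Finset.mem_erase.1 hv
      refine hlt v h2 ?_
      have : (v : ℕ) ≠ i := fun e => h1 (Fin.ext e)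
      omega
  · have h1 := he x
    have h2 := he y
    have h3 := hrt 1 (by decide)
    rw [State.setReg_reg, if_neg (by decide), add_mul]
    omega

end Chain

end TokenReconf

/-! ### The algorithm -/

namespace WordRAM

open FProg

/-- Write down a move from the set in array `20` that is made from the map in array `21`. -/
def jump : FProg := slowDown ;; emit 20 21

/-- Compute the matching and split it. -/
def matching : FProg := auction ;; findGap ;; splitMatching

/-- Write down the last set. -/
def emitLast : FProg := loop 4 (write 3 (ix (R 1) (R 4)) (A 2 (R 4)))

/-- The whole algorithm. -/
def reconfigure : FProg :=
  (closedAdj ;; closedAdjSq ;; matching) ;; (copyArr 1 20 ;; copyArr 12 21 ;; jump) ;;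
  (bfs ;; transfer) ;; (copyArr 11 20 ;; copyArr 13 21 ;; jump) ;; emitLast

theorem reconfigure_ok : reconfigure.ok = true := by decide

theorem reconfigure_depth : reconfigure.depth = 3 := by decide

end WordRAM

namespace TokenReconf

open WordRAM FProg

variable {n : ℕ}

/-- The relation of having distance at most `2`. -/
def Near2 (G : SimpleGraph (Fin n)) (u v : Fin n) : Prop := ∃ w, Near G u w ∧ Near G w v

theorem Near2.symm {G : SimpleGraph (Fin n)} {u v : Fin n} (h : Near2 G u v) : Near2 G v u :=
  let ⟨w, h1, h2⟩ := h
  ⟨w, h2.symm, h1.symm⟩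

theorem Near2.edist_le {G : SimpleGraph (Fin n)} {u v : Fin n} (h : Near2 G u v) :
    G.edist u v ≤ 2 := by
  obtain ⟨w, h1, h2⟩ := h
  exact G.edist_triangle.trans ((add_le_add h1.edist_le h2.edist_le).trans (by norm_num))

theorem Near.near2 {G : SimpleGraph (Fin n)} {u v : Fin n} (h : Near G u v) : Near2 G u v :=
  ⟨v, h, .inl rfl⟩

section Main

variable {G : SimpleGraph (Fin n)} {k : ℕ} {Ds Dt P Q S : Finset (Fin n)} {g σ : Fin n → Fin n}
  {s : State}

/-- All tokens but two slow ones form the exceptional set. For a single token `k - 2` truncates to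
0, and that token is slow. -/
theorem isMove_of_twoSlow (hk : P.card = k) (hg : Set.BijOn g P Q)
    (hH : ∀ x ∈ P, Near2 G x (g x)) (hT : TwoSlow (Near G) P g) : IsMove G (k - 2) 2 P Q g := by
  obtain ⟨r, hr, q, hq, hr', hq', hrq | hP⟩ := hT
  · refine ⟨hg, (P.erase r).erase q, ?_, ?_, fun v hv => ?_, fun v hv => ?_⟩
    · exact (Finset.erase_subset _ _).trans (Finset.erase_subset _ _)
    · rw [Finset.card_erase_of_mem (Finset.mem_erase.2 ⟨hrq.symm, hq⟩),
        Finset.card_erase_of_mem hr, hk]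
      omega
    · have : v = r ∨ v = q := by
        simp only [Finset.mem_sdiff, Finset.mem_erase] at hv
        tauto
      rcases this with rfl | rfl
      · exact hr'.edist_le
      · exact hq'.edist_le
    · exact (hH v (Finset.mem_of_mem_erase (Finset.mem_of_mem_erase hv))).edist_le
  · subst hP
    refine ⟨hg, ∅, by simp, by simp, fun v hv => ?_, by simp⟩
    obtain rfl : v = r := by simpa using hv
    exact hr'.edist_le

theorem run_jump (hE : Env (Near G) (Near2 G) Ds Dt s) (hP : RepS (s.arr 20) P)
    (hg : RepF (s.arr 21) g) (hn : 0 < n) (hbij : Set.BijOn g P Q)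
    (hH : ∀ x ∈ P, Near2 G x (g x)) (hQ : Feasible G k Q) (hS : Hist G k S P s) :
    Hist G k S Q (jump.run s) ∧ (jump.run s).reg 1 ≤ s.reg 1 + 1 := by
  have hfP := hS.feasible
  obtain ⟨g', h1, h2, h3, h4⟩ := run_slowDown hE hP hg hn hbij (fun _ _ h => h.symm)
    (fun _ _ h => h.near2) hH (isDominating_iff.1 hfP.1) (isDominating_iff.1 hQ.1)
  have hF := slowDown.frame s
  refine ⟨(hS.of_frame hF (by decide)).emit ((hE.of_frame hF (by decide)).size) (by decide)
    (by decide) ?_ h1 (isMove_of_twoSlow hfP.2 h2 h3 h4) hQ, ?_⟩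
  · rw [hF.arr 20 (by decide)]
    exact hP
  · rw [jump, run_seq, reg_emit, hF.reg 1 (by decide)]
    split_ifs <;> omega

theorem bijOn_filter_invol (hσ : ∀ v, σ (σ v) = v) (D : Finset (Fin n)) :
    Set.BijOn σ D (Finset.univ.filter fun v => σ v ∈ D) := by
  refine ⟨fun v hv => by simpa [hσ] using hv, fun u _ v _ h => ?_, fun v hv => ⟨σ v, ?_, hσ v⟩⟩
  · rw [← hσ u, h, hσ]
  · simpa using hv

theorem bijOn_filter_invol' (hσ : ∀ v, σ (σ v) = v) (D : Finset (Fin n)) :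
    Set.BijOn σ (Finset.univ.filter fun v => σ v ∈ D) D := by
  refine ⟨fun v hv => by simpa using hv, fun u _ v _ h => ?_, fun v hv => ⟨σ v, ?_, hσ v⟩⟩
  · rw [← hσ u, h, hσ]
  · simpa [hσ] using hv

theorem card_filter_invol (hσ : ∀ v, σ (σ v) = v) (D : Finset (Fin n)) :
    (Finset.univ.filter fun v => σ v ∈ D).card = D.card :=
  have h := bijOn_filter_invol' hσ D
  Finset.card_nbij σ h.mapsTo h.injOn h.surjOn

theorem run_matching (hE : Env (Near G) (Near2 G) Ds Dt s) (h8 : ∀ i, s.arr 8 i = 0)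
    (h9 : ∀ i, s.arr 9 i = 0) (hn : 0 < n) (hs : Dom (Near G) Ds) (ht : Dom (Near G) Dt) :
    ∃ (σ τ : Fin n → Fin n) (E : Finset (Fin n)), (∀ v, σ (σ v) = v) ∧ (∀ v, τ (τ v) = v) ∧
      (∀ v, Near2 G v (σ v)) ∧ (∀ v, Near2 G v (τ v)) ∧ IsDominating G E ∧
      (E ⊆ Finset.univ.filter fun v => σ v ∈ Ds) ∧ (E ⊆ Finset.univ.filter fun v => τ v ∈ Dt) ∧
      RepF ((matching.run s).arr 12) σ ∧ RepF ((matching.run s).arr 13) τ ∧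
      RepS ((matching.run s).arr 10) (Finset.univ.filter fun v => σ v ∈ Ds) ∧
      RepS ((matching.run s).arr 11) (Finset.univ.filter fun v => τ v ∈ Dt) := by
  obtain ⟨mt, pr, dd, hA, hI, hend⟩ := run_auction hE h8 h9
  have hE1 := hE.run auction (by decide)
  obtain ⟨u, hu, -⟩ := hs ⟨0, hn⟩
  -- `Ds` is nonempty, so there are fewer than `n` prices and a gap lies below the cap `n`.
  have hY : (Dt \ Ds).card < n := by
    have h1 : Dt \ Ds ⊂ Finset.univ :=
      Finset.ssubset_univ_iff.2 fun e => by
        have := Finset.mem_univ u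
        rw [← e] at this
        exact (Finset.mem_sdiff.1 this).2 hu
    simpa using Finset.card_lt_card h1
  obtain ⟨hp, hgap⟩ := run_findGap hE1 hA hY
  have hF2 := findGap.frame (auction.run s)
  obtain ⟨h12, h13, h10, h11⟩ := run_splitMatching (hE1.of_frame hF2 (by decide))
    (hA.of_frame hF2 (by decide)) rfl
  obtain ⟨E, hEd, hEs, hEt⟩ := hI.exists_core hend hp hgap hs ht
    fun u v w h1 h2 => ⟨w, Near.symm h1, h2⟩
  have hrefl : ∀ v, Near2 G v v := fun v => Near.near2 (.inl rfl)
  have hmt := hI.rel_mt hrefl (fun _ _ h => h.symm)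
  refine ⟨_, _, E, partSwap_invol hI.inv _, partSwap'_invol hI.inv _, fun v => ?_, fun v => ?_,
    isDominating_iff.2 hEd, fun v hv => ?_, fun v hv => ?_, h12, h13, h10, h11⟩
  · unfold partSwap
    split_ifs
    · exact hmt v
    · exact hrefl v
  · unfold partSwap'
    split_ifs
    · exact hrefl v
    · exact hmt v
  · simpa using hEs v hv
  · simpa using hEt v hv

theorem run_emitLast (h0 : s.reg 0 = n) (h2 : RepS (s.arr 2) Dt) (hH : Hist G k Ds Dt s) :
    ∃ D f, IsOutput (emitLast.run s) (s.reg 1) D f ∧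
      IsReconfSequence G (Feasible G k) (k - 2) 2 Ds Dt (s.reg 1) D f := by
  obtain ⟨-, D, f, hD, hout⟩ := hH
  have hF := emitLast.frame s
  have key := loop_inv (x := 4) (s := s) (p := write 3 (ix (R 1) (R 4)) (A 2 (R 4)))
    (fun i s' => (∀ v < i, s'.arr 3 (s.reg 1 * n + v) = s.arr 2 v) ∧
      ∀ m < s.reg 1 * n, s'.arr 3 m = s.arr 3 m) (by decide) (by simp) (by
      rintro i s' - hr hF ⟨hI1, hI2⟩
      have h0' : s'.reg 0 = n := (hF.reg 0 (by decide)).trans h0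
      have h1' : s'.reg 1 = s.reg 1 := hF.reg 1 (by decide)
      have h2' : s'.arr 2 = s.arr 2 := hF.arr 2 (by decide)
      constructor
      · intro v hv
        by_cases hvi : v = i
        · subst hvi
          simp [BinOp.eval, h0', h1', hr, h2']
        · have hne : s.reg 1 * n + v ≠ s.reg 1 * n + i := by omega
          simpa [BinOp.eval, h0', h1', hr, Function.update_of_ne hne] using hI1 v (by omega)
      · intro m hm
        have hne : m ≠ s.reg 1 * n + i := by omega
        simpa [BinOp.eval, h0', h1', hr, Function.update_of_ne hne] using hI2 m hm)
  rw [h0] at key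
  obtain ⟨key1, key2⟩ := key
  refine ⟨D, f, ⟨hF.reg 1 (by decide), fun i hi v => ?_, fun i hi v hv => ?_⟩, hD⟩
  · rcases hi.lt_or_eq with hi | rfl
    · have hidx : i * n + v < s.reg 1 * n := by
        have := v.2
        have : (i + 1) * n ≤ s.reg 1 * n := Nat.mul_le_mul_right _ hi
        rw [add_mul, one_mul] at this
        omega
      exact (key2 _ hidx).trans ((hout i hi).1 v)
    · rw [hD.finish]
      exact (key1 v v.2).trans (h2 v)
  · rw [hF.arr 4 (by decide)]
    exact (hout i hi).2 v hv

end Main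

end TokenReconf

/-! ### Assembling the algorithm and its bounds -/

namespace TokenReconf

open WordRAM FProg

variable {n : ℕ}

section Main

variable {G : SimpleGraph (Fin n)} {k : ℕ} {Ds Dt : Finset (Fin n)} {s : State}

theorem inputState_bdd : (inputState G Ds Dt).Bdd (n + 1) := by
  refine ⟨fun x => ?_, fun a i => ?_⟩
  · simp only [inputState]
    split_ifs <;> omega
  · simp only [inputState]
    split_ifs <;> omega

theorem env_inputState : Env (Near G) (Near2 G) Ds Dt
    (closedAdjSq.run (closedAdj.run (inputState G Ds Dt))) := by
  set s := inputState G Ds Dt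
  have h0 : s.reg 0 = n := rfl
  have hadj : RepM (s.arr 0) G.Adj := fun u v => by
    simp only [s, inputState, if_true]
    constructor
    · intro h
      by_contra hn
      refine h (if_neg ?_)
      rintro ⟨u', v', he, hadj⟩
      obtain ⟨h1, h2⟩ := (mul_add_inj v.2 v'.2).1 he
      exact hn (by rwa [Fin.ext h1, Fin.ext h2])
    · intro h
      rw [if_pos ⟨u, v, rfl, h⟩]
      exact one_ne_zero
  have hset : ∀ (D : Finset (Fin n)) (v : Fin n),
      (∃ u ∈ D, (v : ℕ) = (u : ℕ)) ↔ v ∈ D := fun D v =>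
    ⟨fun ⟨u, hu, he⟩ => by rwa [Fin.ext he], fun h => ⟨v, h, rfl⟩⟩
  have h1 := closedAdj.frame s
  have h2 := closedAdjSq.frame (closedAdj.run s)
  have h5 := run_closedAdj h0 hadj
  have h01 : (closedAdj.run s).reg 0 = n := (h1.reg 0 (by decide)).trans h0
  have h6 := run_closedAdjSq h01 h5 (fun i => by
    rw [h1.arr 6 (by decide)]
    simp [s, inputState])
  refine ⟨?_, fun v => ?_, fun v => ?_, ?_, h6⟩
  · rw [h2.reg 0 (by decide), h01]
  · rw [h2.arr 1 (by decide), h1.arr 1 (by decide)]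
    simp only [s, inputState, hset]
    simp
  · rw [h2.arr 2 (by decide), h1.arr 2 (by decide)]
    simp only [s, inputState, hset]
    simp
  · rw [h2.arr 5 (by decide)]
    exact h5

theorem Hist.start (hD : Feasible G k Ds) (h1 : s.reg 1 = 0) : Hist G k Ds Ds s := by
  refine ⟨fun _ => h1, fun _ => Ds, fun _ => id, ⟨rfl, rfl, fun _ _ => hD, ?_⟩, ?_⟩ <;>
  · rw [h1]
    intro i hi
    omega

theorem run_reconfigure (hG : G.Connected) (hs : Feasible G k Ds) (ht : Feasible G k Dt) :
    ∃ l D f, IsOutput (reconfigure.run (inputState G Ds Dt)) l D f ∧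
      IsReconfSequence G (Feasible G k) (k - 2) 2 Ds Dt l D f ∧ (n ≤ 1 → l = 0) ∧
      ∀ e, (∀ u v, G.dist u v ≤ e) → l ≤ 2 + n * (2 * e) := by
  have hn : 0 < n := Fin.pos_iff_nonempty.2 hG.nonempty
  have hE2 := env_inputState (G := G) (Ds := Ds) (Dt := Dt)
  have hF2 : Frame [2, 3, 4] [5, 6] (inputState G Ds Dt)
      (closedAdjSq.run (closedAdj.run (inputState G Ds Dt))) :=
    ((closedAdj.frame _).mono (by decide) (by decide)).trans
      ((closedAdjSq.frame _).mono (by decide) (by decide))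
  have hz : ∀ a i, a ∉ [0, 1, 2, 5, 6] →
      (closedAdjSq.run (closedAdj.run (inputState G Ds Dt))).arr a i = 0 := fun a i ha => by
    rw [hF2.arr a (fun h => ha (by simp at h ⊢; tauto))]
    simp only [List.mem_cons, not_or] at ha
    simp [inputState, ha]
  have hr2 : (closedAdjSq.run (closedAdj.run (inputState G Ds Dt))).reg 1 = 0 :=
    hF2.reg 1 (by decide)
  simp only [reconfigure, run_seq]
  generalize closedAdjSq.run (closedAdj.run (inputState G Ds Dt)) = s2 at *
  -- the first move
  obtain ⟨σ, τ, E, hσ, hτ, hσ2, hτ2, hEd, hE₁, hE₂, h12, h13, h10, h11⟩ :=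
    run_matching hE2 (fun i => hz 8 i (by decide)) (fun i => hz 9 i (by decide)) hn
      (isDominating_iff.1 hs.1) (isDominating_iff.1 ht.1)
  have hfeas : ∀ D : Finset (Fin n), E ⊆ D → D.card = k → Feasible G k D := fun D h hk =>
    ⟨fun v => (hEd v).imp (fun hv => h hv) fun ⟨u, hu, huv⟩ => ⟨u, h hu, huv⟩, hk⟩
  have hf₁ := hfeas _ hE₁ ((card_filter_invol hσ Ds).trans hs.2)
  have hf₂ := hfeas _ hE₂ ((card_filter_invol hτ Dt).trans ht.2)
  have hF3 := matching.frame s2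
  have hH3 := Hist.start (s := matching.run s2) hs ((hF3.reg 1 (by decide)).trans hr2)
  have hE3 := hE2.of_frame hF3 (by decide)
  have hz3 : ∀ a i, a = 14 ∨ a = 15 → (matching.run s2).arr a i = 0 := by
    rintro a i (rfl | rfl) <;> rw [hF3.arr _ (by decide)] <;> exact hz _ i (by decide)
  have hr3 : (matching.run s2).reg 1 = 0 := (hF3.reg 1 (by decide)).trans hr2
  generalize matching.run s2 = s3 at *
  have hFa := (copyArr 1 20).frame s3
  have hEa := hE3.of_frame hFa (by decide)
  have h20 := RepS.copy hE3.size (show 1 ≠ 20 by decide) hE3.source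
  rw [← hFa.arr 12 (by decide)] at h12
  have hFb := (copyArr 12 21).frame ((copyArr 1 20).run s3)
  have h21 := RepF.copy hEa.size (show 12 ≠ 21 by decide) h12
  rw [← hFb.arr 20 (by decide)] at h20
  have hEb := hEa.of_frame hFb (by decide)
  obtain ⟨hH5, hc5⟩ := run_jump hEb h20 h21 hn (bijOn_filter_invol hσ Ds) (fun v _ => hσ2 v) hf₁
    ((hH3.of_frame hFa (by decide)).of_frame hFb (by decide))
  have hF5 : Frame (copyArr 1 20 ;; copyArr 12 21 ;; jump).regs
    (copyArr 1 20 ;; copyArr 12 21 ;; jump).arrs s3 _ := FProg.frame _ s3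
  simp only [run_seq] at hF5
  have hE5 := hE3.of_frame hF5 (by decide)
  rw [hFb.reg 1 (by decide), hFa.reg 1 (by decide), hr3] at hc5
  have hz5 : ∀ a i, a = 14 ∨ a = 15 →
      (jump.run ((copyArr 12 21).run ((copyArr 1 20).run s3))).arr a i = 0 := by
    rintro a i (rfl | rfl) <;> rw [hF5.arr _ (by decide)] <;> exact hz3 _ i (by decide)
  rw [← hF5.arr 13 (by decide)] at h13
  rw [← hF5.arr 10 (by decide)] at h10
  rw [← hF5.arr 11 (by decide)] at h11
  generalize jump.run ((copyArr 12 21).run ((copyArr 1 20).run s3)) = s5 at *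
  -- the tokens move one by one
  obtain ⟨dep, par, -, h15, hT, hdep⟩ := run_bfs hE5 hG hn (fun i => hz5 14 i (by decide))
    (fun i => hz5 15 i (by decide))
  have hF6 := bfs.frame s5
  have hE6 := hE5.of_frame hF6 (by decide)
  rw [← hF6.arr 13 (by decide)] at h13
  rw [← hF6.arr 10 (by decide)] at h10
  rw [← hF6.arr 11 (by decide)] at h11
  have htr := fun e (he : ∀ v, dep v ≤ e + 1) => run_transfer hE6.size hT h15 he h10 h11 hEd hE₁
    hE₂ hf₂.2 (hH5.of_frame hF6 (by decide))
  rw [hF6.reg 1 (by decide)] at htr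
  -- The history does not depend on the bound for the depths, so any admissible value serves here.
  have hH7 := (htr n fun v => (hT.le v).trans (by omega)).1
  have hc7 := fun e (he : ∀ u v, G.dist u v ≤ e) =>
    (htr e fun v => (hdep v).trans (Nat.succ_le_succ (he _ v))).2
  have hF7 := transfer.frame (bfs.run s5)
  have hE7 := hE6.of_frame hF7 (by decide)
  rw [← hF7.arr 13 (by decide)] at h13
  rw [← hF7.arr 11 (by decide)] at h11
  generalize transfer.run (bfs.run s5) = s7 at *
  -- the last move
  have hFa := (copyArr 11 20).frame s7
  have hEa := hE7.of_frame hFa (by decide)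
  have h20 := RepS.copy hE7.size (show 11 ≠ 20 by decide) h11
  rw [← hFa.arr 13 (by decide)] at h13
  have hFb := (copyArr 13 21).frame ((copyArr 11 20).run s7)
  have h21 := RepF.copy hEa.size (show 13 ≠ 21 by decide) h13
  rw [← hFb.arr 20 (by decide)] at h20
  have hEb := hEa.of_frame hFb (by decide)
  obtain ⟨hH9, hc9⟩ := run_jump hEb h20 h21 hn (bijOn_filter_invol' hτ Dt) (fun v _ => hτ2 v) ht
    ((hH7.of_frame hFa (by decide)).of_frame hFb (by decide))
  have hE9 := hEb.of_frame (jump.frame _) (by decide)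
  rw [hFb.reg 1 (by decide), hFa.reg 1 (by decide)] at hc9
  obtain ⟨D, f, hout, hD⟩ := run_emitLast hE9.size hE9.target hH9
  refine ⟨_, D, f, hout, hD, hH9.1, fun e he => ?_⟩
  have := hc7 e he
  omega

end Main

theorem exists_reconfigure_steps : ∃ K c : ℕ, ∀ (n : ℕ) (G : SimpleGraph (Fin n))
    (Ds Dt : Finset (Fin n)),
    ∃ t, WordRAM.Exec ((n + 2) ^ c) WordRAM.reconfigure.compile (inputState G Ds Dt) t
      (WordRAM.reconfigure.run (inputState G Ds Dt)) ∧ t ≤ K * (n + 1) ^ 3 := by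
  obtain ⟨K, c, h⟩ := WordRAM.FProg.exists_exec _ WordRAM.reconfigure_ok
  rw [WordRAM.reconfigure_depth] at h
  exact ⟨K, c, fun n G Ds Dt => h _ inputState_bdd⟩

end TokenReconf

theorem mainTheorem2 :
    ∃ (p : WordRAM.Prog) (C c : ℕ),
      ∀ (n k : ℕ) (G : SimpleGraph (Fin n)) (Ds Dt : Finset (Fin n)),
        G.Connected →
        TokenReconf.IsDominating G Ds → Ds.card = k →
        TokenReconf.IsDominating G Dt → Dt.card = k →
        ∃ (t : ℕ) (s : WordRAM.State) (l : ℕ) (D : ℕ → Finset (Fin n)) (f : ℕ → Fin n → Fin n),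
          WordRAM.Exec ((n + 2) ^ c) p (TokenReconf.inputState G Ds Dt) t s ∧
          TokenReconf.IsOutput s l D f ∧
          TokenReconf.IsReconfSequence G
            (fun A => TokenReconf.IsDominating G A ∧ A.card = k) (k - 2) 2 Ds Dt l D f ∧
          (∀ d : ℕ, G.ediam ≤ d → l ≤ C * (n * d)) ∧
          (t : ℝ) ≤ C * ((n : ℝ) ^ (7 / 2 : ℝ) + (n : ℝ) ^ 2 * (G.edgeSet.ncard : ℝ)) := by
  obtain ⟨K, c, hK⟩ := TokenReconf.exists_reconfigure_steps
  -- `8 * K` comes from `(n + 1) ^ 3 ≤ (2 * n) ^ 3`, and 4 from `2 + 2 * n * d ≤ 4 * n * d` when `n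
  -- * d ≥ 1`.
  refine ⟨WordRAM.reconfigure.compile, 8 * K + 4, c, fun n k G Ds Dt hG hs hsk ht htk => ?_⟩
  obtain ⟨t, hexec, htime⟩ := hK n G Ds Dt
  obtain ⟨l, D, f, hout, hD, hl0, hl⟩ := TokenReconf.run_reconfigure hG ⟨hs, hsk⟩ ⟨ht, htk⟩
  have hn : 0 < n := Fin.pos_iff_nonempty.2 hG.nonempty
  refine ⟨t, _, l, D, f, hexec, hout, hD, fun d hd => ?_, ?_⟩
  · have hdist : ∀ u v, G.dist u v ≤ d := fun u v => by
      have h1 : G.edist u v ≤ d := SimpleGraph.edist_le_ediam.trans hd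
      rw [← (hG.preconnected u v).coe_dist_eq_edist] at h1
      exact_mod_cast h1
    rcases Nat.lt_or_ge 1 n with h1 | h1
    · have h2 := hl d hdist
      have hd1 : 1 ≤ d := by
        refine le_trans ?_ (hdist ⟨0, hn⟩ ⟨1, h1⟩)
        exact (hG.preconnected _ _).pos_dist_of_ne (by simp)
      have h3 : 1 ≤ n * d := Nat.mul_pos hn hd1
      calc l ≤ 2 + n * (2 * d) := h2
        _ ≤ 4 * (n * d) := by linarith
        _ ≤ (8 * K + 4) * (n * d) := Nat.mul_le_mul_right _ (by omega)
    · rw [hl0 h1]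
      exact Nat.zero_le _
  · have hn1 : (1 : ℝ) ≤ n := by exact_mod_cast hn
    -- The cubic running time fits into the first summand; of the second only nonnegativity is
    -- needed.
    have h1 : (n : ℝ) ^ 3 ≤ (n : ℝ) ^ (7 / 2 : ℝ) := by
      rw [← Real.rpow_natCast]
      exact Real.rpow_le_rpow_of_exponent_le hn1 (by norm_num)
    have h2 : t ≤ 8 * K * n ^ 3 := by
      refine htime.trans ?_
      calc K * (n + 1) ^ 3 ≤ K * (2 * n) ^ 3 :=
            Nat.mul_le_mul_left _ (Nat.pow_le_pow_left (by omega) _)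
        _ = 8 * K * n ^ 3 := by ring
    have h3 : (t : ℝ) ≤ 8 * K * (n : ℝ) ^ 3 := by exact_mod_cast h2
    have h4 : (0 : ℝ) ≤ (n : ℝ) ^ 2 * (G.edgeSet.ncard : ℝ) := by positivity
    have h5 : (0 : ℝ) ≤ (n : ℝ) ^ 3 := by positivity
    push_cast
    calc (t : ℝ) ≤ 8 * K * (n : ℝ) ^ 3 := h3
      _ ≤ (8 * K + 4) * (n : ℝ) ^ 3 := by nlinarith
      _ ≤ (8 * K + 4) * ((n : ℝ) ^ (7 / 2 : ℝ) + (n : ℝ) ^ 2 * (G.edgeSet.ncard : ℝ)) := by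
        refine mul_le_mul_of_nonneg_left (by linarith) (by positivity)
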